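/- **Notation.** Vectors are in $\mathbb R^d$; $\log$ is the natural logarithm. For a diagonal matrix $C\succ 0$ let $\|x\|_C=(x^\top Cx)^{1/2}$, and let $\mathrm{diam}_\infty$, $\mathrm{diam}_{C^{-1}}$ be diameters in $\|\cdot\|_\infty$ and $\|\cdot\|_{C^{-1}}$. Let $P$ be a distribution on $\mathbb R^d$, $\sigma_j=\mathbb E_{z\sim P}[z_j^2]^{1/2}$, $G_q(C)=\mathbb E_{z\sim P}[\|z\|_C^q]^{1/q}$, and for a dataset $S=(s_1,\dots,s_n)$ let $\hat G_q(S;C)=(\frac1n\sum_i\|s_i\|_C^q)^{1/q}$. $P$ has *bounded moment ratio* $r$ if every $z_j$ is $r^2\sigma_j^2$-sub-Gaussian: $\mathbb E\,e^{s(z_j-\mathbb Ez_j)}\le e^{r^2\sigma_j^2s^2/2}$ for all $s\in\mathbb R$. **Moment estimation.** Input: $z_1,\dots,z_n\in\mathbb R^d$, a number of iterates $T$, and $r,\varepsilon,\delta$. For $t=1,\dots,T$ let $\rho_t=4r\log r/2^{t-1}$, and for each coordinate $j$ not yet set compute $$\hat\sigma_{t,j}^2=\frac1n\sum_{i=1}^n\min(z_{i,j}^2,\rho_t^2)+\xi_{t,j},\qquad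 \xi_{t,j}\sim N\Bigl(0,\ 2\log\tfrac{1.25\,T}{\delta}\cdot\Bigl(\tfrac{\sqrt d\,\rho_t^2\,T}{n\varepsilon}\Bigr)^2\Bigr)\ \text{independent};$$ if $\hat\sigma_{t,j}^2\ge(2^{-t-1})^2$, set $\hat\sigma_j=2^{-t}$. Coordinates never set get $\hat\sigma_j=2^{-T}$. **PAGAN.** Let $X\subset\mathbb R^d$ be compact and convex with more than one point. For each $z\in\mathbb R^d$ let $F(\cdot;z)$ be convex on $X$, with a Borel choice of subgradients $g(x;z)\in\partial F(x;z)$, $x\in X$, satisfying $|g_j(x;z)|\le|z_j|$ for all $j$ (e.g. $F(x;z)=\langle x,z\rangle$, $g=z$). For a dataset $S$ put $f(x;S)=\frac1n\sum_iF(x;s_i)$. Given $C\succ0$ diagonal, $p\ge1$, $\kappa,c>0$, put $T=\lceil cn^2\rceil$, $A=C/B^2$, $$B=\kappa\,G_{2p}(C)\Bigl(\frac{\mathrm{diam}_{C^{-1}}(X)\,n\varepsilon}{\mathrm{diam}_\infty(X)\sqrt{\log(1/\delta)}\ \mathrm{tr}(C^{-1/2})}\Bigr)^{1/p}.$$ Starting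 at any $x^0\in X$, for $k=0,\dots,T-1$: draw one data point $s_{i_k}$ uniformly from $S$, let $g^k=g(x^k;s_{i_k})$, let $\tilde g^k$ be its Euclidean projection onto $\{x:\|x\|_A\le1\}$, let $\hat g^k=\tilde g^k+\frac{\sqrt{\log(1/\delta)}}{\varepsilon}\zeta^k$ with fresh independent $\zeta^k\sim N(0,A^{-1})$, let $H_k=\mathrm{diag}(\sum_{i\le k}\hat g^i\hat g^{i\top})^{1/2}/\mathrm{diam}_\infty(X)$, and let $x^{k+1}$ be the projection of $x^k-H_k^{-1}\hat g^k$ onto $X$ in $\|\cdot\|_{H_k}$. Return $\bar x^T=\frac1T\sum_{k=1}^Tx^k$. Put $R_{\rm ada}(T)=\frac1T\sum_j\mathbb E\bigl[(\sum_{k=0}^{T-1}(g^k_j)^2)^{1/2}\bigr]$. Expectations are over the internal randomness of PAGAN. **Theorem.** Let $\varepsilon\in(0,1]$, $\delta\in(0,1)$. 1. (Privacy.) For all $d,n,T$ and all $r\in\mathbb R$, moment estimation is $(\varepsilon,\delta)$-differentially private: for all datasets $S,S'\in(\mathbb R^d)^n$ that differ in at most one entry and all measurable $O$, $\Pr(M(S)\in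 O)\le e^\varepsilon\Pr(M(S')\in O)+\delta$. For 2 and 3 let $d\ge2$, $\beta\in(0,1)$, and let $P$ have bounded moment ratio $r\ge2$ with $\sigma_j\le1$ for all $j$. Run moment estimation on an i.i.d. sample $z=(z_1,\dots,z_n)$ from $P$ with $T_0=\lceil2\log_2d\rceil$ iterates, where $$n\ge400\,r^4\log\tfrac{8d}\beta,\qquad n\varepsilon\ge1000\,r^2\,T_0\sqrt d\,\log^2r\,\log\tfrac{T_0}\delta\,\log\tfrac{4d}\beta .$$ 2. (Accuracy.) With probability at least $1-\beta$, for all $j$, $$\tfrac12\max(\sigma_j,d^{-2})\le\hat\sigma_j\le8\max(\sigma_j,d^{-2}).$$ 3. (Rate.) For all $\kappa\ge2$, $c>0$ there is $K$ depending only on $\kappa,c$ such that the following holds for all $p\ge1$ and all $X,F,g$ as above, provided $\sum_j\sigma_j^{2/3}\ge d^{-1/3}$ (e.g. if $\max_j\sigma_j=1$, or if all $\sigma_j\ge d^{-2}$). Let $\hat C_{jj}=\frac14(r\hat\sigma_j)^{-4/3}$. With probability at least $1-\beta$, for every dataset $S\in(\mathbb R^d)^n$ with $\hat G_p(S;\hat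 C)\le\kappa\,G_{2p}(\hat C)$, PAGAN run on $S$ with $C=\hat C$ satisfies $$\mathbb E\bigl[f(\bar x^T;S)-\min_{x\in X}f(x;S)\bigr]\le K\,\mathrm{diam}_\infty(X)\Bigl[R_{\rm ada}(T)+\frac{r\,(\sum_j\sigma_j^{2/3})^{3/2}}{n\varepsilon}\sqrt{p\log\tfrac d\delta}\,(n\varepsilon)^{1/p}\Bigr];$$ and, if $p=\log d$ and $n\varepsilon\le d^q$ with $q\ge0$, $$\mathbb E\bigl[f(\bar x^T;S)-\min_{x\in X}f(x;S)\bigr]\le K e^q\,\mathrm{diam}_\infty(X)\Bigl[R_{\rm ada}(T)+\frac{r\,(\sum_j\sigma_j^{2/3})^{3/2}}{n\varepsilon}\log\tfrac d\delta\Bigr],$$ which is the rate of the known-covariance choice $C_{jj}=(r\sigma_j)^{-4/3}$. If $\kappa\ge16$, then with probability at least $1-\beta-\frac1n$ these bounds hold for PAGAN run on $S=z$, the sample used for the estimation. -/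

import Mathlib

open MeasureTheory ProbabilityTheory

noncomputable section

namespace Pagan

/-! ### Norms, projections and diameters -/

/-- The Mahalanobis norm `‖x‖_W = √(xᵀ W x)` of the diagonal matrix `W = diag(w)`. -/
def wnorm {d : ℕ} (w x : Fin d → ℝ) : ℝ := Real.sqrt (∑ j, w j * x j ^ 2)

/-- The projection `argmin {‖y - x‖_W : y ∈ S}` onto `S` with respect to `‖·‖_W`, `W = diag(w)`
(for `w > 0` and `S` nonempty, closed and convex there is exactly one minimizer). -/
def wproj {d : ℕ} (w : Fin d → ℝ) (S : Set (Fin d → ℝ)) (x : Fin d → ℝ) : Fin d → ℝ :=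
  Classical.epsilon fun p => p ∈ S ∧ ∀ y ∈ S, wnorm w (p - x) ≤ wnorm w (y - x)

/-- The ellipsoid `{x : ‖x‖_A ≤ 1}`, `A = diag(a)`. -/
def ellipsoid {d : ℕ} (a : Fin d → ℝ) : Set (Fin d → ℝ) := {x | wnorm a x ≤ 1}

/-- The diameter of `X` with respect to `‖·‖_W`, `W = diag(w)`. The diameter with respect to the
sup norm is `Metric.diam X`, the metric of `Fin d → ℝ` being the sup metric. -/
def wdiam {d : ℕ} (w : Fin d → ℝ) (X : Set (Fin d → ℝ)) : ℝ :=
  sSup {t | ∃ x ∈ X, ∃ y ∈ X, t = wnorm w (x - y)}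

/-! ### Differential privacy -/

/-- `(ε, δ)`-differential privacy of a randomized algorithm, given by the law `M S` of its output
on the dataset `S`. Neighboring datasets differ in at most one entry. -/
def IsDP {n : ℕ} {Z O : Type*} [MeasurableSpace O]
    (M : (Fin n → Z) → Measure O) (ε δ : ℝ) : Prop :=
  (∀ S, IsProbabilityMeasure (M S)) ∧
    ∀ S S' : Fin n → Z, (∃ i, ∀ l, l ≠ i → S l = S' l) →
      ∀ U : Set O, MeasurableSet U →
        M S U ≤ ENNReal.ofReal (Real.exp ε) * M S' U + ENNReal.ofReal δ

/-! ### Second moments and the bounded moment ratio -/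

/-- `σ_j = E[z_j²]^{1/2}`. -/
def sigma {d : ℕ} (P : Measure (Fin d → ℝ)) (j : Fin d) : ℝ := Real.sqrt (∫ z, z j ^ 2 ∂P)

/-- Bounded moment ratio: each coordinate `z_j` is `r² σ_j²`-sub-Gaussian, that is,
`E[exp(s (z_j - E z_j))] ≤ exp(r² σ_j² s² / 2)` for all real `s`. -/
def BoundedMomentRatio {d : ℕ} (P : Measure (Fin d → ℝ)) (r : ℝ) : Prop :=
  ∀ j, HasSubgaussianMGF (fun z : Fin d → ℝ => z j - ∫ y, y j ∂P)
    (Real.toNNReal (r ^ 2 * sigma P j ^ 2)) P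

/-! ### Private estimation of the second moments

Iterate `t = 1, …, T` is indexed by `t - 1 : Fin T`. -/

/-- The truncation level `ρ_t = 4 r log r / 2^(t-1)` of iterate `t`; the argument is `t - 1`. -/
def truncLevel (r : ℝ) (k : ℕ) : ℝ := 4 * r * Real.log r / 2 ^ k

/-- The standard deviation of the noise of iterate `t`. The vector of truncated second moments has
`ℓ₂`-sensitivity `√d ρ_t² / n`, and this is the Gaussian mechanism for `(ε/T, δ/T)`-privacy. -/
def noiseStd (d n T : ℕ) (r ε δ : ℝ) (k : ℕ) : ℝ :=
  (Real.sqrt d * truncLevel r k ^ 2 / n) * Real.sqrt (2 * Real.log (1.25 / (δ / T))) / (ε / T)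

/-- The law of the noise: independent centered Gaussians, one for each iterate and coordinate. -/
def noiseLaw (d n T : ℕ) (r ε δ : ℝ) : Measure (Fin T → Fin d → ℝ) :=
  Measure.pi fun k => Measure.pi fun _ =>
    gaussianReal 0 (Real.toNNReal (noiseStd d n T r ε δ k ^ 2))

/-- The noisy truncated second moment
`σ̂_{t,j}² = (1/n) ∑_i min(z_{i,j}², ρ_t²) + ξ_{t,j}`. -/
def noisyMoment {d n T : ℕ} (r : ℝ) (z : Fin n → Fin d → ℝ) (ξ : Fin T → Fin d → ℝ)
    (k : Fin T) (j : Fin d) : ℝ :=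
  (1 / (n : ℝ)) * ∑ i, min (z i j ^ 2) (truncLevel r k ^ 2) + ξ k j

/-- The output of the procedure: coordinate `j` is set to `σ̂_j = 2^(-t)` at the first iterate `t`
with `σ̂_{t,j} ≥ 2^(-t-1)` and is left alone afterwards; it gets `2^(-T)` if there is none. -/
def momentOutput {d n T : ℕ} (r : ℝ) (z : Fin n → Fin d → ℝ) (ξ : Fin T → Fin d → ℝ)
    (j : Fin d) : ℝ :=
  match (List.finRange T).find?
      (fun k : Fin T => decide (((1 / 2 : ℝ) ^ ((k : ℕ) + 2)) ^ 2 ≤ noisyMoment r z ξ k j)) with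
  | some k => (1 / 2) ^ ((k : ℕ) + 1)
  | none => (1 / 2) ^ T

/-- The private moment estimation procedure, as the law of its output. -/
def momentMech (d n T : ℕ) (r ε δ : ℝ) (z : Fin n → Fin d → ℝ) : Measure (Fin d → ℝ) :=
  (noiseLaw d n T r ε δ).map fun ξ => momentOutput r z ξ

/-- The number of iterates `⌈2 log₂ d⌉`. -/
def momentIters (d : ℕ) : ℕ := Nat.clog 2 (d ^ 2)

/-- The joint law of an i.i.d. sample of size `n` from `P` and of the noise of the procedure run
with `⌈2 log₂ d⌉` iterates. -/
def sampleLaw {d : ℕ} (P : Measure (Fin d → ℝ)) (n : ℕ) (r ε δ : ℝ) :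
    Measure ((Fin n → Fin d → ℝ) × (Fin (momentIters d) → Fin d → ℝ)) :=
  (Measure.pi fun _ : Fin n => P).prod (noiseLaw d n (momentIters d) r ε δ)

/-- The estimated (diagonal) geometry `Ĉ_jj = (r σ̂_j)^(-4/3) / 4`. -/
def estGeometry {d : ℕ} (r : ℝ) (s : Fin d → ℝ) (j : Fin d) : ℝ :=
  (r * s j) ^ (-(4 / 3 : ℝ)) / 4

/-- "Enough samples", for the estimation of the second moments with failure probability `β`. -/
def EnoughSamples (d n : ℕ) (r ε δ β : ℝ) : Prop :=
  400 * r ^ 4 * Real.log (8 * d / β) ≤ n ∧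
    1000 * r ^ 2 * momentIters d * Real.sqrt d * Real.log r ^ 2 *
      Real.log (momentIters d / δ) * Real.log (4 * d / β) ≤ n * ε

/-! ### Lipschitz moments -/

/-- `G_q(C) = E[‖z‖_C^q]^{1/q}`, `C = diag(c)`. -/
def lipMoment {d : ℕ} (P : Measure (Fin d → ℝ)) (q : ℝ) (C : Fin d → ℝ) : ℝ :=
  (∫ z, wnorm C z ^ q ∂P) ^ (1 / q)

/-- The empirical version `Ĝ_q(S; C) = ((1/n) ∑_i ‖z_i‖_C^q)^{1/q}`. -/
def empLipMoment {d n : ℕ} (S : Fin n → Fin d → ℝ) (q : ℝ) (C : Fin d → ℝ) : ℝ :=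
  ((1 / (n : ℝ)) * ∑ i, wnorm C (S i) ^ q) ^ (1 / q)

/-! ### Private AdaGrad with adaptive noise (PAGAN) -/

/-- The empirical loss `f(x; S) = (1/n) ∑_i F(x; z_i)`. -/
def empLoss {d n : ℕ} (F : (Fin d → ℝ) → (Fin d → ℝ) → ℝ) (S : Fin n → Fin d → ℝ)
    (x : Fin d → ℝ) : ℝ :=
  (1 / (n : ℝ)) * ∑ i, F x (S i)

/-- The loss `F(·; z)` is convex on `X`, `g x z ∈ ∂F(x; z)` is a (Borel) choice of subgradients,
and `z` bounds the gradients of `F(·; z)` coordinatewise. The latter says that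
`‖g x z‖_C ≤ ‖z‖_C` for all diagonal `C ≻ 0`, so that the Lipschitz constant of `F(·; z)` with
respect to `‖·‖_{C⁻¹}` is at most `‖z‖_C`. Linear losses `F(x; z) = ⟨x, z⟩`, with `g x z = z`, are
the case where `z` is the gradient. -/
structure IsGradientOracle {d : ℕ} (X : Set (Fin d → ℝ))
    (F : (Fin d → ℝ) → (Fin d → ℝ) → ℝ) (g : (Fin d → ℝ) → (Fin d → ℝ) → (Fin d → ℝ)) :
    Prop where
  convex : ∀ z, ConvexOn ℝ X fun x => F x z
  measurable : ∀ z, Measurable fun x => g x z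
  subgradient : ∀ z, ∀ x ∈ X, ∀ y ∈ X, F x z + ∑ j, g x z j * (y j - x j) ≤ F y z
  bound : ∀ z, ∀ x ∈ X, ∀ j, |g x z j| ≤ |z j|

/-- The unclipped mini-batch gradient `g^k = (1/b) ∑_i g^{k,i}` at `x`. -/
def batchGrad {d n b : ℕ} (g : (Fin d → ℝ) → (Fin d → ℝ) → (Fin d → ℝ))
    (S : Fin n → Fin d → ℝ) (I : Fin b → Fin n) (x : Fin d → ℝ) : Fin d → ℝ :=
  fun j => (1 / (b : ℝ)) * ∑ i, g x (S (I i)) j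

/-- The private gradient
`ĝ^k = (1/b) ∑_i π_A(g^{k,i}) + (√log(1/δ) / (b ε)) ξ^k`, `A = diag(a)`, with `π_A` the Euclidean
projection onto the ellipsoid of `A`. -/
def privGrad {d n b : ℕ} (g : (Fin d → ℝ) → (Fin d → ℝ) → (Fin d → ℝ))
    (S : Fin n → Fin d → ℝ) (a : Fin d → ℝ) (ε δ : ℝ) (I : Fin b → Fin n)
    (ξ x : Fin d → ℝ) : Fin d → ℝ :=
  fun j => (1 / (b : ℝ)) * ∑ i, wproj (fun _ => 1) (ellipsoid a) (g x (S (I i))) j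
    + Real.sqrt (Real.log (1 / δ)) / (b * ε) * ξ j

/-- A run of PAGAN for `T` iterations on the dataset `S`, with batch size `b`, stepsize parameter
`α` and constant ellipsoid `A = diag(a)`. `ℱ k` is the information before iteration `k`; the batch
`I k` (uniform with replacement) and the noise `ξ k ∼ N(0, A⁻¹)` of iteration `k` are drawn
independently of it and of each other. -/
structure IsPaganRun {d n b : ℕ} {Ω : Type} [mΩ : MeasurableSpace Ω] (ν : Measure Ω)
    (ℱ : Filtration ℕ mΩ) (X : Set (Fin d → ℝ))
    (g : (Fin d → ℝ) → (Fin d → ℝ) → (Fin d → ℝ)) (S : Fin n → Fin d → ℝ)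
    (T : ℕ) (α : ℝ) (a : Fin d → ℝ) (ε δ : ℝ)
    (I : ℕ → Ω → Fin b → Fin n) (ξ x : ℕ → Ω → Fin d → ℝ) : Prop where
  init_mem : ∀ ω, x 0 ω ∈ X
  adapted : ∀ k, Measurable[ℱ k] (x k)
  batch_measurable : ∀ k, Measurable[ℱ (k + 1)] (I k)
  noise_measurable : ∀ k, Measurable[ℱ (k + 1)] (ξ k)
  indep : ∀ k, Indep (MeasurableSpace.comap (fun ω => (I k ω, ξ k ω)) inferInstance) (ℱ k) ν
  law : ∀ k, ν.map (fun ω => (I k ω, ξ k ω)) =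
    (Measure.pi fun _ : Fin b => uniformOn (Set.univ : Set (Fin n))).prod
      (Measure.pi fun j => gaussianReal 0 (Real.toNNReal (a j)⁻¹))
  step : ∀ᵐ ω ∂ν, ∀ k < T,
    let gh : ℕ → Fin d → ℝ := fun i => privGrad g S a ε δ (I i ω) (ξ i ω) (x i ω)
    let H : Fin d → ℝ := fun j => Real.sqrt (∑ i ∈ Finset.range (k + 1), gh i j ^ 2) / α
    x (k + 1) ω = wproj H X (fun j => x k ω j - (H j)⁻¹ * gh k j)

/-- The returned average `(1/T) ∑_{k=1}^T x^k`. -/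
def paganOutput {d : ℕ} {Ω : Type} (T : ℕ) (x : ℕ → Ω → Fin d → ℝ) (ω : Ω) : Fin d → ℝ :=
  fun j => (1 / (T : ℝ)) * ∑ k ∈ Finset.range T, x (k + 1) ω j

/-- The error term of non-private AdaGrad,
`R_ada(T) = (1/T) ∑_j E[(∑_k (g^k_j)²)^{1/2}]`, over the `T` gradients of the run. -/
def adaRegret {d n b : ℕ} {Ω : Type} [MeasurableSpace Ω] (ν : Measure Ω)
    (g : (Fin d → ℝ) → (Fin d → ℝ) → (Fin d → ℝ)) (S : Fin n → Fin d → ℝ) (T : ℕ)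
    (I : ℕ → Ω → Fin b → Fin n) (x : ℕ → Ω → Fin d → ℝ) : ℝ :=
  (1 / (T : ℝ)) * ∑ j, ∫ ω,
    Real.sqrt (∑ k ∈ Finset.range T, batchGrad g S (I k ω) (x k ω) j ^ 2) ∂ν

/-- The radius
`B = κ G_{2p}(C) (diam_{C⁻¹}(X) n ε / (diam_∞(X) √log(1/δ) tr(C^{-1/2})))^{1/p}`. -/
def paganRadius {d : ℕ} (P : Measure (Fin d → ℝ)) (n : ℕ) (X : Set (Fin d → ℝ))
    (κ p ε δ : ℝ) (C : Fin d → ℝ) : ℝ :=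
  κ * lipMoment P (2 * p) C *
    (wdiam (fun j => (C j)⁻¹) X * n * ε /
      (Metric.diam X * Real.sqrt (Real.log (1 / δ)) * ∑ j, C j ^ (-(1 / 2 : ℝ)))) ^ (1 / p)

/-- PAGAN with batch size `1`, `T = ⌈c n²⌉`, `α = diam_∞(X)` and `A = C / B²` attains on the
dataset `S`, up to the factor `K`, the rate of the geometry `C_jj = (r σ_j)^(-4/3)`: first for the
given moment `p`, then in the form this takes for `p = log d` and `n ε` polynomial in `d`. -/
def AttainsRate {d n : ℕ} (P : Measure (Fin d → ℝ)) (X : Set (Fin d → ℝ))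
    (F : (Fin d → ℝ) → (Fin d → ℝ) → ℝ) (g : (Fin d → ℝ) → (Fin d → ℝ) → (Fin d → ℝ))
    (r κ p ε δ c K : ℝ) (C : Fin d → ℝ) (S : Fin n → Fin d → ℝ) : Prop :=
  let T : ℕ := ⌈c * (n : ℝ) ^ 2⌉₊
  let B : ℝ := paganRadius P n X κ p ε δ C
  ∀ (Ω : Type) (mΩ : MeasurableSpace Ω) (ν : Measure Ω) (_ : IsProbabilityMeasure ν)
    (ℱ : Filtration ℕ mΩ) (I : ℕ → Ω → Fin 1 → Fin n) (ξ x : ℕ → Ω → Fin d → ℝ),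
    IsPaganRun ν ℱ X g S T (Metric.diam X) (fun j => C j / B ^ 2) ε δ I ξ x →
    Integrable (fun ω => empLoss F S (paganOutput T x ω)) ν ∧
    ∀ y ∈ X,
      (∫ ω, (empLoss F S (paganOutput T x ω) - empLoss F S y) ∂ν ≤
        K * Metric.diam X * (adaRegret ν g S T I x +
          r * (∑ j, sigma P j ^ (2 / 3 : ℝ)) ^ (3 / 2 : ℝ) / (n * ε) *
            Real.sqrt (p * Real.log (d / δ)) * (n * ε) ^ (1 / p))) ∧
      ∀ q : ℝ, 0 ≤ q → p = Real.log d → n * ε ≤ (d : ℝ) ^ q →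
        ∫ ω, (empLoss F S (paganOutput T x ω) - empLoss F S y) ∂ν ≤
          K * Real.exp q * Metric.diam X * (adaRegret ν g S T I x +
            r * (∑ j, sigma P j ^ (2 / 3 : ℝ)) ^ (3 / 2 : ℝ) / (n * ε) * Real.log (d / δ))

end Pagan

end

/-! Privacy. The output is a function of the `T * d` noisy truncated moments taken together, and
these form a Gaussian vector of which only the mean depends on the data. No composition theorem is
needed: changing one data point moves each mean by at most ρ_t²/n, and the squared shifts divided by
the variances sum to s ≤ ε²/(2 log(1.25/δ)). The log-likelihood ratio ℓ of the two Gaussian laws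
satisfies E exp(tℓ) = exp(t(t+1)s/2) when s is that sum, and the inequality 1 ≤ e^(-u) + e^(tu)/4 at
u = ℓ - ε turns this moment into (ε, δ)-privacy for a suitable order t (`LogRatioBound.measure_le`,
`exists_order_gaussian`).

Accuracy. At scale a = 2^(-t) the test compares the noisy moment with a²/4. With high probability
the noise is below 0.18 a² everywhere, the truncated moment is below 0.07 a² whenever 8σ_j < a, and
it is at least 0.43 a² at the scale a < σ_j ≤ 2a. So no test passes far too early, and one passes by
the scale of σ_j (`momentOutput_bounds`). Sub-Gaussianity keeps a fixed share of the second moment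
below the truncation level (`BoundedMomentRatio.le_truncated`). Chernoff and Gaussian tails with a
union bound over scales and coordinates give the probability.

Rate. Write the sampled gradient as the private gradient, plus the clipping error, minus the noise.
AdaGrad's pathwise regret bound covers the first part. The second is at most diam_{C⁻¹}(X) B
(‖z‖_C/B)^p, and the third has mean zero against the iterate, which is known before the noise is
drawn (`IsPaganRun.regret`). The radius B makes bias and noise comparable, both being governed by
G_{2p}(C) tr(C^(-1/2)). For C_jj ~ (r max(σ_j, d⁻²))^(-4/3), both ∑ C_jj σ_j² and tr(C^(-1/2)) are
controlled by Y = ∑ σ_j^(2/3), so the product is of order r √p Y^(3/2)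
(`BoundedMomentRatio.lipMoment_mul_trace_le`). The floor d⁻² costs d^(-1/3) ≤ Y.

Given accurate estimates the rate is a deterministic implication, hence uniform over all datasets S.
For S = z the estimated geometry depends on the sample, so Chebyshev is applied in the deterministic
`idealGeometry`, and the empirical moment is then transferred, the two geometries being within
constant factors. -/

namespace Pagan

/-! ### Privacy of the moment estimation -/

/-- `μ` has density `exp ℓ` with respect to `μ'`, and the exponential moment of order `t` of the
log-likelihood ratio `ℓ` under `μ` is at most `exp M`. -/
structure LogRatioBound {Ω : Type*} [MeasurableSpace Ω] (μ μ' : Measure Ω) (ℓ : Ω → ℝ)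
    (t M : ℝ) : Prop where
  measurable : Measurable ℓ
  density : μ = μ'.withDensity fun x => ENNReal.ofReal (Real.exp (ℓ x))
  moment : ∫⁻ x, ENNReal.ofReal (Real.exp (t * ℓ x)) ∂μ ≤ ENNReal.ofReal (Real.exp M)

/-- For u > 0 this is AM-GM, e^(-u) + e^u/4 ≥ 1. The factor 1/4 is what brings the constant 1.25 of
the noise within reach. -/
theorem one_le_exp_neg_add_exp_mul (t u : ℝ) (ht : 1 ≤ t) :
    1 ≤ Real.exp (-u) + 1 / 4 * Real.exp (t * u) := by
  rcases le_or_gt u 0 with hu | hu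
  · have h1 : 1 ≤ Real.exp (-u) := Real.one_le_exp (by linarith)
    have h2 := Real.exp_pos (t * u)
    linarith
  · have h1 : Real.exp u ≤ Real.exp (t * u) := Real.exp_le_exp.2 (by nlinarith)
    have h2 : Real.exp (-u) * Real.exp u = 1 := by rw [← Real.exp_add]; simp
    have h3 := Real.exp_pos (-u)
    have h4 := Real.exp_pos u
    nlinarith [sq_nonneg (Real.exp u - 2), mul_pos h3 h4]

/-- Integrate the preceding inequality at u = ℓ - ε over `U` under `μ`: since `μ` has density e^ℓ,
the term e^(ε-ℓ) integrates to e^ε `μ' U`, and the other one is an exponential moment of ℓ. -/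
theorem LogRatioBound.measure_le {Ω : Type*} [MeasurableSpace Ω] {μ μ' : Measure Ω} {ℓ : Ω → ℝ}
    {t M ε δ : ℝ} (h : LogRatioBound μ μ' ℓ t M) (ht : 1 ≤ t)
    (hδ : 1 / 4 * Real.exp (M - t * ε) ≤ δ) {U : Set Ω} (hU : MeasurableSet U) :
    μ U ≤ ENNReal.ofReal (Real.exp ε) * μ' U + ENNReal.ofReal δ := by
  have hℓ := h.measurable
  have hp : ∀ x, (1 : ENNReal) ≤ ENNReal.ofReal (Real.exp ε) * ENNReal.ofReal (Real.exp (-ℓ x))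
      + ENNReal.ofReal (1 / 4 * Real.exp (-(t * ε))) * ENNReal.ofReal (Real.exp (t * ℓ x)) := by
    intro x
    rw [← ENNReal.ofReal_mul (Real.exp_pos _).le, ← ENNReal.ofReal_mul (by positivity),
      ← ENNReal.ofReal_add (by positivity) (by positivity), ← ENNReal.ofReal_one]
    refine ENNReal.ofReal_le_ofReal ((one_le_exp_neg_add_exp_mul t (ℓ x - ε) ht).trans_eq ?_)
    rw [mul_assoc, ← Real.exp_add, ← Real.exp_add]
    ring_nf
  have h1 : ∫⁻ x in U, ENNReal.ofReal (Real.exp (-ℓ x)) ∂μ = μ' U := by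
    rw [h.density, restrict_withDensity hU,
      lintegral_withDensity_eq_lintegral_mul _ (by fun_prop) (by fun_prop)]
    have : ∀ x, ((fun x => ENNReal.ofReal (Real.exp (ℓ x))) *
        fun x => ENNReal.ofReal (Real.exp (-ℓ x))) x = 1 := by
      intro x
      simp only [Pi.mul_apply]
      rw [← ENNReal.ofReal_mul (Real.exp_pos _).le, ← Real.exp_add]
      simp
    simp only [this]
    simp
  calc μ U = ∫⁻ _ in U, 1 ∂μ := by simp
    _ ≤ ∫⁻ x in U, (ENNReal.ofReal (Real.exp ε) * ENNReal.ofReal (Real.exp (-ℓ x))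
      + ENNReal.ofReal (1 / 4 * Real.exp (-(t * ε))) * ENNReal.ofReal (Real.exp (t * ℓ x))) ∂μ :=
        lintegral_mono fun x => hp x
    _ = ENNReal.ofReal (Real.exp ε) * μ' U + ENNReal.ofReal (1 / 4 * Real.exp (-(t * ε))) *
        ∫⁻ x in U, ENNReal.ofReal (Real.exp (t * ℓ x)) ∂μ := by
      rw [lintegral_add_left (by fun_prop), lintegral_const_mul _ (by fun_prop),
        lintegral_const_mul _ (by fun_prop), h1]
    _ ≤ ENNReal.ofReal (Real.exp ε) * μ' U + ENNReal.ofReal δ := by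
      gcongr
      calc _ ≤ ENNReal.ofReal (1 / 4 * Real.exp (-(t * ε))) * ENNReal.ofReal (Real.exp M) := by
            gcongr
            exact (setLIntegral_le_lintegral _ _).trans h.moment
        _ ≤ ENNReal.ofReal δ := by
            rw [← ENNReal.ofReal_mul (by positivity)]
            refine ENNReal.ofReal_le_ofReal (le_trans (le_of_eq ?_) hδ)
            rw [mul_assoc, ← Real.exp_add]
            ring_nf

theorem lintegral_pi_prod {ι : Type*} [Fintype ι] {α : ι → Type*} [∀ i, MeasurableSpace (α i)]
    (μ : ∀ i, Measure (α i)) [∀ i, IsProbabilityMeasure (μ i)] {f : ∀ i, α i → ENNReal}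
    (hf : ∀ i, Measurable (f i)) :
    ∫⁻ x, ∏ i, f i (x i) ∂(Measure.pi μ) = ∏ i, ∫⁻ x, f i x ∂(μ i) := by
  refine (lintegral_prod_eq_prod_lintegral_of_indepFun Finset.univ
    (fun i (x : ∀ i, α i) => f i (x i)) (iIndepFun_pi fun i => (hf i).aemeasurable)
    (fun i => (hf i).comp (measurable_pi_apply i))).trans ?_
  refine Finset.prod_congr rfl fun i _ => ?_
  exact (measurePreserving_eval μ i).lintegral_comp (hf i)

theorem ofReal_exp_sum {ι : Type*} (s : Finset ι) (f : ι → ℝ) :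
    ENNReal.ofReal (Real.exp (∑ i ∈ s, f i)) = ∏ i ∈ s, ENNReal.ofReal (Real.exp (f i)) := by
  rw [Real.exp_sum, ENNReal.ofReal_prod_of_nonneg fun i _ => (Real.exp_pos _).le]

/-- Tensorization: log-likelihood ratios of independent components add, so their exponential moments
multiply. -/
theorem LogRatioBound.pi {ι : Type*} [Fintype ι] {α : ι → Type*} [∀ i, MeasurableSpace (α i)]
    {μ μ' : ∀ i, Measure (α i)} [∀ i, IsProbabilityMeasure (μ i)]
    [∀ i, IsProbabilityMeasure (μ' i)] {ℓ : ∀ i, α i → ℝ} {t : ℝ} {M : ι → ℝ}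
    (h : ∀ i, LogRatioBound (μ i) (μ' i) (ℓ i) t (M i)) :
    LogRatioBound (Measure.pi μ) (Measure.pi μ') (fun x => ∑ i, ℓ i (x i)) t (∑ i, M i) where
  measurable := Finset.measurable_sum _ fun i _ => (h i).measurable.comp (measurable_pi_apply i)
  density := by
    refine Measure.pi_eq fun s hs => ?_
    rw [withDensity_apply _ (.univ_pi hs), ← lintegral_indicator (.univ_pi hs)]
    have h1 : ∀ x : ∀ i, α i, (Set.univ.pi s).indicator
        (fun x => ENNReal.ofReal (Real.exp (∑ i, ℓ i (x i)))) x =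
        ∏ i, (s i).indicator (fun y => ENNReal.ofReal (Real.exp (ℓ i y))) (x i) := by
      intro x
      by_cases hx : x ∈ Set.univ.pi s
      · rw [Set.indicator_of_mem hx, ofReal_exp_sum]
        exact Finset.prod_congr rfl fun i _ => by
          rw [Set.indicator_of_mem (hx i (Set.mem_univ i))]
      · rw [Set.indicator_of_notMem hx]
        simp only [Set.mem_pi, Set.mem_univ, true_imp_iff, not_forall] at hx
        obtain ⟨i, hi⟩ := hx
        exact (Finset.prod_eq_zero (Finset.mem_univ i) (Set.indicator_of_notMem hi _)).symm
    simp only [h1]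
    refine (lintegral_pi_prod μ' fun i => (ENNReal.measurable_ofReal.comp
      (Real.measurable_exp.comp (h i).measurable)).indicator (hs i)).trans ?_
    refine Finset.prod_congr rfl fun i _ => ?_
    rw [lintegral_indicator (hs i), (h i).density, withDensity_apply _ (hs i)]
    rfl
  moment := by
    simp only [Finset.mul_sum, ofReal_exp_sum]
    refine (lintegral_pi_prod μ fun i => ENNReal.measurable_ofReal.comp
      (Real.measurable_exp.comp ((h i).measurable.const_mul t))).trans_le ?_
    exact Finset.prod_le_prod' fun i _ => (h i).moment

/-- The log-ratio of two Gaussians of equal variance is affine, so its moments come from the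
Gaussian mgf. Without noise the laws are Dirac masses, comparable only if they coincide. -/
theorem logRatioBound_gaussianReal (m m' : ℝ) (v : NNReal) (t : ℝ) (hv : v = 0 → m = m') :
    LogRatioBound (gaussianReal m v) (gaussianReal m' v)
      (fun x => (m - m') / v * (x - (m + m') / 2)) t (t * (t + 1) / 2 * ((m - m') ^ 2 / v)) where
  measurable := by fun_prop
  density := by
    by_cases h0 : v = 0
    · subst h0; simp [hv rfl]
    have hv' : (v : ℝ) ≠ 0 := by exact_mod_cast h0
    rw [gaussianReal_of_var_ne_zero _ h0, gaussianReal_of_var_ne_zero _ h0,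
      ← withDensity_mul _ (measurable_gaussianPDF _ _) (by fun_prop)]
    congr 1
    ext x
    simp only [Pi.mul_apply, gaussianPDF]
    rw [← ENNReal.ofReal_mul (gaussianPDFReal_nonneg _ _ _)]
    congr 1
    simp only [gaussianPDFReal]
    conv_rhs => rw [mul_assoc, ← Real.exp_add]
    congr 2
    field_simp
    ring
  moment := by
    by_cases h0 : v = 0
    · subst h0; simp [hv rfl]
    have hv' : (v : ℝ) ≠ 0 := by exact_mod_cast h0
    have hI : Integrable (fun x => Real.exp (t * ((m - m') / v * (x - (m + m') / 2))))
        (gaussianReal m v) := by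
      have := (integrable_exp_mul_gaussianReal (μ := m) (v := v) (t * ((m - m') / v))).mul_const
        (Real.exp (-(t * ((m - m') / v) * ((m + m') / 2))))
      refine this.congr (Filter.Eventually.of_forall fun x => ?_)
      simp only
      rw [← Real.exp_add]; ring_nf
    rw [← ofReal_integral_eq_lintegral_ofReal hI
      (Filter.Eventually.of_forall fun x => (Real.exp_pos _).le)]
    refine ENNReal.ofReal_le_ofReal (le_of_eq ?_)
    have h1 : ∀ x, Real.exp (t * ((m - m') / v * (x - (m + m') / 2))) =
        Real.exp (t * ((m - m') / v) * x) *
          Real.exp (-(t * ((m - m') / v) * ((m + m') / 2))) := by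
      intro x; rw [← Real.exp_add]; ring_nf
    simp only [h1]
    rw [integral_mul_const]
    have h2 : ∫ x, Real.exp (t * ((m - m') / v) * x) ∂(gaussianReal m v) =
        mgf (fun x => x) (gaussianReal m v) (t * ((m - m') / v)) := rfl
    rw [h2, mgf_fun_id_gaussianReal]
    simp only
    rw [← Real.exp_add]
    congr 1
    field_simp
    ring

/-- The trade-off of the Gaussian mechanism: `s` bounds the squared normalized shift. -/
theorem exists_order_gaussian {ε δ s : ℝ} (hε : 0 < ε) (hε1 : ε ≤ 1) (hδ : 0 < δ) (hδ1 : δ < 1)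
    (hs : s ≤ ε ^ 2 / (2 * Real.log (1.25 / δ))) :
    ∃ t : ℝ, 1 ≤ t ∧ 1 / 4 * Real.exp (t * (t + 1) / 2 * s - t * ε) ≤ δ := by
  set a := Real.log (1.25 / δ) with ha
  have hδa : δ = 1.25 * Real.exp (-a) := by
    rw [ha, Real.exp_neg, Real.exp_log (by positivity)]; field_simp
  have ha2 : 0.22 ≤ a := by
    have h1 : Real.log 1.25 ≤ a := Real.log_le_log (by norm_num) (by
      rw [le_div_iff₀ hδ]; nlinarith)
    have h2 := Real.one_sub_inv_le_log_of_pos (show (0:ℝ) < 1.014 by norm_num)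
    have h3 : Real.log 1.25 ≥ Real.log (1.014 ^ 16) := Real.log_le_log (by norm_num) (by norm_num)
    rw [Real.log_pow] at h3
    norm_num at h1 h2 h3 ⊢
    linarith
  rcases le_or_gt a (3 / 2) with h | h
  -- For large δ the order 1 is enough: δ = 1.25 e^(-a), the exponent is at most 3/2 - a, and
  -- e^(3/2) ≤ 5.
  · refine ⟨1, le_refl _, ?_⟩
    have h1 : ε ^ 2 / (2 * a) - ε + a ≤ 3 / 2 := by
      have h2 : ε ^ 2 / (2 * a) ≤ ε + 3 / 2 - a := by
        rw [div_le_iff₀ (by linarith)]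
        nlinarith [mul_nonneg hε.le (sub_nonneg.2 hε1), mul_nonneg (sub_nonneg.2 ha2)
          (sub_nonneg.2 h), mul_nonneg (sub_nonneg.2 hε1) (sub_nonneg.2 h)]
      linarith
    have h2 : Real.exp (3 / 2) ≤ 5 := by
      have := Real.exp_one_lt_d9
      have h6 : Real.exp (3 / 2) ^ 2 = Real.exp 1 ^ 3 := by
        rw [← Real.exp_nat_mul, ← Real.exp_nat_mul]; norm_num
      have h7 : Real.exp 1 ^ 3 ≤ 2.8 ^ 3 := by gcongr; linarith
      have h8 : (2.8 : ℝ) ^ 3 ≤ 25 := by norm_num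
      nlinarith [Real.exp_pos (3 / 2)]
    rw [hδa]
    calc _ ≤ 1 / 4 * Real.exp (3 / 2 - a) := by
            refine mul_le_mul_of_nonneg_left (Real.exp_le_exp.2 ?_) (by norm_num)
            linarith
      _ = 1 / 4 * Real.exp (3 / 2) * Real.exp (-a) := by rw [sub_eq_add_neg, Real.exp_add]; ring
      _ ≤ _ := by
          gcongr
          norm_num; linarith
  -- This t minimizes t(t+1)/2 · ε²/(2a) - tε. The exponent becomes at most -a + 1/2, and e^(1/2) ≤
  -- 2 leaves room below 1.25.
  · refine ⟨2 * a / ε - 1 / 2, ?_, ?_⟩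
    · have : 2 * a ≤ 2 * a / ε := by rw [le_div_iff₀ hε]; nlinarith
      linarith
    · rw [hδa]
      set t := 2 * a / ε - 1 / 2 with ht
      have hte : t * ε = 2 * a - ε / 2 := by rw [ht]; field_simp
      have ht1 : 0 ≤ t := by
        have : 2 * a ≤ 2 * a / ε := by rw [le_div_iff₀ hε]; nlinarith
        linarith
      have h1 : t * (t + 1) / 2 * s - t * ε ≤ -a + 1 / 2 := by
        have h2 : t * (t + 1) / 2 * s ≤ t * (t + 1) / 2 * (ε ^ 2 / (2 * a)) := by gcongr
        have h3 : t * (t + 1) / 2 * (ε ^ 2 / (2 * a)) = (t * ε) * (t * ε + ε) / (4 * a) := by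
          field_simp; ring
        have h4 : (t * ε) * (t * ε + ε) / (4 * a) ≤ a := by
          rw [div_le_iff₀ (by linarith), hte]
          nlinarith
        rw [h3] at h2
        linarith
      have h5 : Real.exp (1 / 2) ≤ 2 := by
        have := Real.exp_one_lt_d9
        have h6 : Real.exp (1 / 2) ^ 2 = Real.exp 1 := by rw [← Real.exp_nat_mul]; norm_num
        nlinarith [Real.exp_pos (1 / 2)]
      calc _ ≤ 1 / 4 * Real.exp (-a + 1 / 2) := by gcongr
        _ = 1 / 4 * Real.exp (1 / 2) * Real.exp (-a) := by rw [Real.exp_add]; ring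
        _ ≤ _ := by
          gcongr
          norm_num; linarith

/-! ### The estimator as post-processing of a Gaussian vector -/

theorem measurable_firstPassage {d T : ℕ} :
    Measurable fun (y : Fin T → Fin d → ℝ) (j : Fin d) =>
      (match (List.finRange T).find?
        (fun k : Fin T => decide (((1 / 2 : ℝ) ^ ((k : ℕ) + 2)) ^ 2 ≤ y k j)) with
      | some k => (1 / 2 : ℝ) ^ ((k : ℕ) + 1)
      | none => (1 / 2) ^ T) := by
  refine measurable_pi_lambda _ fun j => ?_
  have h1 : Measurable fun (y : Fin T → Fin d → ℝ) (k : Fin T) =>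
      decide (((1 / 2 : ℝ) ^ ((k : ℕ) + 2)) ^ 2 ≤ y k j) := by
    refine measurable_pi_lambda _ fun k => ?_
    refine measurable_to_bool ?_
    have : (fun y : Fin T → Fin d → ℝ => decide (((1 / 2 : ℝ) ^ ((k : ℕ) + 2)) ^ 2 ≤ y k j)) ⁻¹'
        {true} = {y | ((1 / 2 : ℝ) ^ ((k : ℕ) + 2)) ^ 2 ≤ y k j} := by
      ext y; simp
    rw [this]
    exact measurableSet_le measurable_const
      ((measurable_pi_apply j).comp (measurable_pi_apply k))
  -- The output sees the moments only through the finitely many possible outcomes of the tests.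
  have h2 : Measurable fun b : Fin T → Bool =>
      (match (List.finRange T).find? b with
      | some k => (1 / 2 : ℝ) ^ ((k : ℕ) + 1)
      | none => (1 / 2) ^ T) := measurable_of_countable _
  exact h2.comp h1

theorem noiseLaw_map_const_add {d n T : ℕ} {r ε δ : ℝ} (b : Fin T → Fin d → ℝ) :
    (noiseLaw d n T r ε δ).map (fun ξ k j => b k j + ξ k j) =
      Measure.pi fun k => Measure.pi fun j =>
        gaussianReal (b k j) (Real.toNNReal (noiseStd d n T r ε δ k ^ 2)) := by
  have h1 : ∀ k : Fin T, (Measure.pi fun _ : Fin d =>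
      gaussianReal 0 (Real.toNNReal (noiseStd d n T r ε δ k ^ 2))).map (fun x j => b k j + x j) =
      Measure.pi fun j =>
        gaussianReal (b k j) (Real.toNNReal (noiseStd d n T r ε δ k ^ 2)) := by
    intro k
    rw [Measure.pi_map_pi (f := fun j x => b k j + x) (fun j => by fun_prop)]
    congr 1; ext1 j
    rw [gaussianReal_map_const_add, zero_add]
  have h3 : ∀ k : Fin T, Measurable fun (x : Fin d → ℝ) j => b k j + x j := fun k => by fun_prop
  have h2 : ∀ k : Fin T, IsProbabilityMeasure ((Measure.pi fun _ : Fin d =>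
      gaussianReal 0 (Real.toNNReal (noiseStd d n T r ε δ k ^ 2))).map
        (fun x j => b k j + x j)) := fun k => Measure.isProbabilityMeasure_map (h3 k).aemeasurable
  refine (Measure.pi_map_pi (f := fun k (x : Fin d → ℝ) j => b k j + x j)
    (fun k => (h3 k).aemeasurable)).trans ?_
  simp only [h1]

theorem abs_truncMean_sub_le {d n : ℕ} {S S' : Fin n → Fin d → ℝ} {i : Fin n}
    (h : ∀ l, l ≠ i → S l = S' l) (ρ : ℝ) (j : Fin d) :
    |1 / (n : ℝ) * ∑ l, min (S l j ^ 2) (ρ ^ 2) - 1 / (n : ℝ) * ∑ l, min (S' l j ^ 2) (ρ ^ 2)|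
      ≤ ρ ^ 2 / n := by
  rw [← mul_sub, ← Finset.sum_sub_distrib, Finset.sum_eq_single i
    (fun l _ hl => by rw [h l hl, sub_self]) (fun hi => absurd (Finset.mem_univ i) hi),
    abs_mul, abs_of_nonneg (by positivity), div_mul_eq_mul_div, one_mul]
  gcongr
  have h1 : 0 ≤ min (S i j ^ 2) (ρ ^ 2) := le_min (sq_nonneg _) (sq_nonneg _)
  have h2 : 0 ≤ min (S' i j ^ 2) (ρ ^ 2) := le_min (sq_nonneg _) (sq_nonneg _)
  have h3 := min_le_right (S i j ^ 2) (ρ ^ 2)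
  have h4 := min_le_right (S' i j ^ 2) (ρ ^ 2)
  rw [abs_le]; constructor <;> linarith

theorem isDP_momentMech (d n T : ℕ) (r ε δ : ℝ) (hε : 0 < ε) (hε1 : ε ≤ 1) (hδ : 0 < δ)
    (hδ1 : δ < 1) : IsDP (momentMech d n T r ε δ) ε δ := by
  have hrep : ∀ S, momentMech d n T r ε δ S =
      (Measure.pi fun k : Fin T => Measure.pi fun j : Fin d =>
        gaussianReal (1 / (n : ℝ) * ∑ i, min (S i j ^ 2) (truncLevel r k ^ 2))
          (Real.toNNReal (noiseStd d n T r ε δ k ^ 2))).map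
      (fun (y : Fin T → Fin d → ℝ) (j : Fin d) =>
      (match (List.finRange T).find?
        (fun k : Fin T => decide (((1 / 2 : ℝ) ^ ((k : ℕ) + 2)) ^ 2 ≤ y k j)) with
      | some k => (1 / 2 : ℝ) ^ ((k : ℕ) + 1)
      | none => (1 / 2) ^ T)) := by
    intro S
    rw [← noiseLaw_map_const_add, Measure.map_map measurable_firstPassage (by fun_prop)]
    rfl
  refine ⟨fun S => ?_, fun S S' ⟨i, hi⟩ U hU => ?_⟩
  · rw [hrep]
    exact Measure.isProbabilityMeasure_map measurable_firstPassage.aemeasurable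
  rw [hrep, hrep, Measure.map_apply measurable_firstPassage hU,
    Measure.map_apply measurable_firstPassage hU]
  set v : Fin T → NNReal := fun k => Real.toNNReal (noiseStd d n T r ε δ k ^ 2) with hv
  set m : (Fin n → Fin d → ℝ) → Fin T → Fin d → ℝ := fun S k j =>
    1 / (n : ℝ) * ∑ i, min (S i j ^ 2) (truncLevel r k ^ 2) with hm
  have hdiff : ∀ k j, |m S k j - m S' k j| ≤ truncLevel r k ^ 2 / n := fun k j =>
    abs_truncMean_sub_le hi _ j
  -- With no iterates the output does not depend on the data. This case is separate because the
  -- noise scale divides by `T`.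
  rcases Nat.eq_zero_or_pos T with hT | hT
  · subst hT
    have hSS : m S = m S' := by ext k; exact k.elim0
    change Measure.pi (fun k => Measure.pi fun j => gaussianReal (m S k j) (v k)) _ ≤
      _ * Measure.pi (fun k => Measure.pi fun j => gaussianReal (m S' k j) (v k)) _ + _
    rw [hSS]
    refine le_trans ?_ le_self_add
    refine le_mul_of_one_le_left zero_le ?_
    rw [← ENNReal.ofReal_one]
    exact ENNReal.ofReal_le_ofReal (Real.one_le_exp hε.le)
  have hT' : (1 : ℝ) ≤ T := by exact_mod_cast hT
  set a := Real.log (1.25 / (δ / T)) with ha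
  have hlog : 0 < Real.log (1.25 / δ) := Real.log_pos (by rw [lt_div_iff₀ hδ]; linarith)
  have ha1 : Real.log (1.25 / δ) ≤ a := by
    refine Real.log_le_log (by positivity) ?_
    rw [div_div_eq_mul_div]
    gcongr
    linarith
  have ha0 : 0 < a := hlog.trans_le ha1
  have hvk : ∀ k, (v k : ℝ) =
      d * (truncLevel r k ^ 2 / n) ^ 2 * (2 * a * T ^ 2 / ε ^ 2) := by
    intro k
    simp only [hv, noiseStd]
    rw [Real.coe_toNNReal _ (sq_nonneg _), ← ha]
    rw [div_pow, mul_pow, div_pow, mul_pow, Real.sq_sqrt (by positivity),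
      Real.sq_sqrt (by positivity)]
    field_simp
  -- For arbitrary real r the truncation level may vanish (r = 1, say), and the noise with it; the
  -- truncated moments are then insensitive to the data.
  have hv0 : ∀ k j, v k = 0 → m S k j = m S' k j := by
    intro k j h0
    have h1 : (v k : ℝ) = 0 := by rw [h0]; rfl
    rw [hvk] at h1
    have hd : (d : ℝ) ≠ 0 := by
      have := j.pos
      positivity
    have h2 : truncLevel r k ^ 2 / n = 0 := by
      by_contra hne
      have : 0 < (truncLevel r k ^ 2 / (n : ℝ)) ^ 2 := by positivity
      have : 0 < (d : ℝ) := by positivity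
      have : 0 < (d : ℝ) * (truncLevel r k ^ 2 / n) ^ 2 * (2 * a * T ^ 2 / ε ^ 2) := by positivity
      linarith
    have h3 := hdiff k j
    rw [h2] at h3
    linarith [abs_nonpos_iff.1 h3]
  -- Each iterate contributes at most ε²/(2aT²). The `T` iterates sum to ε²/(2aT), so calibrating
  -- each one to (ε/T, δ/T) is more than enough.
  have hsum : ∑ k, ∑ j, (m S k j - m S' k j) ^ 2 / (v k : ℝ) ≤
      ε ^ 2 / (2 * Real.log (1.25 / δ)) := by
    have h1 : ∀ k, ∑ j, (m S k j - m S' k j) ^ 2 / (v k : ℝ) ≤ ε ^ 2 / (2 * a * T ^ 2) := by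
      intro k
      have h2 : ∀ j, (m S k j - m S' k j) ^ 2 ≤ (truncLevel r k ^ 2 / n) ^ 2 := fun j => by
        rw [← sq_abs]
        exact pow_le_pow_left₀ (abs_nonneg _) (hdiff k j) 2
      rw [← Finset.sum_div]
      have h3 : ∑ j, (m S k j - m S' k j) ^ 2 ≤ d * (truncLevel r k ^ 2 / n) ^ 2 := by
        refine (Finset.sum_le_sum fun j _ => h2 j).trans_eq ?_
        simp
      rw [hvk]
      refine div_le_of_le_mul₀ (by positivity) (by positivity) (h3.trans_eq ?_)
      field_simp
    refine (Finset.sum_le_sum fun k _ => h1 k).trans ?_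
    rw [Finset.sum_const, Finset.card_univ, Fintype.card_fin, nsmul_eq_mul, mul_div_assoc',
      div_le_div_iff₀ (by positivity) (by positivity)]
    have : Real.log (1.25 / δ) * T ≤ a * T ^ 2 := by
      nlinarith [mul_nonneg ha0.le (by linarith : (0 : ℝ) ≤ T)]
    nlinarith [mul_le_mul_of_nonneg_left this (sq_nonneg ε)]
  obtain ⟨t, ht, hb⟩ := exists_order_gaussian hε hε1 hδ hδ1 hsum
  have hL : LogRatioBound _ _ _ t _ := LogRatioBound.pi fun k => LogRatioBound.pi fun j =>
    logRatioBound_gaussianReal (m S k j) (m S' k j) (v k) t (hv0 k j)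
  refine hL.measure_le (ε := ε) ht ?_ (measurable_firstPassage hU)
  simpa only [← Finset.mul_sum] using hb

/-! ### Moments under a bounded moment ratio -/

section Moments

variable {d : ℕ} {P : Measure (Fin d → ℝ)} {r : ℝ}

theorem sigma_nonneg (P : Measure (Fin d → ℝ)) (j : Fin d) : 0 ≤ sigma P j := Real.sqrt_nonneg _

theorem sq_sigma (P : Measure (Fin d → ℝ)) (j : Fin d) : sigma P j ^ 2 = ∫ z, z j ^ 2 ∂P :=
  Real.sq_sqrt (integral_nonneg fun _ => sq_nonneg _)

theorem BoundedMomentRatio.integrable_exp (h : BoundedMomentRatio P r) (j : Fin d) (t : ℝ) :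
    Integrable (fun z : Fin d → ℝ => Real.exp (t * z j)) P := by
  have h1 := ((h j).integrable_exp_mul t).mul_const (Real.exp (t * ∫ y, y j ∂P))
  refine h1.congr (Filter.Eventually.of_forall fun z => ?_)
  simp only
  rw [← Real.exp_add]; ring_nf

theorem BoundedMomentRatio.integral_exp_le (h : BoundedMomentRatio P r) (j : Fin d) (t : ℝ) :
    ∫ z, Real.exp (t * z j) ∂P ≤
      Real.exp (t * ∫ y, y j ∂P) * Real.exp (r ^ 2 * sigma P j ^ 2 * t ^ 2 / 2) := by
  have h1 := (h j).mgf_le t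
  rw [mgf, Real.coe_toNNReal _ (by positivity)] at h1
  have h2 : ∀ z : Fin d → ℝ, Real.exp (t * z j) =
      Real.exp (t * ∫ y, y j ∂P) * Real.exp (t * (z j - ∫ y, y j ∂P)) := by
    intro z; rw [← Real.exp_add]; ring_nf
  simp only [h2]
  rw [integral_const_mul]
  gcongr

theorem BoundedMomentRatio.integrable_cosh (h : BoundedMomentRatio P r) (j : Fin d) (t : ℝ) :
    Integrable (fun z : Fin d → ℝ => Real.cosh (t * z j)) P := by
  simp only [Real.cosh_eq, ← neg_mul]
  exact ((h.integrable_exp j t).add (h.integrable_exp j (-t))).div_const 2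

variable [IsProbabilityMeasure P]

theorem BoundedMomentRatio.memLp (h : BoundedMomentRatio P r) (j : Fin d) (q : NNReal) :
    MemLp (fun z : Fin d → ℝ => z j) q P := by
  have h1 := ((h j).memLp q).add (memLp_const (∫ y, y j ∂P))
  refine h1.ae_eq (Filter.Eventually.of_forall fun z => ?_)
  simp

theorem BoundedMomentRatio.integrable_sq (h : BoundedMomentRatio P r) (j : Fin d) :
    Integrable (fun z : Fin d → ℝ => z j ^ 2) P :=
  (h.memLp j 2).integrable_sq

theorem BoundedMomentRatio.abs_mean_le (h : BoundedMomentRatio P r) (j : Fin d) :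
    |∫ z, z j ∂P| ≤ sigma P j := by
  refine Real.abs_le_sqrt ?_
  have h1 := variance_eq_sub (h.memLp j 2)
  have h2 := variance_nonneg (fun z : Fin d → ℝ => z j) P
  rw [h1] at h2
  simpa using h2

theorem BoundedMomentRatio.ae_eq_zero (h : BoundedMomentRatio P r) {j : Fin d}
    (hj : sigma P j = 0) : ∀ᵐ z ∂P, z j = 0 := by
  have h1 : ∫ z, z j ^ 2 ∂P = 0 := by rw [← sq_sigma, hj]; norm_num
  rw [integral_eq_zero_iff_of_nonneg (fun _ => sq_nonneg _) (h.integrable_sq j)] at h1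
  filter_upwards [h1] with z hz
  simpa using hz

/-- The hyperbolic cosine treats both tails at once. Averaging the bounds at t and -t leaves
cosh(tm) for the mean m, and |m| ≤ σ; this is why r² becomes 1 + r² for the uncentered variable. -/
theorem BoundedMomentRatio.integral_cosh_le (h : BoundedMomentRatio P r) (j : Fin d) (t : ℝ) :
    ∫ z, Real.cosh (t * z j) ∂P ≤ Real.exp ((1 + r ^ 2) * sigma P j ^ 2 * t ^ 2 / 2) := by
  have h1 := h.integral_exp_le j t
  have h2 := h.integral_exp_le j (-t)
  have h3 : ∫ z, Real.cosh (t * z j) ∂P =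
      (∫ z, Real.exp (t * z j) ∂P + ∫ z, Real.exp (-t * z j) ∂P) / 2 := by
    rw [← integral_add (h.integrable_exp j t) (h.integrable_exp j (-t)), ← integral_div]
    simp only [Real.cosh_eq, neg_mul]
  have h4 : Real.cosh (t * ∫ y, y j ∂P) ≤ Real.exp (sigma P j ^ 2 * t ^ 2 / 2) := by
    refine (Real.cosh_le_cosh.2 (?_ : _ ≤ |t * sigma P j|)).trans
      ((Real.cosh_le_exp_half_sq _).trans_eq ?_)
    · rw [abs_mul, abs_mul]
      exact mul_le_mul_of_nonneg_left ((h.abs_mean_le j).trans (le_abs_self _)) (abs_nonneg _)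
    · ring_nf
  have h5 : Real.exp ((1 + r ^ 2) * sigma P j ^ 2 * t ^ 2 / 2) =
      Real.exp (sigma P j ^ 2 * t ^ 2 / 2) * Real.exp (r ^ 2 * sigma P j ^ 2 * t ^ 2 / 2) := by
    rw [← Real.exp_add]; ring_nf
  rw [h3, h5]
  refine le_trans ?_ (mul_le_mul_of_nonneg_right h4 (Real.exp_pos _).le)
  rw [Real.cosh_eq]
  rw [neg_sq, neg_mul] at h2
  linarith

end Moments

/-! ### Concentration of truncated means -/

/-- By convexity e^(tY) ≤ 1 + (e^t - 1)Y on [0, 1], so the mgf is at most exp((e^t - 1) E Y);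
Markov's inequality does the rest. The factor t is kept on both sides of the event so that negative
t gives the lower tail. -/
theorem measure_pi_sum_ge_le {E : Type*} [MeasurableSpace E] {P : Measure E}
    [IsProbabilityMeasure P] {Y : E → ℝ} (hY : Measurable Y) (h0 : ∀ x, 0 ≤ Y x)
    (h1 : ∀ x, Y x ≤ 1) {t A q : ℝ} (hA : (Real.exp t - 1) * ∫ x, Y x ∂P ≤ A) (n : ℕ) :
    (Measure.pi fun _ : Fin n => P) {z | n * (t * q) ≤ t * ∑ i, Y (z i)} ≤
      ENNReal.ofReal (Real.exp (n * (A - t * q))) := by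
  have hYi : Integrable Y P := Integrable.of_bound hY.aestronglyMeasurable 1
    (Filter.Eventually.of_forall fun x => by rw [Real.norm_eq_abs, abs_of_nonneg (h0 x)]; exact h1 x)
  have hb : ∀ x, Real.exp (t * Y x) ≤ 1 + (Real.exp t - 1) * Y x := by
    intro x
    have := convexOn_exp.2 (Set.mem_univ 0) (Set.mem_univ t) (sub_nonneg.2 (h1 x)) (h0 x)
      (by ring)
    simp only [smul_eq_mul, mul_zero, zero_add, Real.exp_zero, mul_one] at this
    rw [mul_comm t]
    linarith
  have hm : ∫⁻ x, ENNReal.ofReal (Real.exp (t * Y x)) ∂P ≤ ENNReal.ofReal (Real.exp A) := by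
    calc _ ≤ ∫⁻ x, ENNReal.ofReal (1 + (Real.exp t - 1) * Y x) ∂P :=
          lintegral_mono fun x => ENNReal.ofReal_le_ofReal (hb x)
      _ = ENNReal.ofReal (∫ x, (1 + (Real.exp t - 1) * Y x) ∂P) :=
          (ofReal_integral_eq_lintegral_ofReal ((integrable_const 1).add (hYi.const_mul _))
            (Filter.Eventually.of_forall fun x => (Real.exp_pos _).le.trans (hb x))).symm
      _ ≤ _ := by
          refine ENNReal.ofReal_le_ofReal ?_
          rw [integral_add (integrable_const 1) (hYi.const_mul _), integral_const_mul]
          simp only [integral_const, probReal_univ, smul_eq_mul, mul_one]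
          linarith [Real.add_one_le_exp A]
  have hme : Measurable fun z : Fin n → E => ENNReal.ofReal (Real.exp (t * ∑ i, Y (z i))) := by
    refine ENNReal.measurable_ofReal.comp (Real.measurable_exp.comp (Measurable.const_mul ?_ t))
    exact Finset.measurable_sum _ fun i _ => hY.comp (measurable_pi_apply i)
  calc _ ≤ (Measure.pi fun _ : Fin n => P) {z | ENNReal.ofReal (Real.exp (n * (t * q))) ≤
        ENNReal.ofReal (Real.exp (t * ∑ i, Y (z i)))} :=
        measure_mono fun z hz => ENNReal.ofReal_le_ofReal (Real.exp_le_exp.2 hz)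
    _ ≤ (∫⁻ z, ENNReal.ofReal (Real.exp (t * ∑ i, Y (z i))) ∂(Measure.pi fun _ : Fin n => P)) /
        ENNReal.ofReal (Real.exp (n * (t * q))) :=
      meas_ge_le_lintegral_div hme.aemeasurable (by simp [Real.exp_pos]) ENNReal.ofReal_ne_top
    _ ≤ ENNReal.ofReal (Real.exp (n * A)) / ENNReal.ofReal (Real.exp (n * (t * q))) := by
      gcongr
      simp only [Finset.mul_sum, ofReal_exp_sum]
      refine (lintegral_pi_prod (fun _ : Fin n => P) fun i => ENNReal.measurable_ofReal.comp
        (Real.measurable_exp.comp (hY.const_mul t))).trans_le ?_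
      simp only [Function.comp_def, Finset.prod_const, Finset.card_univ, Fintype.card_fin]
      rw [Real.exp_nat_mul, ENNReal.ofReal_pow (Real.exp_pos _).le]
      gcongr
    _ = _ := by
      rw [← ENNReal.ofReal_div_of_pos (Real.exp_pos _), ← Real.exp_sub]
      ring_nf

/-- Chernoff's bound for the empirical truncated second moment (upper tail for `t > 0`, lower tail
for `t < 0`). -/
theorem measure_truncMean_ge_le {d : ℕ} {P : Measure (Fin d → ℝ)} [IsProbabilityMeasure P]
    (j : Fin d) {ρ t m q : ℝ} (hρ : 0 < ρ)
    (hm : (Real.exp t - 1) * ∫ z, min (z j ^ 2) (ρ ^ 2) ∂P ≤ (Real.exp t - 1) * m) {n : ℕ}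
    (hn : 0 < n) :
    (Measure.pi fun _ : Fin n => P)
      {z | t * q ≤ t * (1 / (n : ℝ) * ∑ i, min (z i j ^ 2) (ρ ^ 2))} ≤
      ENNReal.ofReal (Real.exp (n * (((Real.exp t - 1) * m - t * q) / ρ ^ 2))) := by
  have h := measure_pi_sum_ge_le (P := P) (Y := fun z : Fin d → ℝ => min (z j ^ 2) (ρ ^ 2) / ρ ^ 2)
    (by fun_prop) (fun x => by positivity)
    (fun x => (div_le_one (by positivity)).2 (min_le_right _ _)) (t := t)
    (A := (Real.exp t - 1) * m / ρ ^ 2) (q := q / ρ ^ 2) (by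
      rw [integral_div, mul_div_assoc']
      gcongr) n
  refine le_trans (measure_mono fun z hz => ?_) (h.trans_eq ?_)
  · simp only [Set.mem_ofPred_eq] at hz ⊢
    rw [← Finset.sum_div]
    have hn' : (0 : ℝ) < n := by exact_mod_cast hn
    calc n * (t * (q / ρ ^ 2)) = n / ρ ^ 2 * (t * q) := by ring
      _ ≤ n / ρ ^ 2 * (t * (1 / (n : ℝ) * ∑ i, min (z i j ^ 2) (ρ ^ 2))) := by gcongr
      _ = _ := by field_simp
  · ring_nf

/-- With y = l(|x| - ρ) the excess is (ρ/l)(2y + y²/(lρ)), and the bracket is at most e^y once lρ ≥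
7.68. That number lies just below 16 (log 2)², the least value of lρ in the application. -/
theorem truncation_le_cosh {l ρ : ℝ} (hl : 0 < l) (hρ : 0 < ρ) (h : 7.68 ≤ l * ρ) (x : ℝ) :
    x ^ 2 - min (x ^ 2) (ρ ^ 2) ≤
      2 * (ρ / l) * Real.exp (-(l * ρ)) * Real.cosh (l * x) := by
  rcases le_total (x ^ 2) (ρ ^ 2) with hx | hx
  · rw [min_eq_left hx, sub_self]
    have := Real.cosh_pos (l * x)
    positivity
  · rw [min_eq_right hx]
    have hx' : ρ ≤ |x| := by
      rw [← abs_of_pos hρ]; exact sq_le_sq.1 hx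
    set y := l * (|x| - ρ) with hy
    have hy0 : 0 ≤ y := mul_nonneg hl.le (by linarith)
    have h1 : Real.exp (l * ρ) * Real.exp y ≤ 2 * Real.cosh (l * x) := by
      rw [← Real.cosh_abs, abs_mul, abs_of_pos hl, Real.cosh_eq, ← Real.exp_add, hy]
      have := Real.exp_pos (-(l * |x|))
      have h2 : l * ρ + l * (|x| - ρ) = l * |x| := by ring
      rw [h2]; linarith
    have h2 : x ^ 2 - ρ ^ 2 = ρ / l * (2 * y + y ^ 2 / (l * ρ)) := by
      rw [← sq_abs x, hy]; field_simp; ring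
    have h3 : 2 * y + y ^ 2 / (l * ρ) ≤ Real.exp y := by
      have h4 : y ^ 2 / (l * ρ) ≤ y ^ 2 / 7.68 := by gcongr
      have h5 := Real.quadratic_le_exp_of_nonneg hy0
      have h6 : y ≤ 0.368 * Real.exp y := by
        have h7 := Real.add_one_le_exp (y - 1)
        rw [Real.exp_sub] at h7
        have h8 := Real.exp_one_gt_d9
        have h9 := Real.exp_pos y
        have h10 : Real.exp y / Real.exp 1 ≤ 0.368 * Real.exp y := by
          rw [div_le_iff₀ (Real.exp_pos 1)]; nlinarith
        linarith
      have h11 : y ^ 2 / 7.68 ≤ 0.2605 * Real.exp y := by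
        rw [div_le_iff₀ (by norm_num)]; nlinarith [Real.exp_pos y]
      linarith [Real.exp_pos y]
    rw [h2]
    calc ρ / l * (2 * y + y ^ 2 / (l * ρ)) ≤ ρ / l * Real.exp y := by gcongr
      _ = ρ / l * Real.exp (-(l * ρ)) * (Real.exp (l * ρ) * Real.exp y) := by
          rw [Real.exp_neg]; field_simp
      _ ≤ ρ / l * Real.exp (-(l * ρ)) * (2 * Real.cosh (l * x)) := by gcongr
      _ = _ := by ring

theorem log_two_le_log {r : ℝ} (hr : 2 ≤ r) : 0.6931 ≤ Real.log r := by
  have := Real.log_two_gt_d9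
  have := Real.log_le_log (by norm_num) hr
  linarith

theorem sq_log_mul_le_sq {r : ℝ} (hr : 2 ≤ r) : 7.38 * Real.log r ^ 2 ≤ r ^ 2 := by
  have h1 := Real.add_one_le_exp (Real.log r - 1)
  rw [Real.exp_sub, Real.exp_log (by linarith), sub_add_cancel, le_div_iff₀ (Real.exp_pos 1)] at h1
  have h2 := Real.exp_one_gt_d9
  have h3 := log_two_le_log hr
  have h4 : 2.718 * Real.log r ≤ r := by nlinarith
  nlinarith

theorem BoundedMomentRatio.le_truncated {d : ℕ} {P : Measure (Fin d → ℝ)} [IsProbabilityMeasure P]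
    {r : ℝ} (h : BoundedMomentRatio P r) (hr : 2 ≤ r) {j : Fin d} (hσ : 0 < sigma P j) :
    0.54 * sigma P j ^ 2 ≤ ∫ z, min (z j ^ 2) ((4 * r * Real.log r * sigma P j) ^ 2) ∂P := by
  set σ := sigma P j with hσd
  set L := Real.log r with hL
  have hL0 := log_two_le_log hr
  rw [← hL] at hL0
  have hr0 : 0 < r := by linarith
  have hLp : 0 < L := by linarith
  set ρ := 4 * r * L * σ with hρ
  have hρ0 : 0 < ρ := by positivity
  -- The choice l = ρ/(r²σ²) minimizes -lρ + r²σ²l²/2. The discarded moment is then at most 2σ²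
  -- exp(2L - 6L²) ≤ 0.46 σ², because L ≥ log 2.
  set l := 4 * L / (r * σ) with hl
  have hl0 : 0 < l := by positivity
  have hlρ : l * ρ = 16 * L ^ 2 := by rw [hl, hρ]; field_simp; ring
  have hρl : ρ / l = r ^ 2 * σ ^ 2 := by rw [hl, hρ]; field_simp
  have h1 := fun z : Fin d → ℝ => truncation_le_cosh hl0 hρ0 (by rw [hlρ]; nlinarith) (z j)
  have hI : Integrable (fun z : Fin d → ℝ => min (z j ^ 2) (ρ ^ 2)) P :=
    (h.integrable_sq j).inf (integrable_const _)
  have h2 : σ ^ 2 - ∫ z, min (z j ^ 2) (ρ ^ 2) ∂P ≤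
      2 * (ρ / l) * Real.exp (-(l * ρ)) * Real.exp ((1 + r ^ 2) * σ ^ 2 * l ^ 2 / 2) := by
    have h20 : σ ^ 2 - ∫ z, min (z j ^ 2) (ρ ^ 2) ∂P =
        ∫ z, (z j ^ 2 - min (z j ^ 2) (ρ ^ 2)) ∂P := by
      rw [integral_sub (h.integrable_sq j) hI, ← sq_sigma]
    rw [h20]
    refine (integral_mono ((h.integrable_sq j).sub hI) ((h.integrable_cosh j l).const_mul _)
      h1).trans ?_
    rw [integral_const_mul]
    exact mul_le_mul_of_nonneg_left (h.integral_cosh_le j l) (by positivity)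
  have h3 : (1 + r ^ 2) * σ ^ 2 * l ^ 2 / 2 = 8 * L ^ 2 / r ^ 2 + 8 * L ^ 2 := by
    rw [hl]; field_simp; ring
  have h4 : 8 * L ^ 2 / r ^ 2 ≤ 2 * L ^ 2 := by
    rw [div_le_iff₀ (by positivity)]; nlinarith [sq_nonneg L, mul_self_nonneg (r - 2)]
  have h5 : r ^ 2 = Real.exp (2 * L) := by
    rw [hL, two_mul, Real.exp_add, Real.exp_log hr0]; ring
  have h6 : r ^ 2 * (Real.exp (-(l * ρ)) * Real.exp ((1 + r ^ 2) * σ ^ 2 * l ^ 2 / 2)) ≤ 0.23 := by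
    rw [h3, hlρ, ← Real.exp_add]
    nth_rewrite 1 [h5]
    rw [← Real.exp_add]
    calc _ ≤ Real.exp (-(149 / 100)) := Real.exp_le_exp.2 (by nlinarith)
      _ ≤ 0.23 := by
        rw [Real.exp_neg, inv_le_comm₀ (Real.exp_pos _) (by norm_num)]
        have h7 := Real.exp_one_gt_d9
        have h8 : Real.exp (149 / 100) = Real.exp (49 / 100) * Real.exp 1 := by
          rw [← Real.exp_add]; norm_num
        have h9 := Real.quadratic_le_exp_of_nonneg (show (0 : ℝ) ≤ 49 / 100 by norm_num)
        rw [h8]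
        norm_num at h9 ⊢
        nlinarith
  rw [hρl] at h2
  have h7 : 2 * (r ^ 2 * σ ^ 2) * Real.exp (-(l * ρ)) *
      Real.exp ((1 + r ^ 2) * σ ^ 2 * l ^ 2 / 2) ≤ 2 * σ ^ 2 * 0.23 := by
    calc _ = 2 * σ ^ 2 * (r ^ 2 * (Real.exp (-(l * ρ)) *
        Real.exp ((1 + r ^ 2) * σ ^ 2 * l ^ 2 / 2))) := by ring
      _ ≤ _ := by gcongr
  linarith

/-! ### Accuracy of the moment estimation -/

theorem momentOutput_eq {d n T : ℕ} (r : ℝ) (z : Fin n → Fin d → ℝ) (ξ : Fin T → Fin d → ℝ)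
    (j : Fin d) :
    (∃ k : Fin T, momentOutput r z ξ j = (1 / 2) ^ ((k : ℕ) + 1) ∧
      ((1 / 2 : ℝ) ^ ((k : ℕ) + 2)) ^ 2 ≤ noisyMoment r z ξ k j ∧
      ∀ l < k, noisyMoment r z ξ l j < ((1 / 2 : ℝ) ^ ((l : ℕ) + 2)) ^ 2) ∨
    (momentOutput r z ξ j = (1 / 2) ^ T ∧
      ∀ l : Fin T, noisyMoment r z ξ l j < ((1 / 2 : ℝ) ^ ((l : ℕ) + 2)) ^ 2) := by
  rcases hf : (List.finRange T).find? (fun k : Fin T =>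
    decide (((1 / 2 : ℝ) ^ ((k : ℕ) + 2)) ^ 2 ≤ noisyMoment r z ξ k j)) with _ | k
  · right
    refine ⟨by unfold momentOutput; rw [hf], fun l => ?_⟩
    rw [List.find?_eq_none] at hf
    simpa using hf l (List.mem_finRange l)
  · left
    refine ⟨k, by unfold momentOutput; rw [hf], ?_⟩
    obtain ⟨h1, i, hi, h2, h3⟩ := List.find?_eq_some_iff_getElem.1 hf
    refine ⟨by simpa using h1, fun l hl => ?_⟩
    have hk : (k : ℕ) = i := by rw [← h2]; simp
    have := h3 l (by rw [← hk]; exact hl)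
    simpa using this

/-- The estimate is within the stated factors as soon as the noise is small, the empirical truncated
moments of coordinates of small variance are small at the early iterates, and the one at the scale
of `σ` is large. -/
theorem momentOutput_bounds {d n T : ℕ} {r σ : ℝ} {z : Fin n → Fin d → ℝ}
    {ξ : Fin T → Fin d → ℝ} {j : Fin d} (hd : 0 < d) (hT1 : d ^ 2 ≤ 2 ^ T)
    (hT2 : 2 ^ T ≤ 2 * d ^ 2) (hσ1 : σ ≤ 1)
    (hξ : ∀ k, |ξ k j| ≤ 0.18 * ((1 / 2 : ℝ) ^ ((k : ℕ) + 1)) ^ 2)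
    (hup : ∀ k : Fin T, 8 * σ < (1 / 2 : ℝ) ^ ((k : ℕ) + 1) →
      1 / (n : ℝ) * ∑ i, min (z i j ^ 2) (truncLevel r k ^ 2) <
        0.07 * ((1 / 2 : ℝ) ^ ((k : ℕ) + 1)) ^ 2)
    (hlow : ∀ k : Fin T, (1 / 2 : ℝ) ^ ((k : ℕ) + 1) < σ → σ ≤ 2 * (1 / 2 : ℝ) ^ ((k : ℕ) + 1) →
      0.43 * ((1 / 2 : ℝ) ^ ((k : ℕ) + 1)) ^ 2 ≤
        1 / (n : ℝ) * ∑ i, min (z i j ^ 2) (truncLevel r k ^ 2)) :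
    (1 / 2) * max σ (1 / (d : ℝ) ^ 2) ≤ momentOutput r z ξ j ∧
      momentOutput r z ξ j ≤ 8 * max σ (1 / (d : ℝ) ^ 2) := by
  have hd' : (0 : ℝ) < d := by exact_mod_cast hd
  have h1 : (1 / 2 : ℝ) ^ T ≤ 1 / (d : ℝ) ^ 2 := by
    rw [one_div_pow]
    gcongr
    exact_mod_cast hT1
  have h2 : (1 / 2) * (1 / (d : ℝ) ^ 2) ≤ (1 / 2 : ℝ) ^ T := by
    rw [one_div_pow, one_div_mul_one_div]
    gcongr
    exact_mod_cast hT2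
  have hsq : ∀ k : ℕ, ((1 / 2 : ℝ) ^ (k + 2)) ^ 2 = ((1 / 2 : ℝ) ^ (k + 1)) ^ 2 / 4 := by
    intro k; rw [pow_succ _ (k + 1)]; ring
  have hmono : ∀ k : ℕ, k + 1 ≤ T → (1 / 2 : ℝ) ^ T ≤ (1 / 2 : ℝ) ^ (k + 1) := fun k hk =>
    pow_le_pow_of_le_one (by norm_num) (by norm_num) hk
  -- The dyadic scale a < σ ≤ 2a is among the iterates as 2^(-T) ≤ d⁻² < σ, and its test passes:
  -- 0.43 - 0.18 is exactly the threshold 1/4.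
  have hpass : 1 / (d : ℝ) ^ 2 < σ → ∃ k : Fin T, (1 / 2) * σ ≤ (1 / 2 : ℝ) ^ ((k : ℕ) + 1) ∧
      ((1 / 2 : ℝ) ^ ((k : ℕ) + 2)) ^ 2 ≤ noisyMoment r z ξ k j := by
    intro hσ
    have hσ0 : 0 < σ := lt_trans (by positivity) hσ
    obtain ⟨k, hk1, hk2⟩ := exists_nat_pow_near_of_lt_one hσ0 hσ1 (y := (1 / 2 : ℝ))
      (by norm_num) (by norm_num)
    have hkT : k < T := by
      by_contra hkT
      have : (1 / 2 : ℝ) ^ k ≤ (1 / 2) ^ T :=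
        pow_le_pow_of_le_one (by norm_num) (by norm_num) (not_lt.1 hkT)
      linarith
    have hk3 : σ ≤ 2 * (1 / 2 : ℝ) ^ (k + 1) := by rw [pow_succ]; linarith
    refine ⟨⟨k, hkT⟩, (by linarith : 1 / 2 * σ ≤ (1 / 2 : ℝ) ^ (k + 1)), ?_⟩
    have h3 := hlow ⟨k, hkT⟩ hk1 hk3
    have h4 := neg_le_of_abs_le (hξ ⟨k, hkT⟩)
    rw [hsq, noisyMoment]
    have := sq_nonneg ((1 / 2 : ℝ) ^ (k + 1))
    simp only at h3 h4 ⊢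
    linarith
  rcases momentOutput_eq r z ξ j with ⟨k, ho, hk, hlt⟩ | ⟨ho, hlt⟩
  · rw [ho]
    constructor
    · rcases le_or_gt σ (1 / (d : ℝ) ^ 2) with hσ | hσ
      · rw [max_eq_right hσ]
        exact h2.trans (hmono k k.2)
      · rw [max_eq_left hσ.le]
        obtain ⟨l, hl1, hl2⟩ := hpass hσ
        refine hl1.trans (pow_le_pow_of_le_one (by norm_num) (by norm_num) ?_)
        have : k ≤ l := by
          by_contra hlk
          exact absurd hl2 (not_le.2 (hlt l (not_le.1 hlk)))
        simpa using this
    · by_contra hcon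
      push Not at hcon
      -- A test that passes too early would need a noisy moment of at least a²/4, but 0.07 + 0.18 =
      -- 1/4 and the bound 0.07 is strict.
      have h3 := hup k (by linarith [le_max_left σ (1 / (d : ℝ) ^ 2)])
      have h4 := le_of_abs_le (hξ k)
      rw [hsq, noisyMoment] at hk
      linarith
  · rw [ho]
    constructor
    · rcases le_or_gt σ (1 / (d : ℝ) ^ 2) with hσ | hσ
      · rw [max_eq_right hσ]
        exact h2
      · obtain ⟨l, hl1, hl2⟩ := hpass hσ
        exact absurd hl2 (not_le.2 (hlt l))
    · have h3 := le_max_right σ (1 / (d : ℝ) ^ 2)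
      have h4 : 0 < 1 / (d : ℝ) ^ 2 := by positivity
      linarith

/-! ### Tails of the added noise -/

theorem gaussianReal_abs_gt_le {v : NNReal} {τ : ℝ} (hτ : 0 ≤ τ) :
    gaussianReal 0 v {x | τ < |x|} ≤ ENNReal.ofReal (2 * Real.exp (-τ ^ 2 / (2 * v))) := by
  have h : HasSubgaussianMGF (fun x : ℝ => x) v (gaussianReal 0 v) :=
    ⟨fun t => integrable_exp_mul_gaussianReal t, fun t => by
      rw [mgf_fun_id_gaussianReal]; simp⟩
  have h1 := h.measure_ge_le hτ
  have h2 := h.neg.measure_ge_le hτ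
  have h3 : {x : ℝ | τ < |x|} ⊆ {x | τ ≤ x} ∪ {x | τ ≤ (-fun x : ℝ => x) x} := by
    intro x hx
    rcases lt_abs.1 (show τ < |x| from hx) with h | h
    · exact Or.inl h.le
    · exact Or.inr h.le
  refine (measure_mono h3).trans ((measure_union_le _ _).trans ?_)
  rw [two_mul, ENNReal.ofReal_add (Real.exp_pos _).le (Real.exp_pos _).le]
  refine add_le_add ?_ ?_
  · rw [← ENNReal.ofReal_toReal (measure_ne_top (gaussianReal 0 v) _)]
    exact ENNReal.ofReal_le_ofReal h1
  · rw [← ENNReal.ofReal_toReal (measure_ne_top (gaussianReal 0 v) _)]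
    exact ENNReal.ofReal_le_ofReal h2

theorem truncLevel_eq (r : ℝ) (k : ℕ) :
    truncLevel r k = 8 * r * Real.log r * (1 / 2) ^ (k + 1) := by
  rw [truncLevel, pow_succ, one_div_pow]; ring

theorem noiseLaw_abs_gt_le {d n T : ℕ} {r ε δ τ : ℝ} (hτ : 0 ≤ τ) (k : Fin T) (j : Fin d) :
    noiseLaw d n T r ε δ {ξ | τ < |ξ k j|} ≤
      ENNReal.ofReal (2 * Real.exp (-τ ^ 2 / (2 * noiseStd d n T r ε δ k ^ 2))) := by
  have h1 : MeasurePreserving (fun ξ : Fin T → Fin d → ℝ => ξ k j) (noiseLaw d n T r ε δ)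
      (gaussianReal 0 (Real.toNNReal (noiseStd d n T r ε δ k ^ 2))) :=
    (measurePreserving_eval (fun _ : Fin d =>
      gaussianReal 0 (Real.toNNReal (noiseStd d n T r ε δ k ^ 2))) j).comp
      (measurePreserving_eval (fun k : Fin T => Measure.pi fun _ : Fin d =>
      gaussianReal 0 (Real.toNNReal (noiseStd d n T r ε δ k ^ 2))) k)
  have h2 := gaussianReal_abs_gt_le (v := Real.toNNReal (noiseStd d n T r ε δ k ^ 2)) hτ
  rw [Real.coe_toNNReal _ (sq_nonneg _)] at h2
  have h3 : MeasurableSet {x : ℝ | τ < |x|} := measurableSet_lt measurable_const measurable_id.abs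
  rw [← h1.measure_preimage h3.nullMeasurableSet] at h2
  exact h2

/-! ### Chernoff bounds for the truncated means at one scale -/

section Sample

variable {d n : ℕ} {P : Measure (Fin d → ℝ)} [IsProbabilityMeasure P] {r : ℝ}

theorem measure_truncMean_large_le (h : BoundedMomentRatio P r) (hr : 2 ≤ r) {l a : ℝ}
    (hl : 0 ≤ l) (hn : 400 * r ^ 4 * l ≤ n) (hn0 : 0 < n) (ha : 0 < a) {j : Fin d}
    (hj : 8 * sigma P j < a) :
    (Measure.pi fun _ : Fin n => P) {z | 0.07 * a ^ 2 ≤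
      1 / (n : ℝ) * ∑ i, min (z i j ^ 2) ((8 * r * Real.log r * a) ^ 2)} ≤
      ENNReal.ofReal (Real.exp (-(2 * l))) := by
  have hL := log_two_le_log hr
  have hL2 := sq_log_mul_le_sq hr
  set L := Real.log r
  have hr0 : 0 < r := by linarith
  have hL0 : 0 < L := by linarith
  have hρ : 0 < 8 * r * L * a := by positivity
  have he1 : 0 < Real.exp (3 / 2) - 1 := by
    linarith [Real.add_one_lt_exp (show (3 / 2 : ℝ) ≠ 0 by norm_num)]
  have he2 : Real.exp (3 / 2) ≤ 4.49 := by
    have h1 := Real.exp_one_lt_d9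
    have h2 : Real.exp (3 / 2) ^ 2 = Real.exp 1 ^ 3 := by
      rw [← Real.exp_nat_mul, ← Real.exp_nat_mul]; norm_num
    have h3 : Real.exp 1 ^ 3 ≤ 2.7183 ^ 3 := by gcongr; linarith
    have h4 : (2.7183 : ℝ) ^ 3 ≤ 4.49 ^ 2 := by norm_num
    nlinarith [Real.exp_pos (3 / 2)]
  have hm : ∫ z, min (z j ^ 2) ((8 * r * L * a) ^ 2) ∂P ≤ a ^ 2 / 64 := by
    calc _ ≤ ∫ z, z j ^ 2 ∂P := integral_mono ((h.integrable_sq j).inf (integrable_const _))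
            (h.integrable_sq j) fun z => min_le_left _ _
      _ = sigma P j ^ 2 := (sq_sigma P j).symm
      _ ≤ _ := by nlinarith [sigma_nonneg P j]
  -- At t = 3/2 the exponent per sample is (3.49/64 - 0.105)/(64 r²L²) ≤ -0.000788/(r²L²). Since
  -- 7.38 L² ≤ r² and 400 · 7.38 · 0.000788 > 2, the total is below -2l.
  have h1 := measure_truncMean_ge_le (P := P) j hρ (t := 3 / 2) (m := a ^ 2 / 64)
    (q := 0.07 * a ^ 2) (mul_le_mul_of_nonneg_left hm he1.le) hn0
  refine le_trans (measure_mono fun z hz => ?_) (h1.trans (ENNReal.ofReal_le_ofReal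
    (Real.exp_le_exp.2 ?_)))
  · rw [Set.mem_ofPred_eq] at hz ⊢
    exact mul_le_mul_of_nonneg_left hz (by norm_num)
  · have h2 : ((Real.exp (3 / 2) - 1) * (a ^ 2 / 64) - 3 / 2 * (0.07 * a ^ 2)) /
        (8 * r * L * a) ^ 2 ≤ -(0.000788 / (r ^ 2 * L ^ 2)) := by
      rw [← neg_div (r ^ 2 * L ^ 2), div_le_div_iff₀ (by positivity) (by positivity)]
      have : 0 ≤ a ^ 2 * (r ^ 2 * L ^ 2) := by positivity
      nlinarith
    have h3 : 2 * l ≤ n * (0.000788 / (r ^ 2 * L ^ 2)) := by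
      rw [mul_div_assoc', le_div_iff₀ (by positivity)]
      have h4 : 7.38 * (l * (r ^ 2 * L ^ 2)) ≤ l * r ^ 4 := by
        have : 0 ≤ l * r ^ 2 := by positivity
        nlinarith
      have h5 : 0 ≤ l * r ^ 4 := by positivity
      linarith
    have hn0' : (0 : ℝ) < n := by exact_mod_cast hn0
    have h6 := mul_le_mul_of_nonneg_left h2 hn0'.le
    linarith

theorem measure_truncMean_small_le (h : BoundedMomentRatio P r) (hr : 2 ≤ r) {l a : ℝ}
    (hl : 0 ≤ l) (hn : 400 * r ^ 4 * l ≤ n) (hn0 : 0 < n) (ha : 0 < a) {j : Fin d}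
    (hj1 : a < sigma P j) (hj2 : sigma P j ≤ 2 * a) :
    (Measure.pi fun _ : Fin n => P) {z |
      1 / (n : ℝ) * ∑ i, min (z i j ^ 2) ((8 * r * Real.log r * a) ^ 2) < 0.43 * a ^ 2} ≤
      ENNReal.ofReal (Real.exp (-(2 * l))) := by
  have hσ : 0 < sigma P j := ha.trans hj1
  have hm := h.le_truncated hr hσ
  have hL := log_two_le_log hr
  have hL2 := sq_log_mul_le_sq hr
  set L := Real.log r
  set σ := sigma P j
  have hr0 : 0 < r := by linarith
  have hL0 : 0 < L := by linarith
  have hρ : 0 < 4 * r * L * σ := by positivity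
  have hρ2 : 4 * r * L * σ ≤ 8 * r * L * a := by
    have : 0 < r * L := by positivity
    nlinarith
  have he1 : Real.exp (-(1 / 5)) - 1 < 0 := by
    rw [sub_neg, Real.exp_lt_one_iff]; norm_num
  have he2 : Real.exp (-(1 / 5)) - 1 ≤ -0.18 := by
    rw [Real.exp_neg]
    have h2 := Real.quadratic_le_exp_of_nonneg (show (0 : ℝ) ≤ 1 / 5 by norm_num)
    have h3 : (Real.exp (1 / 5))⁻¹ ≤ (1 + 1 / 5 + (1 / 5) ^ 2 / 2 : ℝ)⁻¹ := by gcongr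
    norm_num at h3 ⊢
    linarith
  -- Lowering the level to 4rLσ ≤ 8rLa only decreases the empirical mean, and 0.54 σ² of the second
  -- moment is known to survive there. At t = -1/5 the exponent is -0.18 · 0.54 + 0.2 · 0.43 = -16 ·
  -- 0.0007, and 400 · 7.38 · 0.0007 > 2.
  have h1 := measure_truncMean_ge_le (P := P) j hρ (t := -(1 / 5)) (m := 0.54 * σ ^ 2)
    (q := 0.43 * σ ^ 2) (mul_le_mul_of_nonpos_left hm he1.le) hn0
  refine le_trans (measure_mono fun z hz => ?_) (h1.trans (ENNReal.ofReal_le_ofReal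
    (Real.exp_le_exp.2 ?_)))
  · rw [Set.mem_ofPred_eq] at hz ⊢
    refine mul_le_mul_of_nonpos_left ?_ (by norm_num)
    calc 1 / (n : ℝ) * ∑ i, min (z i j ^ 2) ((4 * r * L * σ) ^ 2)
        ≤ 1 / (n : ℝ) * ∑ i, min (z i j ^ 2) ((8 * r * L * a) ^ 2) := by gcongr
      _ ≤ 0.43 * a ^ 2 := hz.le
      _ ≤ 0.43 * σ ^ 2 := by gcongr
  · have h2 : ((Real.exp (-(1 / 5)) - 1) * (0.54 * σ ^ 2) - -(1 / 5) * (0.43 * σ ^ 2)) /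
        (4 * r * L * σ) ^ 2 ≤ -(0.0007 / (r ^ 2 * L ^ 2)) := by
      rw [← neg_div (r ^ 2 * L ^ 2), div_le_div_iff₀ (by positivity) (by positivity)]
      have : 0 ≤ σ ^ 2 * (r ^ 2 * L ^ 2) := by positivity
      nlinarith
    have h3 : 2 * l ≤ n * (0.0007 / (r ^ 2 * L ^ 2)) := by
      rw [mul_div_assoc', le_div_iff₀ (by positivity)]
      have h4 : 7.38 * (l * (r ^ 2 * L ^ 2)) ≤ l * r ^ 4 := by
        have : 0 ≤ l * r ^ 2 := by positivity
        nlinarith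
      have h5 : 0 ≤ l * r ^ 4 := by positivity
      linarith
    have hn0' : (0 : ℝ) < n := by exact_mod_cast hn0
    have h6 := mul_le_mul_of_nonneg_left h2 hn0'.le
    linarith

end Sample

/-! ### Sample size, noise level and the union bound -/

theorem momentIters_spec {d : ℕ} (hd : 2 ≤ d) : d ^ 2 ≤ 2 ^ momentIters d ∧
    2 ^ momentIters d ≤ 2 * d ^ 2 ∧ 2 ≤ momentIters d ∧ momentIters d ≤ 2 * d := by
  have h4 : 2 ^ 2 ≤ d ^ 2 := Nat.pow_le_pow_left hd 2
  have h2 : 2 ≤ momentIters d := by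
    by_contra h
    have h5 : d ^ 2 ≤ 2 ^ momentIters d := Nat.le_pow_clog (by norm_num) _
    have h6 : (2 : ℕ) ^ momentIters d ≤ 2 ^ 1 := Nat.pow_le_pow_right (by norm_num) (by omega)
    omega
  refine ⟨Nat.le_pow_clog (by norm_num) _, ?_, h2, ?_⟩
  · have h5 := Nat.pow_pred_clog_lt_self (b := 2) (by norm_num) (x := d ^ 2) (by omega)
    have h6 : 2 ^ momentIters d = 2 ^ (momentIters d).pred * 2 := by
      rw [← pow_succ]; congr 1; simp; omega
    rw [h6]
    have h7 : 2 ^ (momentIters d).pred < d ^ 2 := h5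
    omega
  · refine Nat.clog_le_of_le_pow ?_
    rw [mul_comm, pow_mul]
    exact Nat.pow_le_pow_left Nat.lt_two_pow_self.le 2

theorem EnoughSamples.pos {d n : ℕ} {r ε δ β : ℝ} (h : EnoughSamples d n r ε δ β) (hd : 2 ≤ d)
    (hr : 2 ≤ r) (hβ : 0 < β) (hβ1 : β < 1) : 0 < n := by
  have hd' : (2 : ℝ) ≤ d := by exact_mod_cast hd
  have h1 : 0 < Real.log (8 * d / β) := Real.log_pos (by rw [lt_div_iff₀ hβ]; linarith)
  have h2 : 0 < 400 * r ^ 4 * Real.log (8 * d / β) := by positivity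
  exact_mod_cast h2.trans_le h.1

theorem log_eight_le {d : ℕ} {β : ℝ} (hd : 2 ≤ d) (hβ : 0 < β) (hβ1 : β < 1) :
    2.079 ≤ Real.log (4 * d / β) := by
  have hd' : (2 : ℝ) ≤ d := by exact_mod_cast hd
  have h1 : Real.log (2 ^ 3) ≤ Real.log (4 * d / β) := Real.log_le_log (by norm_num) (by
    rw [le_div_iff₀ hβ]; nlinarith)
  rw [Real.log_pow] at h1
  have := Real.log_two_gt_d9
  push_cast at h1
  linarith

theorem log_two_le_log_iters {d : ℕ} {δ : ℝ} (hd : 2 ≤ d) (hδ : 0 < δ) (hδ1 : δ < 1) :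
    0.6931 ≤ Real.log (momentIters d / δ) := by
  have hT : (2 : ℝ) ≤ momentIters d := by exact_mod_cast (momentIters_spec hd).2.2.1
  refine log_two_le_log ?_
  rw [le_div_iff₀ hδ]; nlinarith

/-- Noise and tolerance 0.18 a² both scale like a², since the truncation level is proportional to a;
hence one condition on nε serves all iterates. -/
theorem sq_noiseStd_le {d n : ℕ} {r ε δ β : ℝ} (h : EnoughSamples d n r ε δ β) (hd : 2 ≤ d)
    (hr : 2 ≤ r) (hε : 0 < ε) (hδ : 0 < δ) (hδ1 : δ < 1) (hβ : 0 < β) (hβ1 : β < 1) (k : ℕ) :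
    0 < noiseStd d n (momentIters d) r ε δ k ∧
    4 * Real.log (4 * d / β) * noiseStd d n (momentIters d) r ε δ k ^ 2 ≤
      (0.18 * ((1 / 2 : ℝ) ^ (k + 1)) ^ 2) ^ 2 := by
  have hn : (0 : ℝ) < n := by exact_mod_cast h.pos hd hr hβ hβ1
  have hb := log_eight_le hd hβ hβ1
  have hdl := log_two_le_log_iters hd hδ hδ1
  have hT : (2 : ℝ) ≤ momentIters d := by exact_mod_cast (momentIters_spec hd).2.2.1
  have hL := log_two_le_log hr
  have h2 := h.2
  have hd0 : (0 : ℝ) < d := by positivity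
  rw [noiseStd, truncLevel_eq]
  set T : ℝ := ((momentIters d : ℕ) : ℝ) with hTd
  set b := Real.log (4 * d / β)
  set e := Real.log (T / δ)
  set L := Real.log r
  set a := (1 / 2 : ℝ) ^ (k + 1)
  have ha : 0 < a := by positivity
  have hc : Real.log (1.25 / (δ / T)) ≤ e + 0.25 := by
    have h3 : 1.25 / (δ / T) = T / δ * 1.25 := by field_simp
    rw [h3, Real.log_mul (by positivity) (by norm_num)]
    have := Real.log_le_sub_one_of_pos (show (0 : ℝ) < 1.25 by norm_num)
    linarith
  have hc0 : 0 < Real.log (1.25 / (δ / T)) := by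
    refine Real.log_pos ?_
    rw [div_div_eq_mul_div, lt_div_iff₀ hδ]; nlinarith
  set c := Real.log (1.25 / (δ / T))
  have hT0 : 0 < T := by linarith
  have hL0 : 0 < L := by linarith
  have hr0 : 0 < r := by linarith
  have he0 : 0 < e := by linarith
  have hb0 : 0 < b := by linarith
  refine ⟨by positivity, ?_⟩
  set u := 64 * r ^ 2 * L ^ 2 * √d * T / (n * ε) with hu
  have hu0 : 0 < u := by positivity
  have hu1 : u * (e * b) ≤ 0.064 := by
    rw [hu, div_mul_eq_mul_div, div_le_iff₀ (by positivity)]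
    linarith
  have hν : (√d * (8 * r * L * a) ^ 2 / n * √(2 * c) / (ε / T)) ^ 2 = (u * a ^ 2) ^ 2 * (2 * c) := by
    rw [div_pow, mul_pow, Real.sq_sqrt (by positivity), hu]
    field_simp
    ring
  rw [hν]
  have h3 : u ^ 2 * (e * b) ^ 2 ≤ 0.064 ^ 2 := by
    rw [← mul_pow]; exact pow_le_pow_left₀ (by positivity) hu1 2
  -- The constant is 8 · 0.064²/0.18², up to rounding, with 0.064 = 64/1000. The inequality replaces
  -- log(1.25 T/δ) by the square of log(T/δ) times log(4d/β), which holds because neither of these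
  -- logarithms is small.
  have h4 : 1.01136 * c ≤ e ^ 2 * b := by
    have : 0.6931 * 2.079 * e ≤ e * e * b := by
      have : 0.6931 * 2.079 ≤ e * b := mul_le_mul hdl hb (by norm_num) he0.le
      nlinarith
    nlinarith
  have h5 : u ^ 2 * (b * c) * 8 ≤ 0.18 ^ 2 := by
    have h6 : u ^ 2 * b * (1.01136 * c) ≤ u ^ 2 * b * (e ^ 2 * b) := by gcongr
    nlinarith
  calc 4 * b * ((u * a ^ 2) ^ 2 * (2 * c)) = u ^ 2 * (b * c) * 8 * (a ^ 2) ^ 2 := by ring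
    _ ≤ 0.18 ^ 2 * (a ^ 2) ^ 2 := by gcongr
    _ = _ := by ring

theorem exp_neg_two_log {x : ℝ} (hx : 0 < x) : Real.exp (-(2 * Real.log x)) = 1 / x ^ 2 := by
  rw [Real.exp_neg, two_mul, Real.exp_add, Real.exp_log hx]
  field_simp

instance {d n T : ℕ} {r ε δ : ℝ} : IsProbabilityMeasure (noiseLaw d n T r ε δ) := by
  unfold noiseLaw; infer_instance

theorem sampleLaw_fst {d : ℕ} (P : Measure (Fin d → ℝ)) [IsProbabilityMeasure P] (n : ℕ)
    (r ε δ : ℝ) (A : Set (Fin n → Fin d → ℝ)) :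
    sampleLaw P n r ε δ {w | w.1 ∈ A} = (Measure.pi fun _ : Fin n => P) A := by
  have : {w : (Fin n → Fin d → ℝ) × (Fin (momentIters d) → Fin d → ℝ) | w.1 ∈ A} =
      A ×ˢ Set.univ := by ext; simp
  rw [this, sampleLaw, Measure.prod_prod, measure_univ, mul_one]

theorem sampleLaw_snd {d : ℕ} (P : Measure (Fin d → ℝ)) [IsProbabilityMeasure P] (n : ℕ)
    (r ε δ : ℝ) (A : Set (Fin (momentIters d) → Fin d → ℝ)) :
    sampleLaw P n r ε δ {w | w.2 ∈ A} = noiseLaw d n (momentIters d) r ε δ A := by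
  have : {w : (Fin n → Fin d → ℝ) × (Fin (momentIters d) → Fin d → ℝ) | w.2 ∈ A} =
      Set.univ ×ˢ A := by ext; simp
  rw [this, sampleLaw, Measure.prod_prod, measure_univ, one_mul]

theorem sampleLaw_inaccurate_le {d n : ℕ} {P : Measure (Fin d → ℝ)} [IsProbabilityMeasure P]
    {r ε δ β : ℝ} (hd : 2 ≤ d) (hr : 2 ≤ r) (hε : 0 < ε) (hδ : 0 < δ) (hδ1 : δ < 1)
    (hβ : 0 < β) (hβ1 : β < 1) (h : BoundedMomentRatio P r) (hσ : ∀ j, sigma P j ≤ 1)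
    (hs : EnoughSamples d n r ε δ β) :
    sampleLaw P n r ε δ
        {w | ¬ ∀ j,
          (1 / 2) * max (sigma P j) (1 / (d : ℝ) ^ 2) ≤ momentOutput r w.1 w.2 j ∧
          momentOutput r w.1 w.2 j ≤ 8 * max (sigma P j) (1 / (d : ℝ) ^ 2)}
        ≤ ENNReal.ofReal β := by
  obtain ⟨hT1, hT2, -, hT4⟩ := momentIters_spec hd
  have hn := hs.pos hd hr hβ hβ1
  have hd0 : (0 : ℝ) < d := by positivity
  set T := momentIters d with hT
  let a : Fin T → ℝ := fun k => (1 / 2 : ℝ) ^ ((k : ℕ) + 1)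
  let A : Fin T → Fin d → Set (Fin T → Fin d → ℝ) := fun k j =>
    {ξ | 0.18 * a k ^ 2 < |ξ k j|}
  let U : Fin T → Fin d → Set (Fin n → Fin d → ℝ) := fun k j => {z | 8 * sigma P j < a k ∧
    0.07 * a k ^ 2 ≤ 1 / (n : ℝ) * ∑ i, min (z i j ^ 2) (truncLevel r k ^ 2)}
  let V : Fin T → Fin d → Set (Fin n → Fin d → ℝ) := fun k j => {z | (a k < sigma P j ∧
    sigma P j ≤ 2 * a k) ∧
    1 / (n : ℝ) * ∑ i, min (z i j ^ 2) (truncLevel r k ^ 2) < 0.43 * a k ^ 2}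
  have hl : 0 < Real.log (8 * d / β) := Real.log_pos (by
    rw [lt_div_iff₀ hβ]
    have : (2 : ℝ) ≤ d := by exact_mod_cast hd
    linarith)
  have hA : ∀ k j, sampleLaw P n r ε δ {w | w.2 ∈ A k j} ≤
      ENNReal.ofReal (β ^ 2 / (8 * d ^ 2)) := by
    intro k j
    rw [sampleLaw_snd]
    refine (noiseLaw_abs_gt_le (by positivity) k j).trans (ENNReal.ofReal_le_ofReal ?_)
    obtain ⟨h1, h2⟩ := sq_noiseStd_le hs hd hr hε hδ hδ1 hβ hβ1 k
    have h3 : -(0.18 * a k ^ 2) ^ 2 / (2 * noiseStd d n T r ε δ k ^ 2) ≤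
        -(2 * Real.log (4 * d / β)) := by
      rw [neg_div, neg_le_neg_iff, le_div_iff₀ (by positivity)]
      linarith
    calc _ ≤ 2 * Real.exp (-(2 * Real.log (4 * d / β))) := by gcongr
      _ = _ := by rw [exp_neg_two_log (by positivity)]; field_simp; ring
  have h64 : Real.exp (-(2 * Real.log (8 * d / β))) = β ^ 2 / (64 * d ^ 2) := by
    rw [exp_neg_two_log (by positivity)]; field_simp; ring
  have hU : ∀ k j, sampleLaw P n r ε δ {w | w.1 ∈ U k j} ≤
      ENNReal.ofReal (β ^ 2 / (64 * d ^ 2)) := by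
    intro k j
    rw [sampleLaw_fst]
    by_cases hc : 8 * sigma P j < a k
    · rw [← h64]
      refine (measure_mono fun z hz => ?_).trans
        (measure_truncMean_large_le h hr hl.le hs.1 hn (by positivity) hc)
      have := hz.2
      rw [truncLevel_eq] at this
      exact this
    · have : U k j = ∅ := Set.eq_empty_of_forall_notMem fun z hz => hc hz.1
      rw [this]; simp
  have hV : ∀ k j, sampleLaw P n r ε δ {w | w.1 ∈ V k j} ≤
      ENNReal.ofReal (β ^ 2 / (64 * d ^ 2)) := by
    intro k j
    rw [sampleLaw_fst]
    by_cases hc : a k < sigma P j ∧ sigma P j ≤ 2 * a k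
    · rw [← h64]
      refine (measure_mono fun z hz => ?_).trans
        (measure_truncMean_small_le h hr hl.le hs.1 hn (by positivity) hc.1 hc.2)
      have := hz.2
      rw [truncLevel_eq] at this
      exact this
    · have : V k j = ∅ := Set.eq_empty_of_forall_notMem fun z hz => hc hz.1
      rw [this]; simp
  have hsub : {w : (Fin n → Fin d → ℝ) × (Fin T → Fin d → ℝ) | ¬ ∀ j,
          (1 / 2) * max (sigma P j) (1 / (d : ℝ) ^ 2) ≤ momentOutput r w.1 w.2 j ∧
          momentOutput r w.1 w.2 j ≤ 8 * max (sigma P j) (1 / (d : ℝ) ^ 2)} ⊆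
      ⋃ q : Fin T × Fin d, ({w | w.2 ∈ A q.1 q.2} ∪
        ({w | w.1 ∈ U q.1 q.2} ∪ {w | w.1 ∈ V q.1 q.2})) := by
    intro w hw
    by_contra hcon
    simp only [Set.mem_iUnion, not_exists, Set.mem_union, not_or] at hcon
    refine hw fun j => momentOutput_bounds (by omega) hT1 hT2 (hσ j) (fun k => ?_)
      (fun k hk => ?_) (fun k hk1 hk2 => ?_)
    · exact not_lt.1 (hcon (k, j)).1
    · by_contra hc
      exact (hcon (k, j)).2.1 ⟨hk, not_lt.1 hc⟩
    · by_contra hc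
      exact (hcon (k, j)).2.2 ⟨⟨hk1, hk2⟩, not_le.1 hc⟩
  calc _ ≤ _ := measure_mono hsub
    _ ≤ ∑ q : Fin T × Fin d, sampleLaw P n r ε δ ({w | w.2 ∈ A q.1 q.2} ∪
        ({w | w.1 ∈ U q.1 q.2} ∪ {w | w.1 ∈ V q.1 q.2})) := measure_iUnion_fintype_le _ _
    -- The tails carry twice the logarithm, so each event has probability of order β²/d², small
    -- enough for a union over `T * d` ≤ 2d² pairs.
    _ ≤ ∑ _q : Fin T × Fin d, ENNReal.ofReal (β / (2 * d ^ 2)) := by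
      refine Finset.sum_le_sum fun q _ => ?_
      refine (measure_union_le _ _).trans ((add_le_add (hA _ _)
        ((measure_union_le _ _).trans (add_le_add (hU _ _) (hV _ _)))).trans ?_)
      rw [← ENNReal.ofReal_add (by positivity) (by positivity),
        ← ENNReal.ofReal_add (by positivity) (by positivity)]
      refine ENNReal.ofReal_le_ofReal ?_
      have : β ^ 2 / (8 * (d : ℝ) ^ 2) + (β ^ 2 / (64 * d ^ 2) + β ^ 2 / (64 * d ^ 2)) =
          (5 / 16 * β ^ 2) / (2 * d ^ 2) := by field_simp; ring
      rw [this]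
      gcongr
      nlinarith
    _ = ENNReal.ofReal (T * d * (β / (2 * d ^ 2))) := by
      rw [Finset.sum_const, Finset.card_univ, Fintype.card_prod, Fintype.card_fin,
        Fintype.card_fin, nsmul_eq_mul, ← ENNReal.ofReal_natCast,
        ← ENNReal.ofReal_mul (by positivity)]
      push_cast; rfl
    _ ≤ ENNReal.ofReal β := by
      refine ENNReal.ofReal_le_ofReal ?_
      have : (T : ℝ) ≤ 2 * d := by exact_mod_cast hT4
      calc T * d * (β / (2 * d ^ 2)) ≤ 2 * d * d * (β / (2 * d ^ 2)) := by gcongr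
        _ = β := by field_simp

/-! ### Projections -/

theorem sq_wnorm {d : ℕ} {w : Fin d → ℝ} (hw : ∀ j, 0 ≤ w j) (x : Fin d → ℝ) :
    wnorm w x ^ 2 = ∑ j, w j * x j ^ 2 :=
  Real.sq_sqrt (Finset.sum_nonneg fun j _ => mul_nonneg (hw j) (sq_nonneg _))

theorem wnorm_nonneg {d : ℕ} (w x : Fin d → ℝ) : 0 ≤ wnorm w x := Real.sqrt_nonneg _

theorem continuous_wnorm {d : ℕ} (w : Fin d → ℝ) : Continuous (wnorm w) := by
  unfold wnorm; fun_prop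

theorem wnorm_mono {d : ℕ} {w : Fin d → ℝ} (hw : ∀ j, 0 ≤ w j) {x y : Fin d → ℝ}
    (h : ∀ j, |x j| ≤ |y j|) : wnorm w x ≤ wnorm w y := by
  refine Real.sqrt_le_sqrt (Finset.sum_le_sum fun j _ => ?_)
  exact mul_le_mul_of_nonneg_left (sq_le_sq.2 (h j)) (hw j)

/-- Compactness alone provides a minimizer, with no positivity of the weights. AdaGrad needs this:
its matrix may have zero entries. -/
theorem wproj_spec {d : ℕ} {S : Set (Fin d → ℝ)} (hS : IsCompact S) (hne : S.Nonempty)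
    (w x : Fin d → ℝ) :
    wproj w S x ∈ S ∧ ∀ y ∈ S, wnorm w (wproj w S x - x) ≤ wnorm w (y - x) := by
  obtain ⟨p, hp, hmin⟩ := hS.exists_isMinOn hne
    (f := fun y => wnorm w (y - x)) ((continuous_wnorm w).comp (by fun_prop)).continuousOn
  exact Classical.epsilon_spec (p := fun p => p ∈ S ∧ ∀ y ∈ S, wnorm w (p - x) ≤ wnorm w (y - x))
    ⟨p, hp, fun y hy => hmin hy⟩

theorem wproj_eq_self {d : ℕ} {S : Set (Fin d → ℝ)} (hS : IsCompact S) {x : Fin d → ℝ}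
    (hx : x ∈ S) : wproj (fun _ => 1) S x = x := by
  have h1 := (wproj_spec hS ⟨x, hx⟩ (fun _ => 1) x).2 x hx
  have h2 : wnorm (fun _ : Fin d => (1 : ℝ)) (x - x) = 0 := by simp [wnorm]
  have h3 : wnorm (fun _ : Fin d => (1 : ℝ)) (wproj (fun _ => 1) S x - x) = 0 :=
    le_antisymm (h1.trans_eq h2) (wnorm_nonneg _ _)
  have h4 := sq_wnorm (w := fun _ : Fin d => (1 : ℝ)) (fun _ => zero_le_one)
    (wproj (fun _ => 1) S x - x)
  rw [h3] at h4
  simp only [one_mul] at h4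
  have h5 := (Finset.sum_eq_zero_iff_of_nonneg fun j _ => sq_nonneg _).1
    (h4.symm.trans (by norm_num))
  ext j
  have h6 := pow_eq_zero_iff (two_ne_zero) |>.1 (h5 j (Finset.mem_univ j))
  simpa [sub_eq_zero] using h6

/-- The Pythagorean inequality for projections onto convex sets. -/
theorem wproj_sum_sq_le {d : ℕ} {S : Set (Fin d → ℝ)} (hS : IsCompact S) (hc : Convex ℝ S)
    {w : Fin d → ℝ} (hw : ∀ j, 0 ≤ w j) (u : Fin d → ℝ) {y : Fin d → ℝ} (hy : y ∈ S) :
    ∑ j, w j * (wproj w S u j - y j) ^ 2 ≤ ∑ j, w j * (u j - y j) ^ 2 := by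
  obtain ⟨hp, hmin⟩ := wproj_spec hS ⟨y, hy⟩ w u
  set p := wproj w S u
  set A := ∑ j, w j * ((p j - u j) * (y j - p j)) with hA
  set N := ∑ j, w j * (y j - p j) ^ 2 with hN
  have hN0 : 0 ≤ N := Finset.sum_nonneg fun j _ => mul_nonneg (hw j) (sq_nonneg _)
  have key : ∀ t : ℝ, 0 < t → t ≤ 1 → 0 ≤ 2 * A + t * N := by
    intro t ht ht1
    have h1 := hmin (p + t • (y - p)) (hc.add_smul_sub_mem hp hy ⟨ht.le, ht1⟩)
    have h2 := pow_le_pow_left₀ (wnorm_nonneg _ _) h1 2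
    rw [sq_wnorm hw, sq_wnorm hw] at h2
    have h3 : ∑ j, w j * (p + t • (y - p) - u) j ^ 2 =
        ∑ j, w j * (p - u) j ^ 2 + t * (2 * A + t * N) := by
      rw [hA, hN, Finset.mul_sum, Finset.mul_sum, ← Finset.sum_add_distrib, Finset.mul_sum,
        ← Finset.sum_add_distrib]
      refine Finset.sum_congr rfl fun j _ => ?_
      simp only [Pi.add_apply, Pi.sub_apply, Pi.smul_apply, smul_eq_mul]
      ring
    rw [h3] at h2
    by_contra hneg
    push Not at hneg
    nlinarith
  have hA0 : 0 ≤ A := by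
    by_contra hneg
    push Not at hneg
    have hpos : 0 < N + 1 - A := by linarith
    -- A step t in (0, 1) with tN ≤ -A, so that 2A + tN ≤ A < 0 contradicts minimality along the
    -- segment to y.
    have h1 := key (-A / (N + 1 - A)) (div_pos (by linarith) hpos)
      ((div_le_one hpos).2 (by linarith))
    have h2 : -A / (N + 1 - A) * N ≤ -A := by
      rw [div_mul_eq_mul_div, div_le_iff₀ hpos]; nlinarith
    linarith
  have h4 : ∑ j, w j * (u j - y j) ^ 2 =
      ∑ j, w j * (p j - y j) ^ 2 + 2 * A + ∑ j, w j * (p j - u j) ^ 2 := by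
    rw [hA, Finset.mul_sum, ← Finset.sum_add_distrib, ← Finset.sum_add_distrib]
    exact Finset.sum_congr rfl fun j _ => by ring
  have h5 : 0 ≤ ∑ j, w j * (p j - u j) ^ 2 :=
    Finset.sum_nonneg fun j _ => mul_nonneg (hw j) (sq_nonneg _)
  linarith

theorem isCompact_ellipsoid {d : ℕ} {a : Fin d → ℝ} (ha : ∀ j, 0 < a j) :
    IsCompact (ellipsoid a) := by
  have h1 : IsCompact (Set.univ.pi fun j => Set.Icc (-√(a j)⁻¹) √(a j)⁻¹) :=
    isCompact_univ_pi fun j => isCompact_Icc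
  refine h1.of_isClosed_subset (isClosed_le (continuous_wnorm a) continuous_const) ?_
  intro x hx j _
  have hx' : wnorm a x ≤ 1 := hx
  have h2 : wnorm a x ^ 2 ≤ 1 := pow_le_one₀ (wnorm_nonneg _ _) hx'
  rw [sq_wnorm fun j => (ha j).le] at h2
  have h3 := Finset.single_le_sum (f := fun j => a j * x j ^ 2)
    (fun j _ => mul_nonneg (ha j).le (sq_nonneg _)) (Finset.mem_univ j)
  have h4 : x j ^ 2 ≤ (a j)⁻¹ := by
    rw [← one_div, le_div_iff₀' (ha j)]; exact h3.trans h2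
  exact abs_le.1 (Real.abs_le_sqrt h4)

/-- The product is nonpositive exactly when q lies between 0 and x. Otherwise q overshoots x or has
the wrong sign, and x or 0 is closer to x without being larger than q; replacing a coordinate in
this way stays in an axis-aligned ellipsoid. -/
theorem exists_closer_of_notMem {q x : ℝ} (h : ¬ (q * (q - x) ≤ 0)) :
    ∃ c, c ^ 2 ≤ q ^ 2 ∧ (c - x) ^ 2 < (q - x) ^ 2 := by
  push Not at h
  rcases lt_trichotomy (q * x) 0 with hqx | hqx | hqx
  · exact ⟨0, by nlinarith [sq_nonneg q], by nlinarith [mul_self_pos.2 (left_ne_zero_of_mul h.ne')]⟩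
  · refine ⟨0, by nlinarith [sq_nonneg q], ?_⟩
    nlinarith [mul_self_pos.2 (left_ne_zero_of_mul h.ne')]
  · refine ⟨x, ?_, ?_⟩
    · nlinarith [sq_nonneg (q - x)]
    · have := mul_self_pos.2 (right_ne_zero_of_mul h.ne')
      nlinarith

/-- Clipping to an axis-aligned ellipsoid shrinks every coordinate towards zero. -/
theorem wproj_ellipsoid_mul_le {d : ℕ} {a : Fin d → ℝ} (ha : ∀ j, 0 < a j) (x : Fin d → ℝ)
    (j : Fin d) : wproj (fun _ => 1) (ellipsoid a) x j *
      (wproj (fun _ => 1) (ellipsoid a) x j - x j) ≤ 0 := by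
  have h0 : (0 : Fin d → ℝ) ∈ ellipsoid a := by
    have : wnorm a 0 = 0 := by simp [wnorm]
    exact this.trans_le zero_le_one
  obtain ⟨hp, hmin⟩ := wproj_spec (isCompact_ellipsoid ha) ⟨0, h0⟩ (fun _ => 1) x
  set q := wproj (fun _ => 1) (ellipsoid a) x
  by_contra hcon
  obtain ⟨c, hc1, hc2⟩ := exists_closer_of_notMem hcon
  have hmem : Function.update q j c ∈ ellipsoid a := by
    refine (wnorm_mono (fun j => (ha j).le) fun l => ?_).trans (show wnorm a q ≤ 1 from hp)
    by_cases hl : l = j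
    · subst hl; rw [Function.update_self]; exact sq_le_sq.1 hc1
    · rw [Function.update_of_ne hl]
  have h1 := pow_le_pow_left₀ (wnorm_nonneg _ _) (hmin _ hmem) 2
  rw [sq_wnorm fun _ => zero_le_one, sq_wnorm fun _ => zero_le_one] at h1
  refine absurd h1 (not_le.2 (Finset.sum_lt_sum (fun l _ => ?_) ⟨j, Finset.mem_univ j, ?_⟩))
  · by_cases hl : l = j
    · subst hl; simpa using hc2.le
    · simp [Function.update_of_ne hl]
  · simpa using hc2

theorem abs_le_abs_of_mul_sub_nonpos {q x : ℝ} (h : q * (q - x) ≤ 0) :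
    |q| ≤ |x| ∧ |x - q| ≤ |x| := by
  constructor <;> refine sq_le_sq.1 ?_ <;> nlinarith [sq_nonneg (q - x), sq_nonneg q]

/-! ### The AdaGrad regret along a path -/

/-- With s the running root of the sum of squares, the distance terms telescope up to (s' - s)u/D ≤
D(s' - s), and g² = (s' - s)(s' + s) gives Dg²/s' ≤ 2D(s' - s). Keeping -su/D on the right makes the
induction close. -/
theorem adaGrad_coordinate_le {D : ℝ} (hD : 0 < D) (g u : ℕ → ℝ) (T : ℕ)
    (hu : ∀ k ≤ T, 0 ≤ u k ∧ u k ≤ D ^ 2) :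
    ∑ k ∈ Finset.range T, (√(∑ i ∈ Finset.range (k + 1), g i ^ 2) / D * (u k - u (k + 1)) +
      (√(∑ i ∈ Finset.range (k + 1), g i ^ 2) / D)⁻¹ * g k ^ 2) ≤
    3 * D * √(∑ k ∈ Finset.range T, g k ^ 2) - √(∑ k ∈ Finset.range T, g k ^ 2) / D * u T := by
  induction T with
  | zero => simp
  | succ T ih =>
    have h1 := ih fun k hk => hu k (by omega)
    rw [Finset.sum_range_succ]
    set s := √(∑ k ∈ Finset.range T, g k ^ 2) with hs
    set s' := √(∑ k ∈ Finset.range (T + 1), g k ^ 2) with hs'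
    have hsum0 : ∀ m, 0 ≤ ∑ k ∈ Finset.range m, g k ^ 2 :=
      fun m => Finset.sum_nonneg fun _ _ => sq_nonneg _
    have hs0 : 0 ≤ s := Real.sqrt_nonneg _
    have hs'0 : 0 ≤ s' := Real.sqrt_nonneg _
    have hsq : s' ^ 2 = s ^ 2 + g T ^ 2 := by
      rw [hs, hs', Real.sq_sqrt (hsum0 _), Real.sq_sqrt (hsum0 _), Finset.sum_range_succ]
    have hle : s ≤ s' := by
      refine Real.sqrt_le_sqrt ?_
      rw [Finset.sum_range_succ]; nlinarith [sq_nonneg (g T)]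
    have h2 : (s' / D)⁻¹ * g T ^ 2 ≤ 2 * D * (s' - s) := by
      rcases hs'0.eq_or_lt with h | h
      · rw [← h]; simp; nlinarith
      · rw [inv_div, div_mul_eq_mul_div, div_le_iff₀ h]
        have : g T ^ 2 = (s' - s) * (s' + s) := by linarith
        rw [this]
        have : 0 ≤ D * (s' - s) := mul_nonneg hD.le (by linarith)
        nlinarith
    have h3 : (s' - s) / D * u T ≤ D * (s' - s) := by
      rw [div_mul_eq_mul_div, div_le_iff₀ hD]
      have := mul_le_mul_of_nonneg_left (hu T (by omega)).2 (sub_nonneg.2 hle)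
      linarith
    have h4 : s' / D * (u T - u (T + 1)) =
        (s' - s) / D * u T + s / D * u T - s' / D * u (T + 1) := by ring
    rw [h4]
    linarith

theorem adaGrad_regret {d : ℕ} {X : Set (Fin d → ℝ)} (hX : IsCompact X) (hc : Convex ℝ X)
    {D : ℝ} (hD : 0 < D) (hdiam : ∀ x ∈ X, ∀ y ∈ X, ∀ j, |x j - y j| ≤ D)
    (g x : ℕ → Fin d → ℝ) (T : ℕ) (hx0 : x 0 ∈ X)
    (hx : ∀ k < T, x (k + 1) =
      wproj (fun j => √(∑ i ∈ Finset.range (k + 1), g i j ^ 2) / D) X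
        (fun j => x k j - (√(∑ i ∈ Finset.range (k + 1), g i j ^ 2) / D)⁻¹ * g k j))
    {y : Fin d → ℝ} (hy : y ∈ X) :
    (∀ k ≤ T, x k ∈ X) ∧
    ∑ k ∈ Finset.range T, ∑ j, g k j * (x k j - y j) ≤
      3 / 2 * D * ∑ j, √(∑ k ∈ Finset.range T, g k j ^ 2) := by
  have hmem : ∀ k ≤ T, x k ∈ X := by
    intro k hk
    cases k with
    | zero => exact hx0
    | succ k => rw [hx k (by omega)]; exact (wproj_spec hX ⟨y, hy⟩ _ _).1
  refine ⟨hmem, ?_⟩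
  have hstep : ∀ k ∈ Finset.range T, 2 * ∑ j, g k j * (x k j - y j) ≤
      ∑ j, (√(∑ i ∈ Finset.range (k + 1), g i j ^ 2) / D *
        ((x k j - y j) ^ 2 - (x (k + 1) j - y j) ^ 2) +
      (√(∑ i ∈ Finset.range (k + 1), g i j ^ 2) / D)⁻¹ * g k j ^ 2) := by
    intro k hk
    have h1 := hx k (Finset.mem_range.1 hk)
    set H : Fin d → ℝ := fun j => √(∑ i ∈ Finset.range (k + 1), g i j ^ 2) / D with hH
    have hH0 : ∀ j, 0 ≤ H j := fun j => by positivity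
    have h2 := wproj_sum_sq_le hX hc hH0 (fun j => x k j - (H j)⁻¹ * g k j) hy
    rw [← h1] at h2
    have h3 : ∀ j, H j * (x k j - (H j)⁻¹ * g k j - y j) ^ 2 =
        H j * (x k j - y j) ^ 2 - 2 * (g k j * (x k j - y j)) + (H j)⁻¹ * g k j ^ 2 := by
      intro j
      -- If H_j = 0, every gradient so far, including the current one, vanishes in coordinate j, so
      -- the convention 0⁻¹ = 0 is harmless.
      by_cases h0 : H j = 0
      · have h4 : g k j = 0 := by
          simp only [hH, div_eq_zero_iff, hD.ne', or_false] at h0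
          rw [Real.sqrt_eq_zero (Finset.sum_nonneg fun _ _ => sq_nonneg _),
            Finset.sum_eq_zero_iff_of_nonneg fun _ _ => sq_nonneg _] at h0
          exact pow_eq_zero_iff two_ne_zero |>.1 (h0 k (Finset.self_mem_range_succ k))
        rw [h0, h4]; ring
      · field_simp; ring
    simp only [h3] at h2
    rw [Finset.sum_add_distrib, Finset.sum_sub_distrib, ← Finset.mul_sum] at h2
    change _ ≤ ∑ j, (H j * ((x k j - y j) ^ 2 - (x (k + 1) j - y j) ^ 2) + (H j)⁻¹ * g k j ^ 2)
    simp only [mul_sub (H _)]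
    rw [Finset.sum_add_distrib, Finset.sum_sub_distrib]
    linarith
  have h5 := Finset.sum_le_sum hstep
  rw [← Finset.mul_sum, Finset.sum_comm (s := Finset.range T) (t := Finset.univ)
    (f := fun k j => _ * ((x k j - y j) ^ 2 - _) + _)] at h5
  have h6 : ∀ j, ∑ k ∈ Finset.range T, (√(∑ i ∈ Finset.range (k + 1), g i j ^ 2) / D *
        ((x k j - y j) ^ 2 - (x (k + 1) j - y j) ^ 2) +
      (√(∑ i ∈ Finset.range (k + 1), g i j ^ 2) / D)⁻¹ * g k j ^ 2) ≤
      3 * D * √(∑ k ∈ Finset.range T, g k j ^ 2) := by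
    intro j
    refine (adaGrad_coordinate_le hD (fun k => g k j) (fun k => (x k j - y j) ^ 2) T
      fun k hk => ⟨sq_nonneg _, ?_⟩).trans ?_
    · rw [← sq_abs]
      exact pow_le_pow_left₀ (abs_nonneg _) (hdiam _ (hmem k hk) _ hy j) 2
    · have : 0 ≤ √(∑ k ∈ Finset.range T, g k j ^ 2) / D * (x T j - y j) ^ 2 := by positivity
      linarith
  have h7 := h5.trans (Finset.sum_le_sum fun j _ => h6 j)
  rw [← Finset.mul_sum] at h7
  linarith

theorem sqrt_sum_sq_add_le {ι : Type*} (s : Finset ι) (f g : ι → ℝ) :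
    √(∑ i ∈ s, (f i + g i) ^ 2) ≤ √(∑ i ∈ s, f i ^ 2) + √(∑ i ∈ s, g i ^ 2) := by
  rw [Real.sqrt_le_left (by positivity)]
  have h1 := Real.sum_mul_le_sqrt_mul_sqrt s f g
  rw [add_sq, Real.sq_sqrt (Finset.sum_nonneg fun _ _ => sq_nonneg _),
    Real.sq_sqrt (Finset.sum_nonneg fun _ _ => sq_nonneg _)]
  simp only [add_sq, Finset.sum_add_distrib]
  have h2 : ∑ i ∈ s, 2 * f i * g i = 2 * ∑ i ∈ s, f i * g i := by
    rw [Finset.mul_sum]; exact Finset.sum_congr rfl fun _ _ => by ring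
  rw [h2]
  linarith

/-! ### The empirical loss -/

section Loss

variable {d n : ℕ} {X : Set (Fin d → ℝ)} {F : (Fin d → ℝ) → (Fin d → ℝ) → ℝ}
  {g : (Fin d → ℝ) → (Fin d → ℝ) → (Fin d → ℝ)}

theorem abs_sub_le_diam (hX : IsCompact X) {x y : Fin d → ℝ} (hx : x ∈ X) (hy : y ∈ X)
    (j : Fin d) : |x j - y j| ≤ Metric.diam X := by
  rw [← Real.dist_eq]
  exact (dist_le_pi_dist x y j).trans (Metric.dist_le_diam_of_mem hX.isBounded hx hy)

theorem IsGradientOracle.empLoss_sub_le (h : IsGradientOracle X F g) (S : Fin n → Fin d → ℝ)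
    {x y : Fin d → ℝ} (hx : x ∈ X) (hy : y ∈ X) :
    empLoss F S x - empLoss F S y ≤
      1 / (n : ℝ) * ∑ i, ∑ j, g x (S i) j * (x j - y j) := by
  rw [empLoss, empLoss, ← mul_sub, ← Finset.sum_sub_distrib]
  refine mul_le_mul_of_nonneg_left (Finset.sum_le_sum fun i _ => ?_) (by positivity)
  have h1 := h.subgradient (S i) x hx y hy
  have h2 : ∑ j, g x (S i) j * (x j - y j) = -∑ j, g x (S i) j * (y j - x j) := by
    rw [← Finset.sum_neg_distrib]; exact Finset.sum_congr rfl fun _ _ => by ring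
  linarith

theorem IsGradientOracle.empLoss_sub_le_mul (h : IsGradientOracle X F g) (S : Fin n → Fin d → ℝ)
    {x y : Fin d → ℝ} (hx : x ∈ X) (hy : y ∈ X) {D : ℝ} (hD : ∀ j, |x j - y j| ≤ D) :
    empLoss F S x - empLoss F S y ≤ (1 / (n : ℝ) * ∑ i, ∑ j, |S i j|) * D := by
  refine (h.empLoss_sub_le S hx hy).trans ?_
  rw [mul_assoc, Finset.sum_mul]
  refine mul_le_mul_of_nonneg_left (Finset.sum_le_sum fun i _ => ?_) (by positivity)
  rw [Finset.sum_mul]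
  refine Finset.sum_le_sum fun j _ => (le_abs_self _).trans ?_
  rw [abs_mul]
  exact mul_le_mul (h.bound (S i) x hx j) (hD j) (abs_nonneg _) (abs_nonneg _)

theorem IsGradientOracle.continuousOn_empLoss (h : IsGradientOracle X F g)
    (S : Fin n → Fin d → ℝ) : ContinuousOn (empLoss F S) X := by
  have hK : 0 ≤ 1 / (n : ℝ) * ∑ i, ∑ j, |S i j| := by positivity
  have : LipschitzOnWith (Real.toNNReal (1 / (n : ℝ) * ∑ i, ∑ j, |S i j|)) (empLoss F S) X := by
    refine LipschitzOnWith.of_dist_le_mul fun x hx y hy => ?_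
    rw [Real.coe_toNNReal _ hK, Real.dist_eq, abs_le]
    have h1 := h.empLoss_sub_le_mul S hx hy (D := dist x y) (dist_le_pi_dist x y)
    have h2 := h.empLoss_sub_le_mul S hy hx (D := dist y x) (dist_le_pi_dist y x)
    rw [dist_comm y x] at h2
    constructor <;> linarith
  exact this.continuousOn

theorem IsGradientOracle.convexOn_empLoss (h : IsGradientOracle X F g) (hc : Convex ℝ X)
    (S : Fin n → Fin d → ℝ) : ConvexOn ℝ X (empLoss F S) := by
  refine ⟨hc, fun x hx y hy a b ha hb hab => ?_⟩
  simp only [empLoss, smul_eq_mul]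
  have h1 : a * (1 / (n : ℝ) * ∑ i, F x (S i)) + b * (1 / (n : ℝ) * ∑ i, F y (S i)) =
      1 / (n : ℝ) * ∑ i, (a * F x (S i) + b * F y (S i)) := by
    rw [Finset.sum_add_distrib, ← Finset.mul_sum, ← Finset.mul_sum]; ring
  rw [h1]
  exact mul_le_mul_of_nonneg_left
    (Finset.sum_le_sum fun i _ => (h.convex (S i)).2 hx hy ha hb hab) (by positivity)

end Loss

/-! ### Runs of PAGAN -/

section Path

variable {d n : ℕ} {X : Set (Fin d → ℝ)} {g : (Fin d → ℝ) → (Fin d → ℝ) → (Fin d → ℝ)}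
  {S : Fin n → Fin d → ℝ} {T : ℕ} {a : Fin d → ℝ} {ε δ : ℝ}

theorem batchGrad_one (I : Fin 1 → Fin n) (x : Fin d → ℝ) : batchGrad g S I x = g x (S (I 0)) := by
  ext j; simp [batchGrad]

/-- A deterministic decomposition along one path. Clipping shrinks each coordinate, so the clipped
gradients in the AdaGrad bound may be replaced by the true ones; the clipping error goes into `b`,
and the last sum will have mean zero. -/
theorem pagan_path_le (hX : IsCompact X) (hc : Convex ℝ X) (hD : 0 < Metric.diam X)
    (ha : ∀ j, 0 < a j) (hε : 0 < ε) {b : Fin n → ℝ} {y : Fin d → ℝ} (hy : y ∈ X)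
    (hb : ∀ i, ∀ x ∈ X, ∑ j, (g x (S i) j - wproj (fun _ => 1) (ellipsoid a) (g x (S i)) j) *
      (x j - y j) ≤ b i)
    (I : ℕ → Fin 1 → Fin n) (ξ x : ℕ → Fin d → ℝ) (hx0 : x 0 ∈ X)
    (hx : ∀ k < T,
      let gh : ℕ → Fin d → ℝ := fun i => privGrad g S a ε δ (I i) (ξ i) (x i)
      let H : Fin d → ℝ := fun j => √(∑ i ∈ Finset.range (k + 1), gh i j ^ 2) / Metric.diam X
      x (k + 1) = wproj H X (fun j => x k j - (H j)⁻¹ * gh k j)) :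
    (∀ k ≤ T, x k ∈ X) ∧
    ∑ k ∈ Finset.range T, ∑ j, g (x k) (S (I k 0)) j * (x k j - y j) ≤
      3 / 2 * Metric.diam X * ∑ j, √(∑ k ∈ Finset.range T, g (x k) (S (I k 0)) j ^ 2) +
      3 / 2 * Metric.diam X * (√(Real.log (1 / δ)) / ε) *
        ∑ j, √(∑ k ∈ Finset.range T, ξ k j ^ 2) +
      ∑ k ∈ Finset.range T, b (I k 0) -
      √(Real.log (1 / δ)) / ε * ∑ k ∈ Finset.range T, ∑ j, ξ k j * (x k j - y j) := by
  set η := √(Real.log (1 / δ)) / ε with hη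
  have hη0 : 0 ≤ η := by positivity
  set G : ℕ → Fin d → ℝ := fun k => g (x k) (S (I k 0)) with hG
  set q : ℕ → Fin d → ℝ := fun k => wproj (fun _ => 1) (ellipsoid a) (G k) with hq
  set gh : ℕ → Fin d → ℝ := fun i => privGrad g S a ε δ (I i) (ξ i) (x i) with hgh
  have hgh1 : ∀ k j, gh k j = q k j + η * ξ k j := by
    intro k j; simp [hgh, privGrad, hq, hG, hη]
  obtain ⟨hmem, hreg⟩ := adaGrad_regret hX hc hD
    (fun x hx y hy j => abs_sub_le_diam hX hx hy j) gh x T hx0 hx hy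
  refine ⟨hmem, ?_⟩
  have h1 : ∀ j, √(∑ k ∈ Finset.range T, gh k j ^ 2) ≤
      √(∑ k ∈ Finset.range T, G k j ^ 2) + η * √(∑ k ∈ Finset.range T, ξ k j ^ 2) := by
    intro j
    simp only [hgh1]
    refine (sqrt_sum_sq_add_le _ _ _).trans (add_le_add ?_ ?_)
    · refine Real.sqrt_le_sqrt (Finset.sum_le_sum fun k _ => sq_le_sq.2 ?_)
      exact (abs_le_abs_of_mul_sub_nonpos (wproj_ellipsoid_mul_le ha (G k) j)).1
    · simp only [mul_pow]
      rw [← Finset.mul_sum, Real.sqrt_mul (sq_nonneg _), Real.sqrt_sq hη0]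
  have h2 : ∑ k ∈ Finset.range T, ∑ j, G k j * (x k j - y j) =
      ∑ k ∈ Finset.range T, ∑ j, gh k j * (x k j - y j) +
      ∑ k ∈ Finset.range T, ∑ j, (G k j - q k j) * (x k j - y j) -
      η * ∑ k ∈ Finset.range T, ∑ j, ξ k j * (x k j - y j) := by
    rw [Finset.mul_sum, ← Finset.sum_add_distrib, ← Finset.sum_sub_distrib]
    refine Finset.sum_congr rfl fun k _ => ?_
    rw [Finset.mul_sum, ← Finset.sum_add_distrib, ← Finset.sum_sub_distrib]
    refine Finset.sum_congr rfl fun j _ => ?_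
    rw [hgh1]; ring
  have h3 : ∑ k ∈ Finset.range T, ∑ j, (G k j - q k j) * (x k j - y j) ≤
      ∑ k ∈ Finset.range T, b (I k 0) :=
    Finset.sum_le_sum fun k hk => hb (I k 0) (x k) (hmem k (Finset.mem_range.1 hk).le)
  have h4 : 3 / 2 * Metric.diam X * ∑ j, √(∑ k ∈ Finset.range T, gh k j ^ 2) ≤
      3 / 2 * Metric.diam X * ∑ j, √(∑ k ∈ Finset.range T, G k j ^ 2) +
      3 / 2 * Metric.diam X * η * ∑ j, √(∑ k ∈ Finset.range T, ξ k j ^ 2) := by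
    have h5 := Finset.sum_le_sum fun j (_ : j ∈ Finset.univ) => h1 j
    rw [Finset.sum_add_distrib, ← Finset.mul_sum] at h5
    have h6 := mul_le_mul_of_nonneg_left h5 (by positivity : 0 ≤ 3 / 2 * Metric.diam X)
    linarith
  rw [h2]
  linarith

end Path

/-! ### Fresh batches and fresh noise in expectation -/

section Run

variable {d n : ℕ} {Ω : Type} {mΩ : MeasurableSpace Ω} {ν : Measure Ω}
  {ℱ : Filtration ℕ mΩ} {X : Set (Fin d → ℝ)}
  {g : (Fin d → ℝ) → (Fin d → ℝ) → (Fin d → ℝ)} {S : Fin n → Fin d → ℝ} {T : ℕ} {α : ℝ}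
  {a : Fin d → ℝ} {ε δ : ℝ} {I : ℕ → Ω → Fin 1 → Fin n} {ξ x : ℕ → Ω → Fin d → ℝ}

theorem IsPaganRun.measurable_iterate (h : IsPaganRun ν ℱ X g S T α a ε δ I ξ x) (k : ℕ) :
    Measurable (x k) := (h.adapted k).mono (ℱ.le k) le_rfl

theorem IsPaganRun.measurable_batch (h : IsPaganRun ν ℱ X g S T α a ε δ I ξ x) (k : ℕ) :
    Measurable (I k) := (h.batch_measurable k).mono (ℱ.le (k + 1)) le_rfl

theorem IsPaganRun.measurable_noise (h : IsPaganRun ν ℱ X g S T α a ε δ I ξ x) (k : ℕ) :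
    Measurable (ξ k) := (h.noise_measurable k).mono (ℱ.le (k + 1)) le_rfl

theorem IsPaganRun.indepFun (h : IsPaganRun ν ℱ X g S T α a ε δ I ξ x) (k : ℕ) {φ : Ω → ℝ}
    (hφ : Measurable[ℱ k] φ) {ψ : (Fin 1 → Fin n) × (Fin d → ℝ) → ℝ} (hψ : Measurable ψ) :
    IndepFun (fun ω => ψ (I k ω, ξ k ω)) φ ν := by
  rw [IndepFun_iff_Indep]
  refine indep_of_indep_of_le_right (indep_of_indep_of_le_left (h.indep k) ?_) hφ.comap_le
  have : MeasurableSpace.comap (fun ω => ψ (I k ω, ξ k ω)) inferInstance =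
      MeasurableSpace.comap (fun ω => (I k ω, ξ k ω)) (MeasurableSpace.comap ψ inferInstance) :=
    MeasurableSpace.comap_comp.symm
  rw [this]
  exact MeasurableSpace.comap_mono hψ.comap_le

theorem IsPaganRun.map_batch (h : IsPaganRun ν ℱ X g S T α a ε δ I ξ x) (hn : 0 < n) (k : ℕ) :
    ν.map (fun ω => I k ω 0) = uniformOn (Set.univ : Set (Fin n)) := by
  have : Nonempty (Fin n) := ⟨⟨0, hn⟩⟩
  have : IsProbabilityMeasure (uniformOn (Set.univ : Set (Fin n))) :=
    isProbabilityMeasure_uniformOn Set.finite_univ Set.univ_nonempty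
  have h1 : ν.map (fun ω => I k ω 0) =
      (ν.map (fun ω => (I k ω, ξ k ω))).map (fun q => q.1 0) := by
    rw [Measure.map_map (by fun_prop) ((h.measurable_batch k).prodMk (h.measurable_noise k))]
    rfl
  rw [h1, h.law k]
  have h2 := (measurePreserving_eval (fun _ : Fin 1 => uniformOn (Set.univ : Set (Fin n))) 0).comp
    (measurePreserving_fst (μ := Measure.pi fun _ : Fin 1 => uniformOn (Set.univ : Set (Fin n)))
      (ν := Measure.pi fun j => gaussianReal 0 (Real.toNNReal (a j)⁻¹)))
  exact h2.map_eq

theorem IsPaganRun.map_noise (h : IsPaganRun ν ℱ X g S T α a ε δ I ξ x) (hn : 0 < n) (k : ℕ)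
    (j : Fin d) : ν.map (fun ω => ξ k ω j) = gaussianReal 0 (Real.toNNReal (a j)⁻¹) := by
  have : Nonempty (Fin n) := ⟨⟨0, hn⟩⟩
  have : IsProbabilityMeasure (uniformOn (Set.univ : Set (Fin n))) :=
    isProbabilityMeasure_uniformOn Set.finite_univ Set.univ_nonempty
  have h1 : ν.map (fun ω => ξ k ω j) =
      (ν.map (fun ω => (I k ω, ξ k ω))).map (fun q => q.2 j) := by
    rw [Measure.map_map (by fun_prop) ((h.measurable_batch k).prodMk (h.measurable_noise k))]
    rfl
  rw [h1, h.law k]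
  have h2 := (measurePreserving_eval (fun j => gaussianReal 0 (Real.toNNReal (a j)⁻¹)) j).comp
    (measurePreserving_snd (μ := Measure.pi fun _ : Fin 1 => uniformOn (Set.univ : Set (Fin n)))
      (ν := Measure.pi fun j => gaussianReal 0 (Real.toNNReal (a j)⁻¹)))
  exact h2.map_eq

/-- Unbiasedness of sampling: split over the value of the index, each indicator being independent of
the past. -/
theorem IsPaganRun.integral_batch [IsProbabilityMeasure ν] (h : IsPaganRun ν ℱ X g S T α a ε δ I ξ x) (hn : 0 < n) (k : ℕ)
    {Φ : Fin n → Ω → ℝ} (hΦ : ∀ i, Measurable[ℱ k] (Φ i)) (hi : ∀ i, Integrable (Φ i) ν) :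
    Integrable (fun ω => Φ (I k ω 0) ω) ν ∧
      ∫ ω, Φ (I k ω 0) ω ∂ν = 1 / (n : ℝ) * ∑ i, ∫ ω, Φ i ω ∂ν := by
  have hrep : ∀ ω, Φ (I k ω 0) ω = ∑ i, (if I k ω 0 = i then (1 : ℝ) else 0) * Φ i ω := by
    intro ω; simp
  have hI : Measurable fun ω => I k ω 0 := (measurable_pi_apply 0).comp (h.measurable_batch k)
  have hm : ∀ i, Measurable fun ω => if I k ω 0 = i then (1 : ℝ) else 0 := fun i =>
    (measurable_of_countable fun l : Fin n => if l = i then (1 : ℝ) else 0).comp hI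
  have hint : ∀ i, Integrable (fun ω => if I k ω 0 = i then (1 : ℝ) else 0) ν := fun i =>
    Integrable.of_bound (hm i).aestronglyMeasurable 1
      (Filter.Eventually.of_forall fun ω => by split_ifs <;> simp)
  have hind : ∀ i, IndepFun (fun ω => if I k ω 0 = i then (1 : ℝ) else 0) (Φ i) ν := fun i =>
    h.indepFun k (hΦ i) (ψ := fun q => if q.1 0 = i then (1 : ℝ) else 0)
      ((measurable_of_countable fun l : Fin n => if l = i then (1 : ℝ) else 0).comp
        ((measurable_pi_apply 0).comp measurable_fst))
  have hone : ∀ i, ∫ ω, (if I k ω 0 = i then (1 : ℝ) else 0) ∂ν = 1 / n := by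
    intro i
    have h1 := integral_map (μ := ν) hI.aemeasurable
      (f := fun l : Fin n => if l = i then (1 : ℝ) else 0)
      (measurable_of_countable _).aestronglyMeasurable
    rw [← h1, h.map_batch hn k]
    have : IsFiniteMeasure (uniformOn (Set.univ : Set (Fin n))) := by
      have : Nonempty (Fin n) := ⟨⟨0, hn⟩⟩
      have := isProbabilityMeasure_uniformOn (Set.finite_univ (α := Fin n)) Set.univ_nonempty
      infer_instance
    rw [integral_fintype (Integrable.of_finite)]
    simp [Measure.real, uniformOn_univ]
  have hmul : ∀ i, Integrable (fun ω => (if I k ω 0 = i then (1 : ℝ) else 0) * Φ i ω) ν := fun i =>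
    (hind i).integrable_mul (hint i) (hi i)
  constructor
  · simp only [hrep]
    exact integrable_finsetSum _ fun i _ => hmul i
  · simp only [hrep]
    rw [integral_finsetSum _ fun i _ => hmul i, Finset.mul_sum]
    refine Finset.sum_congr rfl fun i _ => ?_
    rw [(hind i).integral_fun_mul_eq_mul_integral (hm i).aestronglyMeasurable
      (hi i).aestronglyMeasurable, hone]

theorem IsPaganRun.integral_noise_mul (h : IsPaganRun ν ℱ X g S T α a ε δ I ξ x) (hn : 0 < n)
    (k : ℕ) (j : Fin d) {Φ : Ω → ℝ} (hΦ : Measurable[ℱ k] Φ) (hi : Integrable Φ ν) :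
    Integrable (fun ω => ξ k ω j * Φ ω) ν ∧ ∫ ω, ξ k ω j * Φ ω ∂ν = 0 := by
  have hm : Measurable fun ω => ξ k ω j := (measurable_pi_apply j).comp (h.measurable_noise k)
  have hind : IndepFun (fun ω => ξ k ω j) Φ ν := h.indepFun k hΦ (ψ := fun q => q.2 j)
    (by fun_prop)
  have hid : Integrable (fun y : ℝ => y) (ν.map (fun ω => ξ k ω j)) := by
    rw [h.map_noise hn k j]; exact (memLp_id_gaussianReal 1).integrable (by simp)
  have h1 : Integrable (fun ω => ξ k ω j) ν := hid.comp_measurable hm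
  have h2 : ∫ ω, ξ k ω j ∂ν = 0 := by
    rw [← integral_map (f := fun y : ℝ => y) hm.aemeasurable (by fun_prop), h.map_noise hn k j,
      integral_id_gaussianReal]
  refine ⟨hind.integrable_mul h1 hi, ?_⟩
  rw [hind.integral_fun_mul_eq_mul_integral hm.aestronglyMeasurable hi.aestronglyMeasurable, h2,
    zero_mul]

theorem IsPaganRun.integral_noise_sq (h : IsPaganRun ν ℱ X g S T α a ε δ I ξ x) (hn : 0 < n)
    (k : ℕ) (j : Fin d) (ha : 0 < a j) :
    Integrable (fun ω => ξ k ω j ^ 2) ν ∧ ∫ ω, ξ k ω j ^ 2 ∂ν = (a j)⁻¹ := by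
  have hm : Measurable fun ω => ξ k ω j := (measurable_pi_apply j).comp (h.measurable_noise k)
  have hid : Integrable (fun y : ℝ => y ^ 2) (ν.map (fun ω => ξ k ω j)) := by
    rw [h.map_noise hn k j]; exact (memLp_id_gaussianReal 2).integrable_sq
  refine ⟨hid.comp_measurable hm, ?_⟩
  rw [← integral_map (f := fun y : ℝ => y ^ 2) hm.aemeasurable (by fun_prop), h.map_noise hn k j]
  have h1 := variance_eq_sub (memLp_id_gaussianReal (μ := 0)
    (v := Real.toNNReal (a j)⁻¹) 2)
  rw [variance_id_gaussianReal, Real.coe_toNNReal _ (by positivity)] at h1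
  simp only [id_eq, Pi.pow_apply, integral_id_gaussianReal] at h1
  simpa using h1.symm

/-- Jensen's inequality in the form of a nonnegative variance: only second moments of the noise
enter, not independence across iterations. -/
theorem IsPaganRun.integral_sqrt_noise_le [IsProbabilityMeasure ν]
    (h : IsPaganRun ν ℱ X g S T α a ε δ I ξ x) (hn : 0 < n)
    (m : ℕ) (j : Fin d) (ha : 0 < a j) :
    Integrable (fun ω => √(∑ k ∈ Finset.range m, ξ k ω j ^ 2)) ν ∧
      ∫ ω, √(∑ k ∈ Finset.range m, ξ k ω j ^ 2) ∂ν ≤ √m * √(a j)⁻¹ := by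
  have hm : Measurable fun ω => √(∑ k ∈ Finset.range m, ξ k ω j ^ 2) := by
    refine Real.continuous_sqrt.measurable.comp (Finset.measurable_sum _ fun k _ => ?_)
    exact ((measurable_pi_apply j).comp (h.measurable_noise k)).pow_const 2
  have hint := fun k => (h.integral_noise_sq hn k j ha).1
  have hL : MemLp (fun ω => √(∑ k ∈ Finset.range m, ξ k ω j ^ 2)) 2 ν := by
    rw [memLp_two_iff_integrable_sq hm.aestronglyMeasurable]
    refine (integrable_finsetSum (Finset.range m) fun k _ => hint k).congr
      (Filter.Eventually.of_forall fun ω => ?_)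
    exact (Real.sq_sqrt (Finset.sum_nonneg fun _ _ => sq_nonneg _)).symm
  refine ⟨hL.integrable (by norm_num), ?_⟩
  have h1 := variance_eq_sub hL
  have h2 := variance_nonneg (fun ω => √(∑ k ∈ Finset.range m, ξ k ω j ^ 2)) ν
  rw [h1] at h2
  have h3 : ∫ ω, (√(∑ k ∈ Finset.range m, ξ k ω j ^ 2)) ^ 2 ∂ν = m * (a j)⁻¹ := by
    simp only [Real.sq_sqrt (Finset.sum_nonneg fun _ _ => sq_nonneg _)]
    rw [integral_finsetSum _ fun k _ => hint k]
    simp [(h.integral_noise_sq hn _ j ha).2]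
  simp only [Pi.pow_apply] at h2
  rw [h3] at h2
  rw [← Real.sqrt_mul (Nat.cast_nonneg m)]
  exact Real.le_sqrt_of_sq_le (by linarith)

end Run

/-! ### Expected regret of a run -/

section Regret

variable {d n : ℕ} {Ω : Type} {mΩ : MeasurableSpace Ω} {ν : Measure Ω}
  {ℱ : Filtration ℕ mΩ} {X : Set (Fin d → ℝ)} {F : (Fin d → ℝ) → (Fin d → ℝ) → ℝ}
  {g : (Fin d → ℝ) → (Fin d → ℝ) → (Fin d → ℝ)} {S : Fin n → Fin d → ℝ} {T : ℕ}
  {a : Fin d → ℝ} {ε δ : ℝ} {I : ℕ → Ω → Fin 1 → Fin n} {ξ x : ℕ → Ω → Fin d → ℝ}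

/-- Nothing is known about the losses outside X, so measurability is obtained from the indicator of
X. -/
theorem integrable_comp_of_continuousOn [IsFiniteMeasure ν] (hX : IsCompact X) {f : (Fin d → ℝ) → ℝ}
    (hf : ContinuousOn f X) {u : Ω → Fin d → ℝ} (hu : Measurable u) (hm : ∀ᵐ ω ∂ν, u ω ∈ X) :
    Integrable (fun ω => f (u ω)) ν := by
  obtain ⟨C, hC⟩ := hX.exists_bound_of_continuousOn hf
  have h1 : Measurable (X.indicator f) := by
    classical
    have := hf.measurable_piecewise (g := 0) continuousOn_const hX.measurableSet
    rwa [Set.piecewise_eq_indicator] at this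
  refine Integrable.of_bound ((h1.comp hu).aestronglyMeasurable.congr ?_) C ?_
  · filter_upwards [hm] with ω hω
    simp [Set.indicator_of_mem hω]
  · filter_upwards [hm] with ω hω using hC _ hω

theorem integral_le_of_ae_le_add {U A B C E : Ω → ℝ} {c₁ c₂ c₃ : ℝ} (hU : Integrable U ν)
    (hA : Integrable A ν) (hB : Integrable B ν) (hC : Integrable C ν) (hE : Integrable E ν)
    (hE0 : ∫ ω, E ω ∂ν = 0) (h : ∀ᵐ ω ∂ν, U ω ≤ c₁ * A ω + c₂ * B ω + C ω - c₃ * E ω) :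
    ∫ ω, U ω ∂ν ≤ c₁ * ∫ ω, A ω ∂ν + c₂ * ∫ ω, B ω ∂ν + ∫ ω, C ω ∂ν := by
  have h1 : Integrable (fun ω => c₁ * A ω + c₂ * B ω) ν := (hA.const_mul _).add (hB.const_mul _)
  have h2 : Integrable (fun ω => c₁ * A ω + c₂ * B ω + C ω) ν := h1.add hC
  refine (integral_mono_ae hU (h2.sub (hE.const_mul _)) h).trans_eq ?_
  refine (integral_sub h2 (hE.const_mul _)).trans ?_
  rw [integral_add h1 hC, integral_add (hA.const_mul _) (hB.const_mul _), integral_const_mul,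
    integral_const_mul, integral_const_mul, hE0, mul_zero, sub_zero]

theorem IsPaganRun.regret [IsProbabilityMeasure ν]
    (h : IsPaganRun ν ℱ X g S T (Metric.diam X) a ε δ I ξ x)
    (hX : IsCompact X) (hc : Convex ℝ X) (hD : 0 < Metric.diam X) (ha : ∀ j, 0 < a j)
    (hε : 0 < ε) (hn : 0 < n) (hT : 0 < T) (hg : IsGradientOracle X F g) {b : Fin n → ℝ}
    (hb : ∀ y ∈ X, ∀ i, ∀ x ∈ X, ∑ j, (g x (S i) j -
      wproj (fun _ => 1) (ellipsoid a) (g x (S i)) j) * (x j - y j) ≤ b i) :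
    Integrable (fun ω => empLoss F S (paganOutput T x ω)) ν ∧
    ∀ y ∈ X, ∫ ω, (empLoss F S (paganOutput T x ω) - empLoss F S y) ∂ν ≤
      3 / 2 * Metric.diam X * adaRegret ν g S T I x +
      3 / 2 * Metric.diam X * (√(Real.log (1 / δ)) / ε) * (∑ j, √(a j)⁻¹) / √T +
      1 / (n : ℝ) * ∑ i, b i +
      (1 / (n : ℝ) * ∑ i, ∑ j, |S i j|) * Metric.diam X / T := by
  have hT' : (0 : ℝ) < T := by exact_mod_cast hT
  have hpath := h.step.mono fun ω hω => fun y (hy : y ∈ X) =>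
    pagan_path_le hX hc hD ha hε hy (hb y hy) (fun k => I k ω)
      (fun k => ξ k ω) (fun k => x k ω) (h.init_mem ω) hω
  have hmem : ∀ᵐ ω ∂ν, ∀ k ≤ T, x k ω ∈ X := by
    filter_upwards [hpath] with ω hω
    exact (hω _ (h.init_mem ω)).1
  have hcont := hg.continuousOn_empLoss S
  have houtsum : ∀ ω, paganOutput T x ω = ∑ k ∈ Finset.range T, (1 / (T : ℝ)) • x (k + 1) ω := by
    intro ω; ext j; simp [paganOutput, Finset.mul_sum]
  have hw : ∑ _k ∈ Finset.range T, 1 / (T : ℝ) = 1 := by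
    rw [Finset.sum_const, Finset.card_range, nsmul_eq_mul]; field_simp
  have hmemS : ∀ ω, (∀ k ≤ T, x k ω ∈ X) → ∀ k ∈ Finset.range T, x (k + 1) ω ∈ X :=
    fun ω hω k hk => hω _ (Finset.mem_range.1 hk)
  have hout : ∀ᵐ ω ∂ν, paganOutput T x ω ∈ X := by
    filter_upwards [hmem] with ω hω
    rw [houtsum]
    exact hc.sum_mem (fun _ _ => by positivity) hw (hmemS ω hω)
  have hmout : Measurable fun ω => paganOutput T x ω := by
    refine measurable_pi_lambda _ fun j => Measurable.const_mul ?_ _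
    exact Finset.measurable_sum _ fun k _ =>
      (measurable_pi_apply j).comp (h.measurable_iterate (k + 1))
  have hIout := integrable_comp_of_continuousOn hX hcont hmout hout
  refine ⟨hIout, fun y hy => ?_⟩
  have hIx : ∀ k ∈ Finset.range T, Integrable (fun ω => empLoss F S (x k ω) - empLoss F S y) ν := by
    intro k hk
    refine (integrable_comp_of_continuousOn hX hcont (h.measurable_iterate k) ?_).sub
      (integrable_const _)
    filter_upwards [hmem] with ω hω using hω k (Finset.mem_range.1 hk).le
  -- the loss of the average, and the shift of the index
  have hjensen : T * ∫ ω, (empLoss F S (paganOutput T x ω) - empLoss F S y) ∂ν ≤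
      ∑ k ∈ Finset.range T, ∫ ω, (empLoss F S (x k ω) - empLoss F S y) ∂ν +
      (1 / (n : ℝ) * ∑ i, ∑ j, |S i j|) * Metric.diam X := by
    rw [← integral_const_mul, ← integral_finsetSum _ hIx]
    have hle : ∀ᵐ ω ∂ν, T * (empLoss F S (paganOutput T x ω) - empLoss F S y) ≤
        ∑ k ∈ Finset.range T, (empLoss F S (x k ω) - empLoss F S y) +
        (1 / (n : ℝ) * ∑ i, ∑ j, |S i j|) * Metric.diam X := by
      filter_upwards [hmem] with ω hω
      have h1 := (hg.convexOn_empLoss hc S).map_sum_le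
        (fun _ _ => by positivity) hw (hmemS ω hω)
      rw [← houtsum] at h1
      simp only [smul_eq_mul] at h1
      rw [← Finset.mul_sum, one_div, ← div_eq_inv_mul, le_div_iff₀ hT'] at h1
      -- The output averages x^1, …, x^T but the regret concerns x^0, …, x^(T-1). Splitting off the
      -- last and the first term shows that the difference is f(x^T) - f(x^0), bounded by the
      -- Lipschitz constant times the diameter.
      have h2 := Finset.sum_range_succ (fun k => empLoss F S (x k ω)) T
      rw [Finset.sum_range_succ'] at h2
      have h3 := hg.empLoss_sub_le_mul S (hω T le_rfl) (hω 0 (Nat.zero_le T))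
        (abs_sub_le_diam hX (hω T le_rfl) (hω 0 (Nat.zero_le T)))
      rw [Finset.sum_sub_distrib, Finset.sum_const, Finset.card_range, nsmul_eq_mul]
      linarith
    refine (integral_mono_ae ((hIout.sub (integrable_const _)).const_mul _)
      ((integrable_finsetSum _ hIx).add (integrable_const _)) hle).trans_eq ?_
    refine (integral_add (integrable_finsetSum _ hIx) (integrable_const _)).trans ?_
    simp
  -- the linearized losses
  have hΦm : ∀ i, Measurable fun v : Fin d → ℝ => ∑ j, g v (S i) j * (v j - y j) := by
    intro i
    have := hg.measurable (S i)
    fun_prop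
  have hΦi : ∀ k ∈ Finset.range T, ∀ i,
      Integrable (fun ω => ∑ j, g (x k ω) (S i) j * (x k ω j - y j)) ν := by
    intro k hk i
    refine Integrable.of_bound ((hΦm i).comp (h.measurable_iterate k)).aestronglyMeasurable
      (∑ j, |S i j| * Metric.diam X) ?_
    filter_upwards [hmem] with ω hω
    have hk' := hω k (Finset.mem_range.1 hk).le
    refine (norm_sum_le _ _).trans (Finset.sum_le_sum fun j _ => ?_)
    rw [norm_mul, Real.norm_eq_abs, Real.norm_eq_abs]
    exact mul_le_mul (hg.bound _ _ hk' j) (abs_sub_le_diam hX hk' hy j) (abs_nonneg _)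
      (abs_nonneg _)
  have hlin := fun k (hk : k ∈ Finset.range T) => h.integral_batch hn k
    (Φ := fun i ω => ∑ j, g (x k ω) (S i) j * (x k ω j - y j))
    (fun i => (hΦm i).comp (h.adapted k)) (hΦi k hk)
  -- Convexity for the full empirical gradient, which is the mean of the unclipped sampled gradient
  -- given the past.
  have hloss : ∀ k ∈ Finset.range T, ∫ ω, (empLoss F S (x k ω) - empLoss F S y) ∂ν ≤
      ∫ ω, ∑ j, g (x k ω) (S (I k ω 0)) j * (x k ω j - y j) ∂ν := by
    intro k hk
    rw [(hlin k hk).2, ← integral_finsetSum _ fun i _ => hΦi k hk i, ← integral_const_mul]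
    refine integral_mono_ae (hIx k hk)
      ((integrable_finsetSum _ fun i _ => hΦi k hk i).const_mul _) ?_
    filter_upwards [hmem] with ω hω
    exact hg.empLoss_sub_le S (hω k (Finset.mem_range.1 hk).le) hy
  -- the terms of the regret bound
  have hGm : ∀ k j, Measurable fun ω => g (x k ω) (S (I k ω 0)) j := by
    intro k j
    have h1 : Measurable fun q : (Fin d → ℝ) × Fin n => g q.1 (S q.2) j :=
      measurable_from_prod_countable_left fun i => (measurable_pi_apply j).comp (hg.measurable (S i))
    exact h1.comp ((h.measurable_iterate k).prodMk
      ((measurable_pi_apply 0).comp (h.measurable_batch k)))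
  have hA : ∀ j, Integrable
      (fun ω => √(∑ k ∈ Finset.range T, g (x k ω) (S (I k ω 0)) j ^ 2)) ν := by
    intro j
    refine Integrable.of_bound (Real.continuous_sqrt.measurable.comp (Finset.measurable_sum _
      fun k _ => (hGm k j).pow_const 2)).aestronglyMeasurable
      (√(∑ _k ∈ Finset.range T, (∑ i, |S i j|) ^ 2)) ?_
    filter_upwards [hmem] with ω hω
    rw [Real.norm_eq_abs, abs_of_nonneg (Real.sqrt_nonneg _)]
    refine Real.sqrt_le_sqrt (Finset.sum_le_sum fun k hk => ?_)
    rw [← sq_abs]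
    refine pow_le_pow_left₀ (abs_nonneg _)
      ((hg.bound _ _ (hω k (Finset.mem_range.1 hk).le) j).trans ?_) 2
    exact Finset.single_le_sum (f := fun i => |S i j|) (fun _ _ => abs_nonneg _)
      (Finset.mem_univ (I k ω 0))
  have hB := fun j => h.integral_sqrt_noise_le hn T j (ha j)
  have hC := fun k => h.integral_batch hn k (Φ := fun i _ => b i)
    (fun i => measurable_const) (fun i => integrable_const _)
  have hE : ∀ k ∈ Finset.range T, ∀ j, Integrable (fun ω => ξ k ω j * (x k ω j - y j)) ν ∧
      ∫ ω, ξ k ω j * (x k ω j - y j) ∂ν = 0 := by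
    intro k hk j
    have hm : Measurable fun v : Fin d → ℝ => v j - y j := by fun_prop
    refine h.integral_noise_mul hn k j (hm.comp (h.adapted k)) ?_
    refine Integrable.of_bound (hm.comp (h.measurable_iterate k)).aestronglyMeasurable
      (Metric.diam X) ?_
    filter_upwards [hmem] with ω hω
    exact abs_sub_le_diam hX (hω k (Finset.mem_range.1 hk).le) hy j
  have hIA := integrable_finsetSum Finset.univ fun j _ => hA j
  have hIB := integrable_finsetSum Finset.univ fun j _ => (hB j).1
  have hIC := integrable_finsetSum (Finset.range T) fun k _ => (hC k).1
  have hIE := integrable_finsetSum (Finset.range T) fun k hk =>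
    integrable_finsetSum Finset.univ fun j _ => (hE k hk j).1
  have hmain : ∑ k ∈ Finset.range T, ∫ ω, ∑ j, g (x k ω) (S (I k ω 0)) j * (x k ω j - y j) ∂ν ≤
      3 / 2 * Metric.diam X *
        ∑ j, ∫ ω, √(∑ k ∈ Finset.range T, g (x k ω) (S (I k ω 0)) j ^ 2) ∂ν +
      3 / 2 * Metric.diam X * (√(Real.log (1 / δ)) / ε) *
        ∑ j, ∫ ω, √(∑ k ∈ Finset.range T, ξ k ω j ^ 2) ∂ν +
      ∑ k ∈ Finset.range T, ∫ ω, b (I k ω 0) ∂ν := by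
    rw [← integral_finsetSum _ fun k hk => (hlin k hk).1, ← integral_finsetSum _ fun j _ => hA j,
      ← integral_finsetSum _ fun j _ => (hB j).1, ← integral_finsetSum _ fun k _ => (hC k).1]
    refine integral_le_of_ae_le_add (integrable_finsetSum _ fun k hk => (hlin k hk).1) hIA hIB hIC
      hIE ?_ (hpath.mono fun ω hω => (hω y hy).2)
    rw [integral_finsetSum _ fun k hk =>
      integrable_finsetSum Finset.univ fun j _ => (hE k hk j).1]
    refine Finset.sum_eq_zero fun k hk => ?_
    rw [integral_finsetSum _ fun j _ => (hE k hk j).1]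
    exact Finset.sum_eq_zero fun j _ => (hE k hk j).2
  have hBsum : ∑ j, ∫ ω, √(∑ k ∈ Finset.range T, ξ k ω j ^ 2) ∂ν ≤ √T * ∑ j, √(a j)⁻¹ := by
    rw [Finset.mul_sum]; exact Finset.sum_le_sum fun j _ => (hB j).2
  have hCsum : ∑ k ∈ Finset.range T, ∫ ω, b (I k ω 0) ∂ν = T * (1 / (n : ℝ) * ∑ i, b i) := by
    have h1 : ∀ k, ∫ ω, b (I k ω 0) ∂ν = 1 / (n : ℝ) * ∑ i, b i := by
      intro k; rw [(hC k).2]; simp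
    simp only [h1]
    simp
  have hAsum : ∑ j, ∫ ω, √(∑ k ∈ Finset.range T, g (x k ω) (S (I k ω 0)) j ^ 2) ∂ν =
      T * adaRegret ν g S T I x := by
    simp only [adaRegret, batchGrad_one]
    field_simp
  rw [hCsum, hAsum] at hmain
  have h1 : 3 / 2 * Metric.diam X * (√(Real.log (1 / δ)) / ε) *
      ∑ j, ∫ ω, √(∑ k ∈ Finset.range T, ξ k ω j ^ 2) ∂ν ≤
      3 / 2 * Metric.diam X * (√(Real.log (1 / δ)) / ε) * (√T * ∑ j, √(a j)⁻¹) := by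
    gcongr
  have h2 := Finset.sum_le_sum hloss
  have h3 : ∀ c₁ c₂ c₃ c₄ : ℝ, c₁ + c₂ * (∑ j, √(a j)⁻¹) / √T + c₃ + c₄ / T =
      (T * c₁ + c₂ * (√T * ∑ j, √(a j)⁻¹) + T * c₃ + c₄) / T := by
    intro c₁ c₂ c₃ c₄
    have h4 : √(T : ℝ) * √T = T := Real.mul_self_sqrt hT'.le
    have h5 : 0 < √(T : ℝ) := Real.sqrt_pos.2 hT'
    rw [eq_div_iff hT'.ne', add_mul, add_mul, add_mul, div_mul_cancel₀ _ hT'.ne',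
      div_mul_eq_mul_div, div_eq_iff h5.ne' |>.2 (_ : _ = (c₂ * (√T * ∑ j, √(a j)⁻¹)) * √T)]
    · ring
    · nth_rewrite 1 [← h4]; ring
  rw [h3, le_div_iff₀ hT']
  linarith

end Regret

/-! ### Lipschitz moments -/

/-- The q-th power of v ≤ e^(v-1) at v = |y|/√q. The scale √q makes E cosh of order e^q for a
normalized sub-Gaussian variable, which cancels e^(-q). -/
theorem rpow_abs_le_cosh {q : ℝ} (hq : 0 < q) (y : ℝ) :
    |y| ^ q ≤ 2 * (q ^ (q / 2) * Real.exp (-q)) * Real.cosh (√q * y) := by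
  have hs : 0 < √q := Real.sqrt_pos.2 hq
  have h1 : |y| / √q ≤ Real.exp (|y| / √q - 1) := by
    have := Real.add_one_le_exp (|y| / √q - 1); linarith
  have h2 : (|y| / √q) ^ q ≤ Real.exp (|y| / √q - 1) ^ q :=
    Real.rpow_le_rpow (by positivity) h1 hq.le
  rw [← Real.exp_mul, Real.div_rpow (abs_nonneg _) hs.le, div_le_iff₀ (by positivity)] at h2
  have h3 : √q ^ q = q ^ (q / 2) := by
    rw [Real.sqrt_eq_rpow, ← Real.rpow_mul hq.le]; ring_nf
  have h4 : (|y| / √q - 1) * q = √q * |y| + -q := by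
    have : q = √q * √q := (Real.mul_self_sqrt hq.le).symm
    have h5 : |y| / √q * q = √q * |y| := by
      rw [div_mul_eq_mul_div, div_eq_iff hs.ne']; linear_combination |y| * this
    linear_combination h5
  rw [h3, h4, Real.exp_add] at h2
  have h5 : Real.exp (√q * |y|) ≤ 2 * Real.cosh (√q * y) := by
    rw [← Real.cosh_abs, abs_mul, abs_of_pos hs, Real.cosh_eq]
    linarith [Real.exp_pos (-(√q * |y|))]
  calc |y| ^ q ≤ Real.exp (√q * |y|) * Real.exp (-q) * q ^ (q / 2) := h2
    _ ≤ 2 * Real.cosh (√q * y) * Real.exp (-q) * q ^ (q / 2) := by gcongr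
    _ = _ := by ring

section

variable {d : ℕ} {P : Measure (Fin d → ℝ)} [IsProbabilityMeasure P] {r p : ℝ}

theorem BoundedMomentRatio.rpow_abs_le (h : BoundedMomentRatio P r) (hr : 2 ≤ r) (hp : 1 ≤ p)
    (j : Fin d) :
    Integrable (fun z : Fin d → ℝ => |z j / (r * sigma P j)| ^ (2 * p)) P ∧
      ∫ z, |z j / (r * sigma P j)| ^ (2 * p) ∂P ≤ (4 * p) ^ p := by
  have hq : 0 < 2 * p := by linarith
  set t := √(2 * p) / (r * sigma P j) with ht
  have hb : ∀ z : Fin d → ℝ, |z j / (r * sigma P j)| ^ (2 * p) ≤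
      2 * ((2 * p) ^ (2 * p / 2) * Real.exp (-(2 * p))) * Real.cosh (t * z j) := by
    intro z
    refine (rpow_abs_le_cosh hq _).trans_eq ?_
    rw [ht]; ring_nf
  have hI := (h.integrable_cosh j t).const_mul (2 * ((2 * p) ^ (2 * p / 2) * Real.exp (-(2 * p))))
  have hm : Measurable fun z : Fin d → ℝ => |z j / (r * sigma P j)| ^ (2 * p) := by fun_prop
  refine ⟨hI.mono' hm.aestronglyMeasurable (Filter.Eventually.of_forall fun z => ?_), ?_⟩
  · rw [Real.norm_eq_abs, abs_of_nonneg (by positivity)]; exact hb z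
  refine (integral_mono_of_nonneg (Filter.Eventually.of_forall fun z => by positivity) hI
    (Filter.Eventually.of_forall hb)).trans ?_
  rw [integral_const_mul]
  have h1 : (1 + r ^ 2) * sigma P j ^ 2 * t ^ 2 / 2 ≤ 2 * p := by
    rw [ht, div_pow, Real.sq_sqrt hq.le]
    rcases (sigma_nonneg P j).eq_or_lt with h0 | h0
    · rw [← h0]; simp; linarith
    · have : (1 + r ^ 2) * sigma P j ^ 2 * (2 * p / (r * sigma P j) ^ 2) / 2 =
          (1 + r ^ 2) / r ^ 2 * p := by field_simp
      rw [this]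
      have : (1 + r ^ 2) / r ^ 2 ≤ 2 := by rw [div_le_iff₀ (by positivity)]; nlinarith
      nlinarith
  have h2 : ∫ z, Real.cosh (t * z j) ∂P ≤ Real.exp (2 * p) :=
    (h.integral_cosh_le j t).trans (Real.exp_le_exp.2 h1)
  calc _ ≤ 2 * ((2 * p) ^ (2 * p / 2) * Real.exp (-(2 * p))) * Real.exp (2 * p) := by gcongr
    _ = 2 * (2 * p) ^ p := by
        rw [Real.exp_neg]; field_simp
    -- Since p ≥ 1, the prefactor 2 is at most 2^p; the bound then survives taking 2p-th roots with
    -- an absolute constant.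
    _ ≤ 2 ^ p * (2 * p) ^ p := by
        gcongr
        exact Real.self_le_rpow_of_one_le one_le_two hp
    _ = (4 * p) ^ p := by
        rw [← Real.mul_rpow (by norm_num) hq.le]; ring_nf

theorem wnorm_rpow_two_mul {C : Fin d → ℝ} (hC : ∀ j, 0 ≤ C j) (z : Fin d → ℝ) :
    wnorm C z ^ (2 * p) = (∑ j, C j * z j ^ 2) ^ p := by
  rw [Real.rpow_mul (wnorm_nonneg _ _), ← sq_wnorm hC]
  norm_num

/-- Up to the factor r²W, ‖z‖_C² is a convex combination, with weights C_j σ_j²/W, of squared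
normalized coordinates. Jensen's inequality reduces to one coordinate, with no dimension factor and
no independence of coordinates. -/
theorem BoundedMomentRatio.wnorm_rpow_le (h : BoundedMomentRatio P r) (hr : 2 ≤ r) (hp : 1 ≤ p)
    {C : Fin d → ℝ} (hC : ∀ j, 0 ≤ C j) (hW : 0 < ∑ j, C j * sigma P j ^ 2) :
    Integrable (fun z => wnorm C z ^ (2 * p)) P ∧
      ∫ z, wnorm C z ^ (2 * p) ∂P ≤ (4 * p * r ^ 2 * ∑ j, C j * sigma P j ^ 2) ^ p := by
  have hr0 : 0 < r := by linarith
  set W := ∑ j, C j * sigma P j ^ 2 with hWd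
  have hb : ∀ᵐ z ∂P, wnorm C z ^ (2 * p) ≤ (r ^ 2 * W) ^ p * ∑ j, C j * sigma P j ^ 2 / W *
      |z j / (r * sigma P j)| ^ (2 * p) := by
    have h0 : ∀ᵐ z ∂P, ∀ j, sigma P j = 0 → z j = 0 := by
      rw [ae_all_iff]
      intro j
      by_cases hj : sigma P j = 0
      · filter_upwards [h.ae_eq_zero hj] with z hz using fun _ => hz
      · exact Filter.Eventually.of_forall fun z hz => absurd hz hj
    filter_upwards [h0] with z hz
    rw [wnorm_rpow_two_mul hC]
    have h1 : ∑ j, C j * z j ^ 2 = r ^ 2 * W * ∑ j, C j * sigma P j ^ 2 / W *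
        (z j / (r * sigma P j)) ^ 2 := by
      rw [Finset.mul_sum]
      refine Finset.sum_congr rfl fun j _ => ?_
      by_cases hj : sigma P j = 0
      · rw [hz j hj, hj]; simp
      · field_simp
    rw [h1, Real.mul_rpow (by positivity) (Finset.sum_nonneg fun j _ => mul_nonneg
      (div_nonneg (mul_nonneg (hC j) (sq_nonneg _)) hW.le) (sq_nonneg _))]
    gcongr
    refine (Real.rpow_arith_mean_le_arith_mean_rpow _ _ _ (fun j _ => div_nonneg
      (mul_nonneg (hC j) (sq_nonneg _)) hW.le) ?_ (fun j _ => sq_nonneg _) hp).trans_eq ?_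
    · rw [← Finset.sum_div]; exact div_self hW.ne'
    · refine Finset.sum_congr rfl fun j _ => ?_
      congr 1
      rw [← sq_abs, Real.rpow_mul (abs_nonneg _)]
      norm_num
  have hI : Integrable (fun z : Fin d → ℝ => (r ^ 2 * W) ^ p * ∑ j, C j * sigma P j ^ 2 / W *
      |z j / (r * sigma P j)| ^ (2 * p)) P :=
    (integrable_finsetSum _ fun j _ => (h.rpow_abs_le hr hp j).1.const_mul _).const_mul _
  have hm : Measurable fun z : Fin d → ℝ => wnorm C z ^ (2 * p) :=
    (continuous_wnorm C).measurable.pow_const _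
  have hnn : ∀ z : Fin d → ℝ, 0 ≤ wnorm C z ^ (2 * p) := fun z =>
    Real.rpow_nonneg (wnorm_nonneg _ _) _
  refine ⟨hI.mono' hm.aestronglyMeasurable ?_, ?_⟩
  · filter_upwards [hb] with z hz
    rw [Real.norm_eq_abs, abs_of_nonneg (hnn z)]; exact hz
  refine (integral_mono_of_nonneg (Filter.Eventually.of_forall hnn) hI hb).trans ?_
  rw [integral_const_mul, integral_finsetSum _ fun j _ => (h.rpow_abs_le hr hp j).1.const_mul _]
  have h1 : ∑ j, ∫ z, C j * sigma P j ^ 2 / W * |z j / (r * sigma P j)| ^ (2 * p) ∂P ≤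
      (4 * p) ^ p := by
    calc _ ≤ ∑ j, C j * sigma P j ^ 2 / W * (4 * p) ^ p := by
          refine Finset.sum_le_sum fun j _ => ?_
          rw [integral_const_mul]
          exact mul_le_mul_of_nonneg_left (h.rpow_abs_le hr hp j).2
            (div_nonneg (mul_nonneg (hC j) (sq_nonneg _)) hW.le)
      _ = _ := by rw [← Finset.sum_mul, ← Finset.sum_div, div_self hW.ne', one_mul]
  calc _ ≤ (r ^ 2 * W) ^ p * (4 * p) ^ p := by gcongr
    _ = _ := by rw [← Real.mul_rpow (by positivity) (by positivity)]; ring_nf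

theorem BoundedMomentRatio.lipMoment_le (h : BoundedMomentRatio P r) (hr : 2 ≤ r) (hp : 1 ≤ p)
    {C : Fin d → ℝ} (hC : ∀ j, 0 ≤ C j) (hW : 0 < ∑ j, C j * sigma P j ^ 2) :
    lipMoment P (2 * p) C ≤ 2 * r * √p * √(∑ j, C j * sigma P j ^ 2) := by
  have hr0 : 0 < r := by linarith
  have hp0 : 0 < p := by linarith
  have hV := integral_nonneg (μ := P) (f := fun z => wnorm C z ^ (2 * p)) fun z =>
    Real.rpow_nonneg (wnorm_nonneg C z) _
  refine (Real.rpow_le_rpow hV (h.wnorm_rpow_le hr hp hC hW).2 (by positivity)).trans_eq ?_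
  rw [← Real.rpow_mul (by positivity), show p * (1 / (2 * p)) = 1 / 2 by field_simp,
    ← Real.sqrt_eq_rpow, Real.sqrt_mul (by positivity), Real.sqrt_mul (by positivity),
    Real.sqrt_mul (by norm_num), Real.sqrt_sq hr0.le, show (4 : ℝ) = 2 ^ 2 by norm_num,
    Real.sqrt_sq (by norm_num)]
  ring

theorem BoundedMomentRatio.integral_wnorm_rpow_pos (h : BoundedMomentRatio P r) (hr : 2 ≤ r)
    (hp : 1 ≤ p) {C : Fin d → ℝ} (hC : ∀ j, 0 ≤ C j) (hW : 0 < ∑ j, C j * sigma P j ^ 2) :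
    0 < ∫ z, wnorm C z ^ (2 * p) ∂P := by
  have hnn : ∀ z : Fin d → ℝ, 0 ≤ wnorm C z ^ (2 * p) := fun z =>
    Real.rpow_nonneg (wnorm_nonneg _ _) _
  refine (integral_nonneg hnn).lt_of_ne fun h0 => hW.ne ?_
  have h1 := (integral_eq_zero_iff_of_nonneg hnn (h.wnorm_rpow_le hr hp hC hW).1).1 h0.symm
  have h2 : ∀ᵐ z ∂P, ∑ j, C j * z j ^ 2 = 0 := by
    filter_upwards [h1] with z hz
    rw [← sq_wnorm hC, (Real.rpow_eq_zero (wnorm_nonneg _ _) (by linarith)).1 hz]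
    norm_num
  calc (0 : ℝ) = ∫ z, ∑ j, C j * z j ^ 2 ∂P := by rw [integral_congr_ae h2]; simp
    _ = _ := by
      rw [integral_finsetSum _ fun j _ => (h.integrable_sq j).const_mul _]
      simp only [integral_const_mul, sq_sigma]

/-- Chebyshev's inequality for the empirical Lipschitz moment in a fixed geometry. -/
theorem BoundedMomentRatio.measure_empLipMoment_gt_le (h : BoundedMomentRatio P r) (hr : 2 ≤ r)
    (hp : 1 ≤ p) {C : Fin d → ℝ} (hC : ∀ j, 0 ≤ C j) (hW : 0 < ∑ j, C j * sigma P j ^ 2) {n : ℕ}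
    (hn : 0 < n) :
    (Measure.pi fun _ : Fin n => P) {z | 2 * lipMoment P (2 * p) C < empLipMoment z p C} ≤
      1 / (n : ENNReal) := by
  have hp0 : 0 < p := by linarith
  have hn' : (0 : ℝ) < n := by exact_mod_cast hn
  have hVpos := h.integral_wnorm_rpow_pos hr hp hC hW
  set V := ∫ z, wnorm C z ^ (2 * p) ∂P with hV
  have hm : Measurable fun z : Fin d → ℝ => wnorm C z ^ p :=
    (continuous_wnorm C).measurable.pow_const _
  have hsq : ∀ z : Fin d → ℝ, (wnorm C z ^ p) ^ 2 = wnorm C z ^ (2 * p) := fun z => by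
    rw [← Real.rpow_natCast, ← Real.rpow_mul (wnorm_nonneg _ _)]; ring_nf
  have hL : MemLp (fun z : Fin d → ℝ => wnorm C z ^ p) 2 P := by
    rw [memLp_two_iff_integrable_sq hm.aestronglyMeasurable]
    simp only [hsq]
    exact (h.wnorm_rpow_le hr hp hC hW).1
  have hvar : Var[fun z : Fin d → ℝ => wnorm C z ^ p; P] ≤ V := by
    refine (variance_le_expectation_sq hm.aestronglyMeasurable).trans_eq ?_
    simp only [Pi.pow_apply, hsq, hV]
  have hmean : ∫ z, wnorm C z ^ p ∂P ≤ √V := by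
    refine Real.le_sqrt_of_sq_le ?_
    have h1 := variance_eq_sub hL
    have h2 := variance_nonneg (fun z : Fin d → ℝ => wnorm C z ^ p) P
    rw [h1] at h2
    simp only [Pi.pow_apply, hsq] at h2
    linarith
  set Z : (Fin n → Fin d → ℝ) → ℝ := ∑ i, fun z => wnorm C (z i) ^ p with hZ
  have hLi : ∀ i : Fin n, MemLp (fun z : Fin n → Fin d → ℝ => wnorm C (z i) ^ p) 2
      (Measure.pi fun _ : Fin n => P) := fun i =>
    hL.comp_measurePreserving (measurePreserving_eval (fun _ : Fin n => P) i)
  have hZL : MemLp Z 2 (Measure.pi fun _ : Fin n => P) := by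
    rw [hZ]; exact memLp_finsetSum' _ fun i _ => hLi i
  have hZvar : Var[Z; Measure.pi fun _ : Fin n => P] ≤ n * V := by
    rw [hZ, variance_sum_pi (X := fun _ z => wnorm C z ^ p) fun _ => hL]
    simpa using mul_le_mul_of_nonneg_left hvar hn'.le
  have hZmean : ∫ z, Z z ∂(Measure.pi fun _ : Fin n => P) = n * ∫ z, wnorm C z ^ p ∂P := by
    simp only [hZ, Finset.sum_apply]
    rw [integral_finsetSum _ fun i _ => (hLi i).integrable (by norm_num)]
    have : ∀ i : Fin n, ∫ z, wnorm C (z i) ^ p ∂(Measure.pi fun _ : Fin n => P) =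
        ∫ z, wnorm C z ^ p ∂P := fun i => by
      have h1 := (measurePreserving_eval (fun _ : Fin n => P) i)
      conv_rhs => rw [← h1.map_eq]
      rw [integral_map h1.measurable.aemeasurable hm.aestronglyMeasurable]
    simp [this]
  have hcheb := meas_ge_le_variance_div_sq hZL (c := n * √V) (by positivity)
  refine (measure_mono fun z hz => ?_).trans (hcheb.trans ?_)
  · rw [Set.mem_ofPred_eq] at hz ⊢
    rw [hZmean]
    refine le_trans ?_ (le_abs_self _)
    have hG0 : 0 ≤ lipMoment P (2 * p) C := Real.rpow_nonneg hVpos.le _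
    have h1 : (2 * lipMoment P (2 * p) C) ^ p < empLipMoment z p C ^ p :=
      Real.rpow_lt_rpow (by positivity) hz hp0
    have h2 : empLipMoment z p C ^ p = 1 / (n : ℝ) * Z z := by
      rw [empLipMoment, ← Real.rpow_mul (mul_nonneg (by positivity)
        (Finset.sum_nonneg fun i _ => Real.rpow_nonneg (wnorm_nonneg _ _) _)),
        one_div_mul_cancel hp0.ne', Real.rpow_one]
      simp [hZ]
    have h3 : lipMoment P (2 * p) C ^ p = √V := by
      rw [lipMoment, ← hV, ← Real.rpow_mul hVpos.le, Real.sqrt_eq_rpow]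
      congr 1; field_simp
    rw [Real.mul_rpow (by norm_num) hG0, h3, h2] at h1
    -- The p-th power of the event forces the sum above 2n√V, twice the bound n√V on its mean. A
    -- deviation n√V against variance at most nV has probability at most 1/n; this is where the
    -- moment 2p is needed.
    have h4 : 2 * √V ≤ 2 ^ p * √V := by
      gcongr
      exact Real.self_le_rpow_of_one_le one_le_two hp
    have h5 : 2 * √V < 1 / (n : ℝ) * Z z := h4.trans_lt h1
    rw [one_div, ← div_eq_inv_mul, lt_div_iff₀ hn'] at h5
    nlinarith
  · rw [mul_pow, Real.sq_sqrt hVpos.le, ← ENNReal.ofReal_natCast, ← ENNReal.ofReal_one,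
      ← ENNReal.ofReal_div_of_pos hn']
    refine ENNReal.ofReal_le_ofReal ?_
    rw [div_le_div_iff₀ (by positivity) hn']
    nlinarith [mul_le_mul_of_nonneg_left hZvar hn'.le]

end

/-! ### The rate in a fixed geometry -/

theorem wnorm_le_sum {d : ℕ} {w : Fin d → ℝ} (hw : ∀ j, 0 ≤ w j) (x : Fin d → ℝ) :
    wnorm w x ≤ ∑ j, √(w j) * |x j| := by
  refine Real.sqrt_le_iff.2 ⟨Finset.sum_nonneg fun j _ => by positivity, ?_⟩
  refine le_trans (le_of_eq (Finset.sum_congr rfl fun j _ => ?_))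
    (Finset.sum_sq_le_sq_sum_of_nonneg fun j _ => (by positivity : 0 ≤ √(w j) * |x j|))
  rw [mul_pow, Real.sq_sqrt (hw j), sq_abs]

theorem sqrt_mul_abs_le_wnorm {d : ℕ} {w : Fin d → ℝ} (hw : ∀ j, 0 ≤ w j) (x : Fin d → ℝ)
    (j : Fin d) : √(w j) * |x j| ≤ wnorm w x := by
  refine Real.le_sqrt_of_sq_le ?_
  rw [mul_pow, Real.sq_sqrt (hw j), sq_abs]
  exact Finset.single_le_sum (f := fun j => w j * x j ^ 2)
    (fun j _ => mul_nonneg (hw j) (sq_nonneg _)) (Finset.mem_univ j)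

theorem sum_mul_le_wnorm_mul_wnorm {d : ℕ} {w : Fin d → ℝ} (hw : ∀ j, 0 < w j)
    (x y : Fin d → ℝ) : ∑ j, x j * y j ≤ wnorm w x * wnorm (fun j => (w j)⁻¹) y := by
  have h1 := Real.sum_mul_le_sqrt_mul_sqrt Finset.univ (fun j => √(w j) * x j)
    (fun j => √(w j)⁻¹ * y j)
  have h2 : ∀ j, √(w j) * x j * (√(w j)⁻¹ * y j) = x j * y j := by
    intro j
    have : √(w j) * √(w j)⁻¹ = 1 := by
      rw [← Real.sqrt_mul (hw j).le, mul_inv_cancel₀ (hw j).ne', Real.sqrt_one]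
    linear_combination x j * y j * this
  have h3 : ∀ j, √(w j)⁻¹ ^ 2 = (w j)⁻¹ := fun j => Real.sq_sqrt (inv_nonneg.2 (hw j).le)
  simp only [h2, mul_pow, Real.sq_sqrt (hw _).le, h3] at h1
  exact h1

theorem sqrt_inv_eq_rpow {x : ℝ} (hx : 0 < x) : √x⁻¹ = x ^ (-(1 / 2 : ℝ)) := by
  rw [Real.sqrt_eq_rpow, Real.inv_rpow hx.le, Real.rpow_neg hx.le]

/-! ### Diameters in the dual norm -/

section Diameter

variable {d : ℕ} {X : Set (Fin d → ℝ)} {C : Fin d → ℝ}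

theorem wnorm_sub_le (hX : IsCompact X) (hC : ∀ j, 0 < C j) {x y : Fin d → ℝ} (hx : x ∈ X)
    (hy : y ∈ X) :
    wnorm (fun j => (C j)⁻¹) (x - y) ≤ Metric.diam X * ∑ j, C j ^ (-(1 / 2 : ℝ)) := by
  refine (wnorm_le_sum (fun j => inv_nonneg.2 (hC j).le) _).trans ?_
  rw [Finset.mul_sum]
  refine Finset.sum_le_sum fun j _ => ?_
  rw [sqrt_inv_eq_rpow (hC j), mul_comm]
  exact mul_le_mul_of_nonneg_right (abs_sub_le_diam hX hx hy j) (Real.rpow_nonneg (hC j).le _)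

theorem wnorm_sub_le_wdiam (hX : IsCompact X) (hC : ∀ j, 0 < C j) {x y : Fin d → ℝ} (hx : x ∈ X)
    (hy : y ∈ X) : wnorm (fun j => (C j)⁻¹) (x - y) ≤ wdiam (fun j => (C j)⁻¹) X := by
  refine le_csSup ⟨Metric.diam X * ∑ j, C j ^ (-(1 / 2 : ℝ)), ?_⟩ ⟨x, hx, y, hy, rfl⟩
  rintro _ ⟨x, hx, y, hy, rfl⟩
  exact wnorm_sub_le hX hC hx hy

theorem wdiam_le (hX : IsCompact X) (hne : X.Nonempty) (hC : ∀ j, 0 < C j) :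
    wdiam (fun j => (C j)⁻¹) X ≤ Metric.diam X * ∑ j, C j ^ (-(1 / 2 : ℝ)) := by
  obtain ⟨x, hx⟩ := hne
  refine csSup_le ⟨_, x, hx, x, hx, rfl⟩ ?_
  rintro _ ⟨x, hx, y, hy, rfl⟩
  exact wnorm_sub_le hX hC hx hy

theorem wdiam_pos (hX : IsCompact X) (hne : X.Nontrivial) (hC : ∀ j, 0 < C j) :
    0 < wdiam (fun j => (C j)⁻¹) X := by
  obtain ⟨x, hx, y, hy, hxy⟩ := hne
  obtain ⟨j, hj⟩ := Function.ne_iff.1 hxy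
  refine lt_of_lt_of_le ?_ (wnorm_sub_le_wdiam hX hC hx hy)
  refine lt_of_lt_of_le ?_ (sqrt_mul_abs_le_wnorm (fun j => inv_nonneg.2 (hC j).le) _ j)
  have : 0 < |(x - y) j| := abs_pos.2 (sub_ne_zero.2 hj)
  have := hC j
  positivity

theorem diam_pos (hX : IsCompact X) (hne : X.Nontrivial) : 0 < Metric.diam X := by
  obtain ⟨x, hx, y, hy, hxy⟩ := hne
  exact (dist_pos.2 hxy).trans_le (Metric.dist_le_diam_of_mem hX.isBounded hx hy)

end Diameter

/-! ### Empirical moments, clipping bias and the radius -/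

theorem empLipMoment_rpow {d n : ℕ} (S : Fin n → Fin d → ℝ) {p : ℝ} (hp : 0 < p)
    (C : Fin d → ℝ) : empLipMoment S p C ^ p = 1 / (n : ℝ) * ∑ i, wnorm C (S i) ^ p := by
  rw [empLipMoment, ← Real.rpow_mul (mul_nonneg (by positivity)
    (Finset.sum_nonneg fun i _ => Real.rpow_nonneg (wnorm_nonneg _ _) _)),
    one_div_mul_cancel hp.ne', Real.rpow_one]

theorem mean_wnorm_le_empLipMoment {d n : ℕ} (hn : 0 < n) (S : Fin n → Fin d → ℝ) {p : ℝ}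
    (hp : 1 ≤ p) (C : Fin d → ℝ) :
    1 / (n : ℝ) * ∑ i, wnorm C (S i) ≤ empLipMoment S p C := by
  have hn' : (0 : ℝ) < n := by exact_mod_cast hn
  have h1 := Real.rpow_arith_mean_le_arith_mean_rpow Finset.univ (fun _ : Fin n => 1 / (n : ℝ))
    (fun i => wnorm C (S i)) (fun _ _ => by positivity) (by simp; field_simp)
    (fun _ _ => wnorm_nonneg _ _) hp
  rw [← Finset.mul_sum, ← Finset.mul_sum, ← empLipMoment_rpow S (by linarith)] at h1
  refine (Real.rpow_le_rpow_iff (mul_nonneg (by positivity)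
    (Finset.sum_nonneg fun _ _ => wnorm_nonneg _ _)) (Real.rpow_nonneg (mul_nonneg (by positivity)
    (Finset.sum_nonneg fun i _ => Real.rpow_nonneg (wnorm_nonneg _ _) _)) _)
    (by linarith : 0 < p)).1 h1

/-- The left side bounds the sup-norm Lipschitz constant of the empirical loss, which enters through
the index shift. -/
theorem mean_l1_le {d n : ℕ} (hn : 0 < n) (S : Fin n → Fin d → ℝ) {p : ℝ} (hp : 1 ≤ p)
    {C : Fin d → ℝ} (hC : ∀ j, 0 < C j) :
    1 / (n : ℝ) * ∑ i, ∑ j, |S i j| ≤ empLipMoment S p C * ∑ j, C j ^ (-(1 / 2 : ℝ)) := by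
  refine le_trans ?_ (mul_le_mul_of_nonneg_right (mean_wnorm_le_empLipMoment hn S hp C)
    (Finset.sum_nonneg fun j _ => Real.rpow_nonneg (hC j).le _))
  rw [mul_assoc, Finset.sum_mul]
  refine mul_le_mul_of_nonneg_left (Finset.sum_le_sum fun i _ => ?_) (by positivity)
  rw [Finset.mul_sum]
  refine Finset.sum_le_sum fun j _ => ?_
  have h1 := sqrt_mul_abs_le_wnorm (fun j => (hC j).le) (S i) j
  have h2 : √(C j) * √(C j)⁻¹ = 1 := by
    rw [← Real.sqrt_mul (hC j).le, mul_inv_cancel₀ (hC j).ne', Real.sqrt_one]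
  rw [← sqrt_inv_eq_rpow (hC j)]
  calc |S i j| = √(C j) * |S i j| * √(C j)⁻¹ := by linear_combination -|S i j| * h2
    _ ≤ _ := by gcongr

/-- The bias of clipping. -/
theorem clipping_bias_le {d : ℕ} {X : Set (Fin d → ℝ)} {C : Fin d → ℝ} (hX : IsCompact X)
    (hC : ∀ j, 0 < C j) {B p : ℝ} (hB : 0 < B) (hp : 1 ≤ p) {v z x y : Fin d → ℝ}
    (hv : ∀ j, |v j| ≤ |z j|) (hx : x ∈ X) (hy : y ∈ X) :
    ∑ j, (v j - wproj (fun _ => 1) (ellipsoid fun j => C j / B ^ 2) v j) * (x j - y j) ≤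
      wdiam (fun j => (C j)⁻¹) X * (B * (wnorm C z / B) ^ p) := by
  have ha : ∀ j, 0 < C j / B ^ 2 := fun j => div_pos (hC j) (by positivity)
  have hΔ : 0 ≤ wdiam (fun j => (C j)⁻¹) X :=
    (wnorm_nonneg _ _).trans (wnorm_sub_le_wdiam hX hC hx hy)
  have hz := wnorm_nonneg C z
  -- Inside the ellipsoid nothing is clipped. Outside, ‖z‖_C/B ≥ 1, so its first power is at most
  -- its p-th power.
  by_cases hvB : wnorm C v ≤ B
  · have hmem : v ∈ ellipsoid fun j => C j / B ^ 2 := by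
      have h1 : wnorm (fun j => C j / B ^ 2) v = wnorm C v / B := by
        rw [wnorm, wnorm, ← Real.sqrt_sq hB.le, ← Real.sqrt_div' _ (sq_nonneg _),
          Finset.sum_div, Real.sqrt_sq hB.le]
        simp only [div_mul_eq_mul_div]
      exact h1.trans_le ((div_le_one hB).2 hvB)
    rw [wproj_eq_self (isCompact_ellipsoid ha) hmem]
    simp only [sub_self, zero_mul, Finset.sum_const_zero]
    positivity
  · push Not at hvB
    have h1 : wnorm C v ≤ wnorm C z := wnorm_mono (fun j => (hC j).le) hv
    set q := wproj (fun _ => 1) (ellipsoid fun j => C j / B ^ 2) v with hq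
    have h2 : wnorm C (v - q) ≤ wnorm C z := (wnorm_mono (fun j => (hC j).le) fun j =>
      (abs_le_abs_of_mul_sub_nonpos (wproj_ellipsoid_mul_le ha v j)).2).trans h1
    have h3 : wnorm C z ≤ B * (wnorm C z / B) ^ p := by
      have h4 : 1 ≤ wnorm C z / B := (one_le_div hB).2 (hvB.le.trans h1)
      have h5 := Real.self_le_rpow_of_one_le h4 hp
      calc wnorm C z = B * (wnorm C z / B) := by field_simp
        _ ≤ _ := by gcongr
    calc _ ≤ wnorm C (v - q) * wnorm (fun j => (C j)⁻¹) (x - y) :=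
          sum_mul_le_wnorm_mul_wnorm hC (v - q) (x - y)
      _ ≤ (B * (wnorm C z / B) ^ p) * wdiam (fun j => (C j)⁻¹) X :=
          mul_le_mul (h2.trans h3) (wnorm_sub_le_wdiam hX hC hx hy) (wnorm_nonneg _ _)
            (by positivity)
      _ = _ := mul_comm _ _

/-- The choice of the clipping radius balances bias and noise. -/
theorem radius_balance {D l t Δ N p G : ℝ} (hD : 0 < D) (hl : 0 < l) (ht : 0 < t) (hΔ : 0 < Δ)
    (hN : 0 < N) (hp : 1 ≤ p) (hG : 0 < G) (hΔD : Δ ≤ D * t) {M : ℝ} (hlM : l ≤ M)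
    (hM : 1 ≤ 2 * M) :
    let B := G * (Δ * N / (D * l * t)) ^ (1 / p)
    0 < B ∧ Δ * (B * (G / B) ^ p) = D * t * (l * B) / N ∧ l * B ≤ G * N ^ (1 / p) * (2 * M) := by
  intro B
  have hp0 : 0 < p := by linarith
  have hQ : 0 < Δ * N / (D * l * t) := by positivity
  have hB : 0 < B := mul_pos hG (Real.rpow_pos_of_pos hQ _)
  refine ⟨hB, ?_, ?_⟩
  · have h1 : (G / B) ^ p = (Δ * N / (D * l * t))⁻¹ := by
      have h2 : G / B = ((Δ * N / (D * l * t)) ^ (1 / p))⁻¹ := by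
        simp only [B]; field_simp
      rw [h2, Real.inv_rpow (by positivity), ← Real.rpow_mul hQ.le, one_div_mul_cancel hp0.ne',
        Real.rpow_one]
    rw [h1]
    field_simp
  · have h1 : Δ * N / (D * l * t) ≤ N / l := by
      rw [div_le_div_iff₀ (by positivity) hl]
      have := mul_le_mul_of_nonneg_right hΔD (by positivity : 0 ≤ N * l)
      linarith
    have h2 : (Δ * N / (D * l * t)) ^ (1 / p) ≤ N ^ (1 / p) / l ^ (1 / p) := by
      rw [← Real.div_rpow hN.le hl.le]
      exact Real.rpow_le_rpow hQ.le h1 (by positivity)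
    have h3 : l / l ^ (1 / p) ≤ 2 * M := by
      have h4 : l / l ^ (1 / p) = l ^ (1 - 1 / p) := by
        rw [Real.rpow_sub hl, Real.rpow_one]
      have h5 : 1 / p ≤ 1 := by rw [div_le_one hp0]; exact hp
      have h6 : 0 < 1 / p := by positivity
      rw [h4]
      -- What remains of √log(1/δ) is its power 1 - 1/p, at most max(1, l). Both are at most
      -- 2√log(d/δ), including for δ close to 1.
      rcases le_total l 1 with h | h
      · exact (Real.rpow_le_one hl.le h (by linarith)).trans hM
      · refine (Real.rpow_le_rpow_of_exponent_le h (by linarith : 1 - 1 / p ≤ 1)).trans ?_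
        rw [Real.rpow_one]; linarith
    calc l * B ≤ l * (G * (N ^ (1 / p) / l ^ (1 / p))) := by
          simp only [B]; gcongr
      _ = G * N ^ (1 / p) * (l / l ^ (1 / p)) := by ring
      _ ≤ _ := by gcongr

/-- The factor in the rate of PAGAN. -/
noncomputable def rateFactor (κ c : ℝ) : ℝ := 3 / 2 + 64 * κ * (3 / (2 * √c) + 1 + 1 / c)

theorem adaRegret_nonneg {d n b : ℕ} {Ω : Type} [MeasurableSpace Ω] (ν : Measure Ω)
    (g : (Fin d → ℝ) → (Fin d → ℝ) → (Fin d → ℝ)) (S : Fin n → Fin d → ℝ) (T : ℕ)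
    (I : ℕ → Ω → Fin b → Fin n) (x : ℕ → Ω → Fin d → ℝ) : 0 ≤ adaRegret ν g S T I x :=
  mul_nonneg (by positivity) (Finset.sum_nonneg fun _ _ => integral_nonneg fun _ => Real.sqrt_nonneg _)

theorem half_le_sqrt_log_div {d δ : ℝ} (hd : 2 ≤ d) (hδ : 0 < δ) (hδ1 : δ < 1) :
    1 ≤ 2 * √(Real.log (d / δ)) := by
  have h1 : Real.log 2 ≤ Real.log (d / δ) := by
    refine Real.log_le_log two_pos ?_
    rw [le_div_iff₀ hδ]; nlinarith
  have h2 : (1 / 2 : ℝ) ≤ √(Real.log (d / δ)) :=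
    Real.le_sqrt_of_sq_le (by linarith [Real.log_two_gt_d9])
  linarith

/-- All error terms are multiples of one quantity E: noise at most 3/(2√c) E by √T ≥ √c n, bias at
most E, and the index shift at most E/c by T ≥ cn² ≥ cN. The factor 64 κ is 32 from `hGt` times the
2κ in E. -/
theorem rate_sum_le {κ c D R t l B G H W N M P₁ n T s ε u : ℝ} (hκ : 0 < κ) (hc : 0 < c) (hD : 0 < D)
    (hR : 0 ≤ R) (ht : 0 < t) (hN : 1 ≤ N) (hP : 1 ≤ P₁) (hM : 1 ≤ 2 * M) (hn : 0 < n)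
    (hε : 0 < ε) (hNn : N = n * ε) (hε1 : ε ≤ 1) (hT : c * n ^ 2 ≤ T)
    (hlB0 : 0 ≤ l * B) (hlB : l * B ≤ κ * G * P₁ * (2 * M))
    (hH0 : 0 ≤ H) (hH : H ≤ κ * G) (hG : 0 < G) (hGt : G * t ≤ 32 * W * s)
    (hu : u ≤ D * t * (l * B) / N) :
    3 / 2 * D * R + 3 / 2 * D * (l / ε) * (B * t) / √T + u + H * t * D / T ≤
      rateFactor κ c * D * (R + W / N * (s * M) * P₁) := by
  have hN0 : 0 < N := by linarith
  have hM0 : 0 < M := by linarith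
  have hs : 0 < √c := Real.sqrt_pos.2 hc
  have hsT : √c * n ≤ √T := by
    rw [← Real.sqrt_sq hn.le, ← Real.sqrt_mul hc.le]; exact Real.sqrt_le_sqrt hT
  set E := D * t * (κ * G * P₁ * (2 * M)) / N with hE
  have hE0 : 0 < E := by positivity
  have h1 : D * t * (l * B) / N ≤ E := by rw [hE]; gcongr
  have h2 : 3 / 2 * D * (l / ε) * (B * t) / √T ≤ 3 / (2 * √c) * E := by
    calc 3 / 2 * D * (l / ε) * (B * t) / √T = 3 / 2 * D * t * (l * B) / ε / √T := by ring
      _ ≤ 3 / 2 * D * t * (l * B) / ε / (√c * n) := by gcongr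
      _ = 3 / (2 * √c) * (D * t * (l * B) / N) := by rw [hNn]; field_simp
      _ ≤ _ := by gcongr
  have hn1 : N ≤ n ^ 2 := by
    have : N ≤ n := by rw [hNn]; nlinarith
    nlinarith
  have h3 : H * t * D / T ≤ 1 / c * E := by
    have h4 : c * N ≤ T := (mul_le_mul_of_nonneg_left hn1 hc.le).trans hT
    calc H * t * D / T ≤ H * t * D / (c * N) := by gcongr
      _ = 1 / c * (D * t * (H * 1 * 1) / N) := by field_simp
      _ ≤ 1 / c * E := by rw [hE]; gcongr
  have h5 : E ≤ 64 * κ * (D * (W / N * (s * M) * P₁)) := by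
    calc E = (G * t) * (D * κ * P₁ * (2 * M) / N) := by rw [hE]; ring
      _ ≤ (32 * W * s) * (D * κ * P₁ * (2 * M) / N) := by gcongr
      _ = _ := by ring
  have hV : 0 ≤ D * (W / N * (s * M) * P₁) :=
    nonneg_of_mul_nonneg_right (hE0.le.trans h5) (by positivity)
  set Q := 3 / (2 * √c) + 1 + 1 / c with hQ
  have hQ0 : 0 < Q := by positivity
  have h6 : 3 / (2 * √c) * E + E + 1 / c * E ≤ Q * (64 * κ * (D * (W / N * (s * M) * P₁))) := by
    rw [show 3 / (2 * √c) * E + E + 1 / c * E = Q * E by rw [hQ]; ring]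
    gcongr
  have h7 : rateFactor κ c * D * (R + W / N * (s * M) * P₁) =
      3 / 2 * D * R + Q * (64 * κ * (D * (W / N * (s * M) * P₁))) +
      (64 * κ * Q * (D * R) + 3 / 2 * (D * (W / N * (s * M) * P₁))) := by
    rw [rateFactor, ← hQ]; ring
  have h8 : 0 ≤ 64 * κ * Q * (D * R) + 3 / 2 * (D * (W / N * (s * M) * P₁)) := by positivity
  linarith

/-- The rate of PAGAN in a fixed geometry. -/
theorem attainsRate {d n : ℕ} {P : Measure (Fin d → ℝ)} {X : Set (Fin d → ℝ)}
    {F : (Fin d → ℝ) → (Fin d → ℝ) → ℝ} {g : (Fin d → ℝ) → (Fin d → ℝ) → (Fin d → ℝ)}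
    {r κ p ε δ c : ℝ} {C : Fin d → ℝ} {S : Fin n → Fin d → ℝ} (hd : 2 ≤ d) (hr : 0 ≤ r)
    (hκ : 0 < κ) (hc : 0 < c) (hp : 1 ≤ p) (hε : 0 < ε) (hε1 : ε ≤ 1) (hδ : 0 < δ) (hδ1 : δ < 1)
    (hn : 0 < n) (hN : 1 ≤ n * ε) (hX : IsCompact X) (hXc : Convex ℝ X) (hXn : X.Nontrivial)
    (hg : IsGradientOracle X F g) (hC : ∀ j, 0 < C j) (hG : 0 < lipMoment P (2 * p) C)
    (hGt : lipMoment P (2 * p) C * ∑ j, C j ^ (-(1 / 2 : ℝ)) ≤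
      32 * (r * (∑ j, sigma P j ^ (2 / 3 : ℝ)) ^ (3 / 2 : ℝ)) * √p)
    (hS : empLipMoment S p C ≤ κ * lipMoment P (2 * p) C) :
    AttainsRate P X F g r κ p ε δ c (rateFactor κ c) C S := by
  intro Ω mΩ ν hν ℱ I ξ x hrun
  set T := ⌈c * (n : ℝ) ^ 2⌉₊
  set B := paganRadius P n X κ p ε δ C
  have hp0 : 0 < p := by linarith
  have hn' : (0 : ℝ) < n := by exact_mod_cast hn
  have hd' : (2 : ℝ) ≤ d := by exact_mod_cast hd
  have hD := diam_pos hX hXn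
  have hΔ := wdiam_pos hX hXn hC
  have hΔD := wdiam_le hX hXn.nonempty hC
  have : Nonempty (Fin d) := ⟨⟨0, by omega⟩⟩
  have ht : 0 < ∑ j, C j ^ (-(1 / 2 : ℝ)) :=
    Finset.sum_pos (fun j _ => Real.rpow_pos_of_pos (hC j) _) Finset.univ_nonempty
  set t := ∑ j, C j ^ (-(1 / 2 : ℝ)) with htd
  set D := Metric.diam X with hDd
  set Δ := wdiam (fun j => (C j)⁻¹) X with hΔd
  set G := lipMoment P (2 * p) C with hGd
  have hl : 0 < √(Real.log (1 / δ)) :=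
    Real.sqrt_pos.2 (Real.log_pos (by rw [lt_div_iff₀ hδ]; linarith))
  have hlM : √(Real.log (1 / δ)) ≤ √(Real.log (d / δ)) := by
    refine Real.sqrt_le_sqrt (Real.log_le_log (by positivity) ?_)
    gcongr; linarith
  have hM := half_le_sqrt_log_div hd' hδ hδ1
  have hL0 : 0 ≤ Real.log (d / δ) := by
    refine Real.log_nonneg ?_
    rw [le_div_iff₀ hδ]; linarith
  set M := √(Real.log (d / δ)) with hMd
  set l := √(Real.log (1 / δ)) with hld
  have hN0 : (0 : ℝ) < n * ε := by linarith
  have hBeq : B = κ * G * (Δ * (n * ε) / (D * l * t)) ^ (1 / p) := by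
    rw [htd, hDd, hΔd, hGd, hld, ← mul_assoc]
    rfl
  -- Balanced at κG, which dominates the empirical moment of S by `hS`.
  have hbal := radius_balance hD hl ht hΔ hN0 hp (mul_pos hκ hG) hΔD hlM hM
  simp only [← hBeq] at hbal
  obtain ⟨hB, hbal1, hbal2⟩ := hbal
  have hTc : c * (n : ℝ) ^ 2 ≤ T := Nat.le_ceil _
  have hT : 0 < T := Nat.ceil_pos.2 (by positivity)
  have hreg := hrun.regret hX hXc hD (fun j => div_pos (hC j) (by positivity)) hε hn hT hg
    (b := fun i => Δ * (B * (wnorm C (S i) / B) ^ p))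
    fun y hy i z hz => clipping_bias_le hX hC hB hp (hg.bound _ z hz) hz hy
  refine ⟨hreg.1, fun y hy => ?_⟩
  have h1 := hreg.2 y hy
  have hR := adaRegret_nonneg ν g S T I x
  have hH0 : 0 ≤ empLipMoment S p C := Real.rpow_nonneg (mul_nonneg (by positivity)
    (Finset.sum_nonneg fun i _ => Real.rpow_nonneg (wnorm_nonneg _ _) _)) _
  have ha : ∀ j, √(C j / B ^ 2)⁻¹ = B * C j ^ (-(1 / 2 : ℝ)) := fun j => by
    rw [← sqrt_inv_eq_rpow (hC j), inv_div, div_eq_mul_inv, Real.sqrt_mul (sq_nonneg _),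
      Real.sqrt_sq hB.le]
  have hb : 1 / (n : ℝ) * ∑ i, Δ * (B * (wnorm C (S i) / B) ^ p) ≤ D * t * (l * B) / (n * ε) := by
    have h2 : 1 / (n : ℝ) * ∑ i, Δ * (B * (wnorm C (S i) / B) ^ p) =
        Δ * (B * (empLipMoment S p C / B) ^ p) := by
      rw [Real.div_rpow hH0 hB.le, empLipMoment_rpow S hp0]
      simp only [Real.div_rpow (wnorm_nonneg C _) hB.le]
      rw [← Finset.mul_sum, ← Finset.mul_sum, ← Finset.sum_div]
      ring
    rw [h2, ← hbal1]
    gcongr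
  simp only [ha, ← Finset.mul_sum, ← htd] at h1
  have hP : 1 ≤ (n * ε) ^ (1 / p) := Real.one_le_rpow hN (by positivity)
  have hmain := rate_sum_le hκ hc hD hR ht hN hP hM hn' hε rfl hε1 hTc
    (by positivity) hbal2 hH0 hS hG hGt hb
  have h4 : 1 / (n : ℝ) * ∑ i, ∑ j, |S i j| ≤ empLipMoment S p C * t := mean_l1_le hn S hp hC
  have h5 : (1 / (n : ℝ) * ∑ i, ∑ j, |S i j|) * D / T ≤ empLipMoment S p C * t * D / T := by
    gcongr
  have h6 : ∫ ω, (empLoss F S (paganOutput T x ω) - empLoss F S y) ∂ν ≤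
      rateFactor κ c * D * (adaRegret ν g S T I x +
        r * (∑ j, sigma P j ^ (2 / 3 : ℝ)) ^ (3 / 2 : ℝ) / (n * ε) * (√p * M) *
          (n * ε) ^ (1 / p)) := by
    simp only [← Finset.mul_sum] at hmain
    exact h1.trans (le_trans (by gcongr) hmain)
  have hK : 0 < rateFactor κ c := by rw [rateFactor]; positivity
  refine ⟨by rwa [Real.sqrt_mul hp0.le], fun q hq hpd hNq => h6.trans ?_⟩
  have hW : 0 ≤ r * (∑ j, sigma P j ^ (2 / 3 : ℝ)) ^ (3 / 2 : ℝ) / (n * ε) :=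
    div_nonneg (mul_nonneg hr (Real.rpow_nonneg (Finset.sum_nonneg fun j _ =>
      Real.rpow_nonneg (sigma_nonneg P j) _) _)) hN0.le
  have h7 : √p * M ≤ Real.log (d / δ) := by
    have : p ≤ Real.log (d / δ) := by
      rw [hpd]
      refine Real.log_le_log (by linarith) ?_
      rw [le_div_iff₀ hδ]; nlinarith
    calc √p * M ≤ M * M := by gcongr; exact Real.sqrt_le_sqrt this
      _ = _ := Real.mul_self_sqrt hL0
  -- For p = log d one has d^(q/p) = e^q.
  have h8 : (n * ε) ^ (1 / p) ≤ Real.exp q := by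
    refine (Real.rpow_le_rpow hN0.le hNq (by positivity)).trans_eq ?_
    rw [← Real.rpow_mul (by linarith), Real.rpow_def_of_pos (by linarith), ← hpd]
    congr 1; field_simp
  have h9 : 1 ≤ Real.exp q := Real.one_le_exp hq
  set W := r * (∑ j, sigma P j ^ (2 / 3 : ℝ)) ^ (3 / 2 : ℝ) / (n * ε) with hWd
  calc rateFactor κ c * D * (adaRegret ν g S T I x + W * (√p * M) * (n * ε) ^ (1 / p))
      ≤ rateFactor κ c * D * (Real.exp q * adaRegret ν g S T I x +
        W * Real.log (d / δ) * Real.exp q) := by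
        gcongr
        exact le_mul_of_one_le_left hR h9
    _ = _ := by ring

/-! ### The estimated geometry -/

theorem wnorm_le_sqrt_mul {d : ℕ} {v w : Fin d → ℝ} {a : ℝ} (ha : 0 ≤ a)
    (h : ∀ j, v j ≤ a * w j) (x : Fin d → ℝ) : wnorm v x ≤ √a * wnorm w x := by
  rw [wnorm, wnorm, ← Real.sqrt_mul ha, Finset.mul_sum]
  refine Real.sqrt_le_sqrt (Finset.sum_le_sum fun j _ => ?_)
  rw [← mul_assoc]
  exact mul_le_mul_of_nonneg_right (h j) (sq_nonneg _)

theorem empLipMoment_mono {d n : ℕ} {v w : Fin d → ℝ} (h : ∀ j, v j ≤ w j)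
    (S : Fin n → Fin d → ℝ) {p : ℝ} (hp : 0 < p) : empLipMoment S p v ≤ empLipMoment S p w := by
  have h1 : ∀ x, wnorm v x ≤ wnorm w x := fun x => by
    simpa using wnorm_le_sqrt_mul zero_le_one (fun j => by simpa using h j) x
  have h2 := wnorm_nonneg (d := d)
  refine Real.rpow_le_rpow (mul_nonneg (by positivity) (Finset.sum_nonneg fun i _ =>
    Real.rpow_nonneg (h2 _ _) _)) (mul_le_mul_of_nonneg_left (Finset.sum_le_sum fun i _ =>
    Real.rpow_le_rpow (h2 _ _) (h1 _) hp.le) (by positivity)) (by positivity)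

theorem lipMoment_le_sqrt_mul {d : ℕ} {P : Measure (Fin d → ℝ)} {v w : Fin d → ℝ} {a q : ℝ}
    (ha : 0 ≤ a) (h : ∀ j, v j ≤ a * w j) (hq : 0 < q)
    (hw : Integrable (fun z => wnorm w z ^ q) P) : lipMoment P q v ≤ √a * lipMoment P q w := by
  have h2 := wnorm_nonneg (d := d)
  have h3 : 0 ≤ ∫ z, wnorm w z ^ q ∂P := integral_nonneg fun z => Real.rpow_nonneg (h2 _ _) _
  have h4 : ∫ z, wnorm v z ^ q ∂P ≤ √a ^ q * ∫ z, wnorm w z ^ q ∂P := by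
    rw [← integral_const_mul]
    refine integral_mono_of_nonneg (Filter.Eventually.of_forall fun z =>
      Real.rpow_nonneg (h2 _ _) _) (hw.const_mul _) (Filter.Eventually.of_forall fun z => ?_)
    simp only
    rw [← Real.mul_rpow (Real.sqrt_nonneg _) (h2 _ _)]
    exact Real.rpow_le_rpow (h2 _ _) (wnorm_le_sqrt_mul ha h z) hq.le
  refine (Real.rpow_le_rpow (integral_nonneg fun z => Real.rpow_nonneg (h2 _ _) _) h4
    (by positivity)).trans_eq ?_
  rw [Real.mul_rpow (by positivity) h3, ← Real.rpow_mul (Real.sqrt_nonneg _),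
    mul_one_div_cancel hq.ne', Real.rpow_one, lipMoment]

/-- The geometry `C_jj = (r max(σ_j, d⁻²))^(-4/3)`. -/
noncomputable def idealGeometry {d : ℕ} (P : Measure (Fin d → ℝ)) (r : ℝ) (j : Fin d) : ℝ :=
  (r * max (sigma P j) (1 / (d : ℝ) ^ 2)) ^ (-(4 / 3 : ℝ))

section

variable {d : ℕ} {P : Measure (Fin d → ℝ)} {r : ℝ} {s : Fin d → ℝ}

theorem max_sigma_pos (j : Fin d) : 0 < max (sigma P j) (1 / (d : ℝ) ^ 2) := by
  have : (0 : ℝ) < d := by exact_mod_cast j.pos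
  exact lt_max_of_lt_right (by positivity)

theorem idealGeometry_pos (hr : 0 < r) (j : Fin d) : 0 < idealGeometry P r j :=
  Real.rpow_pos_of_pos (mul_pos hr (max_sigma_pos j)) _

/-- An estimate low by a factor 2 inflates the power -4/3 by 2^(4/3) ≤ 4, which the factor 1/4 in
the estimated geometry absorbs. One high by 8 deflates it by 8^(4/3) = 16, hence 64 = 16 · 4. -/
theorem estGeometry_bounds (hr : 0 < r) {j : Fin d}
    (h1 : 1 / 2 * max (sigma P j) (1 / (d : ℝ) ^ 2) ≤ s j)
    (h2 : s j ≤ 8 * max (sigma P j) (1 / (d : ℝ) ^ 2)) :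
    estGeometry r s j ≤ idealGeometry P r j ∧ idealGeometry P r j ≤ 64 * estGeometry r s j := by
  have hm := max_sigma_pos (P := P) j
  set m := max (sigma P j) (1 / (d : ℝ) ^ 2) with hmd
  have hs : 0 < s j := by linarith
  rw [estGeometry, idealGeometry, ← hmd]
  constructor
  · have h3 : (r * s j) ^ (-(4 / 3 : ℝ)) ≤ (1 / 2 * (r * m)) ^ (-(4 / 3 : ℝ)) := by
      refine Real.rpow_le_rpow_of_nonpos (by positivity) ?_ (by norm_num)
      nlinarith
    rw [Real.mul_rpow (x := 1 / 2) (y := r * m) (by norm_num) (by positivity)] at h3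
    have h4 : (1 / 2 : ℝ) ^ (-(4 / 3 : ℝ)) ≤ 4 := by
      rw [one_div, Real.inv_rpow (by norm_num), ← Real.rpow_neg (by norm_num), neg_neg]
      refine (Real.rpow_le_rpow_of_exponent_le one_le_two (by norm_num : (4 / 3 : ℝ) ≤ 2)).trans ?_
      norm_num
    have h5 := mul_le_mul_of_nonneg_right h4
      (Real.rpow_nonneg (by positivity : 0 ≤ r * m) (-(4 / 3 : ℝ)))
    linarith
  · have h3 : (8 * (r * m)) ^ (-(4 / 3 : ℝ)) ≤ (r * s j) ^ (-(4 / 3 : ℝ)) := by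
      refine Real.rpow_le_rpow_of_nonpos (by positivity) ?_ (by norm_num)
      nlinarith
    rw [Real.mul_rpow (by norm_num) (by positivity)] at h3
    have h4 : (8 : ℝ) ^ (-(4 / 3 : ℝ)) = 1 / 16 := by
      rw [show (8 : ℝ) = 2 ^ (3 : ℝ) by norm_num, ← Real.rpow_mul (by norm_num),
        show (3 : ℝ) * -(4 / 3) = -(4 : ℕ) by norm_num, Real.rpow_neg (by norm_num),
        Real.rpow_natCast]
      norm_num
    rw [h4] at h3
    linarith

theorem idealGeometry_mul_sq_le (hr : 0 < r) (j : Fin d) :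
    idealGeometry P r j * sigma P j ^ 2 ≤ r ^ (-(4 / 3 : ℝ)) * sigma P j ^ (2 / 3 : ℝ) := by
  rcases (sigma_nonneg P j).eq_or_lt with h0 | h0
  · rw [← h0, Real.zero_rpow (by norm_num)]; simp
  have h1 : idealGeometry P r j ≤ (r * sigma P j) ^ (-(4 / 3 : ℝ)) := by
    refine Real.rpow_le_rpow_of_nonpos (by positivity) ?_ (by norm_num)
    gcongr
    exact le_max_left _ _
  refine (mul_le_mul_of_nonneg_right h1 (sq_nonneg _)).trans_eq ?_
  rw [Real.mul_rpow hr.le h0.le, mul_assoc, ← Real.rpow_natCast, ← Real.rpow_add h0]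
  norm_num

theorem idealGeometry_rpow_le (hr : 0 < r) (j : Fin d) :
    idealGeometry P r j ^ (-(1 / 2 : ℝ)) ≤
      r ^ (2 / 3 : ℝ) * (sigma P j ^ (2 / 3 : ℝ) + (1 / (d : ℝ) ^ 2) ^ (2 / 3 : ℝ)) := by
  have hm := max_sigma_pos (P := P) j
  have hσ := sigma_nonneg P j
  rw [idealGeometry, ← Real.rpow_mul (by positivity),
    show -(4 / 3 : ℝ) * -(1 / 2) = 2 / 3 by norm_num, Real.mul_rpow hr.le hm.le]
  gcongr
  rcases max_cases (sigma P j) (1 / (d : ℝ) ^ 2) with h | h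
  · rw [h.1]; exact le_add_of_nonneg_right (by positivity)
  · rw [h.1]; exact le_add_of_nonneg_left (by positivity)

theorem estGeometry_pos (hr : 0 < r) {j : Fin d}
    (h1 : 1 / 2 * max (sigma P j) (1 / (d : ℝ) ^ 2) ≤ s j) : 0 < estGeometry r s j := by
  have := max_sigma_pos (P := P) j
  have hs : 0 < s j := by linarith
  rw [estGeometry]; positivity

theorem estGeometry_rpow_le (hr : 0 < r) {j : Fin d}
    (h1 : 1 / 2 * max (sigma P j) (1 / (d : ℝ) ^ 2) ≤ s j)
    (h2 : s j ≤ 8 * max (sigma P j) (1 / (d : ℝ) ^ 2)) :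
    estGeometry r s j ^ (-(1 / 2 : ℝ)) ≤
      8 * (r ^ (2 / 3 : ℝ) * (sigma P j ^ (2 / 3 : ℝ) + (1 / (d : ℝ) ^ 2) ^ (2 / 3 : ℝ))) := by
  have h3 := (estGeometry_bounds hr h1 h2).2
  have h4 := estGeometry_pos hr h1
  have h5 := idealGeometry_pos (P := P) hr j
  refine le_trans ?_ (mul_le_mul_of_nonneg_left (idealGeometry_rpow_le hr j) (by norm_num))
  rw [← sqrt_inv_eq_rpow h4, ← sqrt_inv_eq_rpow h5]
  refine Real.sqrt_le_iff.2 ⟨by positivity, ?_⟩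
  rw [mul_pow, Real.sq_sqrt (by positivity), ← one_div, ← one_div, mul_one_div,
    div_le_div_iff₀ h4 h5]
  linarith

/-- The floor d⁻² contributes d · d^(-4/3) = d^(-1/3) to the trace; this is the origin of the lower
bound assumed on ∑ σ_j^(2/3). -/
theorem sum_inv_sq_rpow_le {Y : ℝ} (hd : 0 < d) (hY : (d : ℝ) ^ (-(1 / 3 : ℝ)) ≤ Y) :
    ∑ _j : Fin d, (1 / (d : ℝ) ^ 2) ^ (2 / 3 : ℝ) ≤ Y := by
  have hd' : (0 : ℝ) < d := by exact_mod_cast hd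
  refine le_of_eq_of_le ?_ hY
  rw [Finset.sum_const, Finset.card_univ, Fintype.card_fin, nsmul_eq_mul, one_div,
    Real.inv_rpow (by positivity), ← Real.rpow_natCast, ← Real.rpow_mul hd'.le,
    ← Real.rpow_neg hd'.le]
  nth_rewrite 1 [← Real.rpow_one (d : ℝ)]
  rw [← Real.rpow_add hd']
  norm_num

theorem sum_mul_sq_pos {C : Fin d → ℝ} (hC : ∀ j, 0 < C j)
    (hY : 0 < ∑ j, sigma P j ^ (2 / 3 : ℝ)) : 0 < ∑ j, C j * sigma P j ^ 2 := by
  obtain ⟨j, -, hj⟩ := Finset.exists_lt_of_sum_lt (s := Finset.univ) (f := fun _ : Fin d => (0 : ℝ))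
    (by simpa using hY)
  have h0 : sigma P j ≠ 0 := fun h => by
    simp only [h] at hj
    rw [Real.zero_rpow (by norm_num)] at hj
    exact lt_irrefl _ hj
  exact Finset.sum_pos' (fun j _ => mul_nonneg (hC j).le (sq_nonneg _))
    ⟨j, Finset.mem_univ j, mul_pos (hC j) (by positivity)⟩

variable [IsProbabilityMeasure P] {p : ℝ}

theorem BoundedMomentRatio.lipMoment_pos (h : BoundedMomentRatio P r) (hr : 2 ≤ r) (hp : 1 ≤ p)
    {C : Fin d → ℝ} (hC : ∀ j, 0 < C j) (hY : 0 < ∑ j, sigma P j ^ (2 / 3 : ℝ)) :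
    0 < lipMoment P (2 * p) C :=
  Real.rpow_pos_of_pos (h.integral_wnorm_rpow_pos hr hp (fun j => (hC j).le)
    (sum_mul_sq_pos hC hY)) _

/-- The exponent -4/3 turns both Cσ² and C^(-1/2) into σ^(2/3), and the powers of r cancel except
for one factor r. The constant is 32 = 2 · 16, where 16 is √64 from the comparison of geometries
times 2 for the floor. -/
theorem BoundedMomentRatio.lipMoment_mul_trace_le (h : BoundedMomentRatio P r) (hr : 2 ≤ r)
    (hp : 1 ≤ p) (hd : 0 < d) (hY : (d : ℝ) ^ (-(1 / 3 : ℝ)) ≤ ∑ j, sigma P j ^ (2 / 3 : ℝ))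
    (hs : ∀ j, 1 / 2 * max (sigma P j) (1 / (d : ℝ) ^ 2) ≤ s j ∧
      s j ≤ 8 * max (sigma P j) (1 / (d : ℝ) ^ 2)) :
    lipMoment P (2 * p) (estGeometry r s) * ∑ j, estGeometry r s j ^ (-(1 / 2 : ℝ)) ≤
      32 * (r * (∑ j, sigma P j ^ (2 / 3 : ℝ)) ^ (3 / 2 : ℝ)) * √p := by
  have hr0 : 0 < r := by linarith
  have hd' : (0 : ℝ) < d := by exact_mod_cast hd
  have hY0 : 0 < ∑ j, sigma P j ^ (2 / 3 : ℝ) := lt_of_lt_of_le (by positivity) hY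
  have hC : ∀ j, 0 < estGeometry r s j := fun j => estGeometry_pos hr0 (hs j).1
  have hW := sum_mul_sq_pos hC hY0
  have h1 := h.lipMoment_le hr hp (fun j => (hC j).le) hW
  have hd2 := sum_inv_sq_rpow_le hd hY
  set Y := ∑ j, sigma P j ^ (2 / 3 : ℝ) with hYd
  have h2 : ∑ j, estGeometry r s j * sigma P j ^ 2 ≤ r ^ (-(4 / 3 : ℝ)) * Y := by
    rw [hYd, Finset.mul_sum]
    exact Finset.sum_le_sum fun j _ => (mul_le_mul_of_nonneg_right
      (estGeometry_bounds hr0 (hs j).1 (hs j).2).1 (sq_nonneg _)).trans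
      (idealGeometry_mul_sq_le hr0 j)
  have h3 : ∑ j, estGeometry r s j ^ (-(1 / 2 : ℝ)) ≤ 16 * r ^ (2 / 3 : ℝ) * Y := by
    calc _ ≤ ∑ j, 8 * (r ^ (2 / 3 : ℝ) *
          (sigma P j ^ (2 / 3 : ℝ) + (1 / (d : ℝ) ^ 2) ^ (2 / 3 : ℝ))) :=
          Finset.sum_le_sum fun j _ => estGeometry_rpow_le hr0 (hs j).1 (hs j).2
      _ = 8 * r ^ (2 / 3 : ℝ) * (Y + ∑ _j : Fin d, (1 / (d : ℝ) ^ 2) ^ (2 / 3 : ℝ)) := by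
          rw [hYd, ← Finset.sum_add_distrib, Finset.mul_sum]
          exact Finset.sum_congr rfl fun j _ => by ring
      _ ≤ 8 * r ^ (2 / 3 : ℝ) * (Y + Y) := by gcongr
      _ = _ := by ring
  have h4 : √(r ^ (-(4 / 3 : ℝ)) * Y) = r ^ (-(2 / 3 : ℝ)) * Y ^ (1 / 2 : ℝ) := by
    rw [Real.sqrt_eq_rpow, Real.mul_rpow (by positivity) hY0.le, ← Real.rpow_mul hr0.le]
    norm_num
  have h5 : r ^ (-(2 / 3 : ℝ)) * r ^ (2 / 3 : ℝ) = 1 := by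
    rw [← Real.rpow_add hr0]; norm_num
  have h6 : Y ^ (1 / 2 : ℝ) * Y = Y ^ (3 / 2 : ℝ) := by
    nth_rewrite 2 [← Real.rpow_one Y]
    rw [← Real.rpow_add hY0]; norm_num
  calc _ ≤ (2 * r * √p * √(r ^ (-(4 / 3 : ℝ)) * Y)) * (16 * r ^ (2 / 3 : ℝ) * Y) := by
        refine mul_le_mul (h1.trans ?_) h3 (Finset.sum_nonneg fun j _ =>
          Real.rpow_nonneg (hC j).le _) (by positivity)
        gcongr
    _ = _ := by
        rw [h4]
        linear_combination 32 * r * √p * Y * Y ^ (1 / 2 : ℝ) * h5 + 32 * r * √p * h6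

/-- A sample that is typical for the ideal geometry satisfies the hypothesis on the empirical
Lipschitz moment in the estimated geometry. -/
theorem BoundedMomentRatio.empLipMoment_le (h : BoundedMomentRatio P r) (hr : 2 ≤ r)
    (hp : 1 ≤ p) (hY : 0 < ∑ j, sigma P j ^ (2 / 3 : ℝ))
    (hs : ∀ j, 1 / 2 * max (sigma P j) (1 / (d : ℝ) ^ 2) ≤ s j ∧
      s j ≤ 8 * max (sigma P j) (1 / (d : ℝ) ^ 2)) {n : ℕ} {z : Fin n → Fin d → ℝ}
    (hz : empLipMoment z p (idealGeometry P r) ≤ 2 * lipMoment P (2 * p) (idealGeometry P r)) :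
    empLipMoment z p (estGeometry r s) ≤ 16 * lipMoment P (2 * p) (estGeometry r s) := by
  have hr0 : 0 < r := by linarith
  have hC : ∀ j, 0 < estGeometry r s j := fun j => estGeometry_pos hr0 (hs j).1
  have h1 := empLipMoment_mono (fun j => (estGeometry_bounds hr0 (hs j).1 (hs j).2).1) z
    (by linarith : 0 < p)
  have h2 := lipMoment_le_sqrt_mul (by norm_num)
    (fun j => (estGeometry_bounds hr0 (hs j).1 (hs j).2).2) (by linarith : 0 < 2 * p)
    (h.wnorm_rpow_le hr hp (fun j => (hC j).le) (sum_mul_sq_pos hC hY)).1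
  -- The empirical moment does not increase on passing to the smaller estimated geometry, while the
  -- population moment loses at most √64 = 8; hence 16 = 2 · 8.
  rw [show √(64 : ℝ) = 8 by rw [show (64 : ℝ) = 8 ^ 2 by norm_num]; exact Real.sqrt_sq (by norm_num)]
    at h2
  linarith

end

theorem EnoughSamples.one_le {d n : ℕ} {r ε δ β : ℝ} (h : EnoughSamples d n r ε δ β) (hd : 2 ≤ d)
    (hr : 2 ≤ r) (hδ : 0 < δ) (hδ1 : δ < 1) (hβ : 0 < β) (hβ1 : β < 1) : 1 ≤ n * ε := by
  refine le_trans ?_ h.2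
  have h1 := log_eight_le hd hβ hβ1
  have h2 := log_two_le_log_iters hd hδ hδ1
  have h3 : (1 : ℝ) ≤ momentIters d := by
    exact_mod_cast one_le_two.trans (momentIters_spec hd).2.2.1
  have h4 : 1 ≤ √(d : ℝ) := Real.one_le_sqrt.2 (by exact_mod_cast one_le_two.trans hd)
  have h5 : 0.69 ≤ Real.log r := by
    have := Real.log_le_log two_pos hr
    linarith [Real.log_two_gt_d9]
  calc (1 : ℝ) ≤ 1000 * 2 ^ 2 * 1 * 1 * 0.69 ^ 2 * 0.6931 * 2.079 := by norm_num
    _ ≤ _ := by gcongr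

theorem attainsRate_of_accurate {d n : ℕ} {P : Measure (Fin d → ℝ)} [IsProbabilityMeasure P]
    {X : Set (Fin d → ℝ)} {F : (Fin d → ℝ) → (Fin d → ℝ) → ℝ}
    {g : (Fin d → ℝ) → (Fin d → ℝ) → (Fin d → ℝ)} {r κ p ε δ β c : ℝ} {s : Fin d → ℝ}
    {S : Fin n → Fin d → ℝ} (hd : 2 ≤ d) (hr : 2 ≤ r) (hκ : 0 < κ) (hc : 0 < c) (hp : 1 ≤ p)
    (hε : 0 < ε) (hε1 : ε ≤ 1) (hδ : 0 < δ) (hδ1 : δ < 1) (hβ : 0 < β) (hβ1 : β < 1)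
    (h : BoundedMomentRatio P r)
    (hY : (d : ℝ) ^ (-(1 / 3 : ℝ)) ≤ ∑ j, sigma P j ^ (2 / 3 : ℝ))
    (hn : EnoughSamples d n r ε δ β) (hX : IsCompact X) (hXc : Convex ℝ X) (hXn : X.Nontrivial)
    (hg : IsGradientOracle X F g)
    (hs : ∀ j, 1 / 2 * max (sigma P j) (1 / (d : ℝ) ^ 2) ≤ s j ∧
      s j ≤ 8 * max (sigma P j) (1 / (d : ℝ) ^ 2))
    (hS : empLipMoment S p (estGeometry r s) ≤ κ * lipMoment P (2 * p) (estGeometry r s)) :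
    AttainsRate P X F g r κ p ε δ c (rateFactor κ c) (estGeometry r s) S := by
  have hr0 : 0 < r := by linarith
  have hd0 : 0 < d := by omega
  have hC : ∀ j, 0 < estGeometry r s j := fun j => estGeometry_pos hr0 (hs j).1
  have hY0 : 0 < ∑ j, sigma P j ^ (2 / 3 : ℝ) :=
    lt_of_lt_of_le (Real.rpow_pos_of_pos (by exact_mod_cast hd0) _) hY
  exact attainsRate hd hr0.le hκ hc hp hε hε1 hδ hδ1 (hn.pos hd hr hβ hβ1)
    (hn.one_le hd hr hδ hδ1 hβ hβ1) hX hXc hXn hg hC (h.lipMoment_pos hr hp hC hY0)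
    (h.lipMoment_mul_trace_le hr hp hd0 hY hs) hS

end Pagan

theorem mainTheorem6 :
    -- privacy, for every dataset of vectors and every number of iterates
    (∀ (d n T : ℕ) (r ε δ : ℝ), 0 < ε → ε ≤ 1 → 0 < δ → δ < 1 →
      Pagan.IsDP (Pagan.momentMech d n T r ε δ) ε δ) ∧
    -- accuracy of the estimates
    (∀ (d n : ℕ) (P : Measure (Fin d → ℝ)) (_ : IsProbabilityMeasure P) (r ε δ β : ℝ),
      2 ≤ d → 2 ≤ r → 0 < ε → ε ≤ 1 → 0 < δ → δ < 1 → 0 < β → β < 1 →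
      Pagan.BoundedMomentRatio P r → (∀ j, Pagan.sigma P j ≤ 1) →
      Pagan.EnoughSamples d n r ε δ β →
      Pagan.sampleLaw P n r ε δ
        {w | ¬ ∀ j,
          (1 / 2) * max (Pagan.sigma P j) (1 / (d : ℝ) ^ 2) ≤ Pagan.momentOutput r w.1 w.2 j ∧
          Pagan.momentOutput r w.1 w.2 j ≤ 8 * max (Pagan.sigma P j) (1 / (d : ℝ) ^ 2)}
        ≤ ENNReal.ofReal β) ∧
    -- the rate of PAGAN with the estimated geometry
    (∀ κ c : ℝ, 2 ≤ κ → 0 < c → ∃ K : ℝ, 0 < K ∧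
      ∀ (d n : ℕ) (P : Measure (Fin d → ℝ)) (_ : IsProbabilityMeasure P) (r ε δ β p : ℝ)
        (X : Set (Fin d → ℝ)) (F : (Fin d → ℝ) → (Fin d → ℝ) → ℝ)
        (g : (Fin d → ℝ) → (Fin d → ℝ) → (Fin d → ℝ)),
        2 ≤ d → 2 ≤ r → 0 < ε → ε ≤ 1 → 0 < δ → δ < 1 → 0 < β → β < 1 → 1 ≤ p →
        Pagan.BoundedMomentRatio P r → (∀ j, Pagan.sigma P j ≤ 1) →
        (d : ℝ) ^ (-(1 / 3 : ℝ)) ≤ ∑ j, Pagan.sigma P j ^ (2 / 3 : ℝ) →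
        Pagan.EnoughSamples d n r ε δ β →
        IsCompact X → Convex ℝ X → X.Nontrivial → Pagan.IsGradientOracle X F g →
        -- on every dataset whose empirical Lipschitz moment is controlled by the population one
        Pagan.sampleLaw P n r ε δ
          {w | ¬ ∀ S : Fin n → Fin d → ℝ,
            let C := Pagan.estGeometry r (Pagan.momentOutput r w.1 w.2)
            Pagan.empLipMoment S p C ≤ κ * Pagan.lipMoment P (2 * p) C →
            Pagan.AttainsRate P X F g r κ p ε δ c K C S}
          ≤ ENNReal.ofReal β ∧
        -- in particular on the sample from which the geometry was estimated
        (16 ≤ κ → Pagan.sampleLaw P n r ε δ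
          {w | ¬ Pagan.AttainsRate P X F g r κ p ε δ c K
            (Pagan.estGeometry r (Pagan.momentOutput r w.1 w.2)) w.1}
          ≤ ENNReal.ofReal β + 1 / (n : ENNReal))) := by
  refine ⟨fun d n T r ε δ hε hε1 hδ hδ1 => Pagan.isDP_momentMech d n T r ε δ hε hε1 hδ hδ1,
    fun d n P hP r ε δ β hd hr hε hε1 hδ hδ1 hβ hβ1 h hσ hn =>
      Pagan.sampleLaw_inaccurate_le hd hr hε hδ hδ1 hβ hβ1 h hσ hn,
    fun κ c hκ hc => ⟨Pagan.rateFactor κ c, by rw [Pagan.rateFactor]; positivity, ?_⟩⟩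
  intro d n P hP r ε δ β p X F g hd hr hε hε1 hδ hδ1 hβ hβ1 hp h hσ hY hn hX hXc hXn hg
  have hacc := Pagan.sampleLaw_inaccurate_le hd hr hε hδ hδ1 hβ hβ1 h hσ hn
  have hrate := fun {s : Fin d → ℝ} {S : Fin n → Fin d → ℝ} =>
    Pagan.attainsRate_of_accurate (s := s) (S := S) hd hr (by linarith : 0 < κ) hc hp hε hε1 hδ
      hδ1 hβ hβ1 h hY hn hX hXc hXn hg
  refine ⟨(measure_mono fun w hw => ?_).trans hacc, fun hκ16 => ?_⟩
  · rw [Set.mem_ofPred_eq] at hw ⊢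
    -- Failure of the rate for some S forces inaccurate estimates, so uniformity over S costs no
    -- probability.
    exact fun hs => hw fun S hS => hrate hs hS
  have hr0 : 0 < r := by linarith
  have hY0 : 0 < ∑ j, Pagan.sigma P j ^ (2 / 3 : ℝ) :=
    lt_of_lt_of_le (Real.rpow_pos_of_pos (by exact_mod_cast (by omega : 0 < d)) _) hY
  have hC : ∀ j, 0 < Pagan.idealGeometry P r j := Pagan.idealGeometry_pos hr0
  -- Applied in the ideal geometry, which does not depend on the sample; the probability 1/n is the
  -- only extra loss for S = z.
  have hcheb := h.measure_empLipMoment_gt_le hr hp (fun j => (hC j).le)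
    (Pagan.sum_mul_sq_pos hC hY0) (hn.pos hd hr hβ hβ1)
  rw [← Pagan.sampleLaw_fst P n r ε δ] at hcheb
  refine (measure_mono fun w hw => ?_).trans ((measure_union_le _ _).trans (add_le_add hacc hcheb))
  by_contra hcon
  rw [Set.mem_union, not_or, Set.mem_ofPred_eq, not_not, Set.mem_ofPred_eq, Set.mem_ofPred_eq,
    not_lt] at hcon
  have hG := h.lipMoment_pos hr hp (fun j => Pagan.estGeometry_pos hr0 (hcon.1 j).1) hY0
  exact hw (hrate hcon.1 ((h.empLipMoment_le hr hp hY0 hcon.1 hcon.2).trans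
    (mul_le_mul_of_nonneg_right hκ16 hG.le)))
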